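/- **Proposition 1.3.** Let $k$ be a finite field of odd characteristic. Let $\mathcal H$ be the split quaternion algebra over $k$ with basis $1,e_1,e_2,e_3=e_1e_2$, where $e_1^2=e_2^2=1$ and $e_2e_1=-e_1e_2$. Let $\mathcal C=\mathcal H\times\mathcal H$ be the split octonion algebra, with product $(a,b)(c,d)=(ac+\bar d b,\,da+b\bar c)$, and let $\mathcal C^0$ be its 7-dimensional space of pure octonions. Put $X^{\pm}=(\tfrac12,\pm\tfrac12)$ and $X^0=X^+-X^-$, and use on $\mathcal C^0$ the basis $(e_1X^+,e_2X^+,e_3X^+,X^0,e_3X^-,e_2X^-,e_1X^-)$. Let $\mathrm{SO}_7(k)=\{g\in\mathrm{GL}_7(k): {}^t gQg=Q,\ \det g=1\}$, where $Q$ is the matrix in this basis of the form $(v,w)\mapsto N(v)+N(w)-N(v+w)$, with $N(a,b)=a\bar a-b\bar b$. The split group $\mathrm G_2(k)=\mathrm{Aut}(\mathcal C)$ is embedded in $\mathrm{SO}_7(k)$ by its action on $\mathcal C^0$. Let $\alpha$ be the short and $\beta$ the long simple root of $\mathrm G_2$, let $\mathbf x_\gamma:k\to \mathrm G_2(k)$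 denote the root subgroup of a root $\gamma$, and let $U$ be the maximal unipotent subgroup of $\mathrm G_2(k)$ generated by the images of $\mathbf x_\gamma$ for all positive roots $\gamma$. For a nontrivial additive character $\psi$ of $k$, let $\psi_U$ be the character of $U$ with $\psi_U(\mathbf x_\alpha(r))=\psi_U(\mathbf x_\beta(r))=\psi(r)$ and $\psi_U(\mathbf x_\gamma(r))=1$ for every non-simple positive root $\gamma$. All representations are complex. A representation $\Pi$ of $\mathrm G_2(k)$ is called *generic* if $\mathrm{Hom}_U(\Pi,\psi_U)\neq 0$ for some nontrivial $\psi$, and *cuspidal* if its space of coinvariants $\Pi_N$ is zero for the unipotent radical $N$ of every proper parabolic subgroup of $\mathrm G_2(k)$. A representation $\tau$ of $\mathrm{GL}_2(k)$ is called *generic* if $\mathrm{Hom}_{N_2}(\tau,\psi)\neq0$ for some nontrivial $\psi$, where $N_2=\{\begin{pmatrix}1&x\\&1\end{pmatrix}: x\in k\}$ and $\psi\begin{pmatrix}1&x\\&1\end{pmatrix}=\psi(x)$. Let $\widetilde P=(\mathrm{GL}_2(k)\times\mathrm{SO}_3(k))\ltimes\widetilde U$ be the parabolic subgroup of $\mathrm{SO}_7(k)$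 consisting of the block upper triangular matrices with diagonal blocks $a,b,a^*$ of sizes $2,3,2$, where $a\in\mathrm{GL}_2(k)$, $b\in\mathrm{SO}_3(k)$ and $a^*$ is determined by $a$. For a representation $(\tau,V_\tau)$ of $\mathrm{GL}_2(k)$ let $$I(\tau)=\mathrm{Ind}_{\widetilde P}^{\mathrm{SO}_7(k)}(\tau\otimes 1_{\mathrm{SO}_3})$$ be the space of all functions $\xi:\mathrm{SO}_7(k)\to V_\tau$ with $\xi(pg)=\tau(a)\xi(g)$ for all $g\in \mathrm{SO}_7(k)$ and all $p\in\widetilde P$ with first diagonal block $a$, on which $\mathrm{SO}_7(k)$ acts by right translation. If $\Pi$ is an irreducible generic cuspidal representation of $\mathrm G_2(k)$ and $\tau$ is an irreducible generic representation of $\mathrm{GL}_2(k)$, then $$\dim_{\mathbb C}\mathrm{Hom}_{\mathrm G_2(k)}\bigl(I(\tau)|_{\mathrm G_2(k)},\Pi\bigr)=1 .$$ -/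

import Mathlib

open scoped Quaternion Matrix MatrixGroups

namespace G2SO7

/-! ## Split octonions and the group `SO₇(k)` -/

section Octonions

variable (k : Type*) [Field k]

/-- The split quaternion algebra, with basis `e₀ = 1, e₁ = i, e₂ = j, e₃ = ij` and
`e₁² = e₂² = 1`, `e₂e₁ = -e₁e₂`. -/
abbrev SplitQuaternion : Type _ := ℍ[k, 1, 0, 1]

/-- The split octonion algebra `ℍ × ℍ`, with `ℍ` the split quaternions. -/
@[ext]
structure Octonion where
  /-- The first quaternion component. -/
  fst : SplitQuaternion k
  /-- The second quaternion component. -/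
  snd : SplitQuaternion k

variable {k} in
/-- An octonion as a pair of quaternions. -/
def Octonion.equivProd : Octonion k ≃ SplitQuaternion k × SplitQuaternion k where
  toFun x := (x.fst, x.snd)
  invFun x := ⟨x.1, x.2⟩

/-- The vector space structure of `Octonion k` is componentwise. -/
instance : AddCommGroup (Octonion k) := Octonion.equivProd.addCommGroup

instance : Module k (Octonion k) := Octonion.equivProd.module k

/-- The (non-associative) octonion product `(a, b)(c, d) = (ac + d̄b, da + bc̄)`. -/
instance : Mul (Octonion k) :=
  ⟨fun x y => ⟨x.fst * y.fst + star y.snd * x.snd, y.snd * x.fst + x.snd * star y.fst⟩⟩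

instance : One (Octonion k) := ⟨⟨1, 0⟩⟩

section

variable {k} (x y : Octonion k) (c : k)

@[simp] theorem Octonion.fst_add : (x + y).fst = x.fst + y.fst := rfl
@[simp] theorem Octonion.snd_add : (x + y).snd = x.snd + y.snd := rfl
@[simp] theorem Octonion.fst_sub : (x - y).fst = x.fst - y.fst := rfl
@[simp] theorem Octonion.snd_sub : (x - y).snd = x.snd - y.snd := rfl
@[simp] theorem Octonion.fst_smul : (c • x).fst = c • x.fst := rfl
@[simp] theorem Octonion.snd_smul : (c • x).snd = c • x.snd := rfl
@[simp] theorem Octonion.fst_one : (1 : Octonion k).fst = 1 := rfl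
@[simp] theorem Octonion.snd_one : (1 : Octonion k).snd = 0 := rfl
@[simp] theorem Octonion.fst_mul :
    (x * y).fst = x.fst * y.fst + star y.snd * x.snd := rfl
@[simp] theorem Octonion.snd_mul :
    (x * y).snd = y.snd * x.fst + x.snd * star y.fst := rfl

end

/-- The isotropic vectors `X⁺ = (1/2, 1/2)` and `X⁻ = (1/2, -1/2)`; `X⁰ = X⁺ - X⁻`. -/
def Xplus : Octonion k := ⟨⟨2⁻¹, 0, 0, 0⟩, ⟨2⁻¹, 0, 0, 0⟩⟩

/-- See `Xplus`. -/
def Xminus : Octonion k := ⟨⟨2⁻¹, 0, 0, 0⟩, ⟨-2⁻¹, 0, 0, 0⟩⟩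

/-- The basis `(e₁X⁺, e₂X⁺, e₃X⁺, X⁰, e₃X⁻, e₂X⁻, e₁X⁻)` of the space of pure octonions. -/
def pureBasis : Fin 7 → Octonion k :=
  ![⟨⟨0, 1, 0, 0⟩, 0⟩ * Xplus k, ⟨⟨0, 0, 1, 0⟩, 0⟩ * Xplus k, ⟨⟨0, 0, 0, 1⟩, 0⟩ * Xplus k,
    Xplus k - Xminus k,
    ⟨⟨0, 0, 0, 1⟩, 0⟩ * Xminus k, ⟨⟨0, 0, 1, 0⟩, 0⟩ * Xminus k, ⟨⟨0, 1, 0, 0⟩, 0⟩ * Xminus k]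

/-- The pure octonion with given coordinates in `pureBasis`. -/
def pureOct : (Fin 7 → k) →ₗ[k] Octonion k := Fintype.linearCombination k (pureBasis k)

/-- The Gram matrix in `pureBasis` of the bilinear form
`(v, w) ↦ N(v) + N(w) - N(v + w)`, where `N (a, b) = a ā - b b̄` is the octonion norm. -/
def formQ : Matrix (Fin 7) (Fin 7) k :=
  !![0, 0, 0, 0, 0, 0, 1;
     0, 0, 0, 0, 0, 1, 0;
     0, 0, 0, 0, -1, 0, 0;
     0, 0, 0, 2, 0, 0, 0;
     0, 0, -1, 0, 0, 0, 0;
     0, 1, 0, 0, 0, 0, 0;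
     1, 0, 0, 0, 0, 0, 0]

/-- `SO₇(k)`, the special orthogonal group of the form `formQ`. -/
def SO7 : Subgroup (GL (Fin 7) k) where
  carrier := {g | (g.val)ᵀ * formQ k * g.val = formQ k ∧ g.val.det = 1}
  one_mem' := by simp
  mul_mem' := by
    rintro a b ⟨ha, ha'⟩ ⟨hb, hb'⟩
    refine ⟨?_, by simp [ha', hb']⟩
    calc ((a * b).val)ᵀ * formQ k * (a * b).val
        = (b.val)ᵀ * ((a.val)ᵀ * formQ k * a.val) * b.val := by
          simp [Matrix.transpose_mul, Matrix.mul_assoc]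
      _ = formQ k := by rw [ha, hb]
  inv_mem' := by
    rintro a ⟨ha, ha'⟩
    have h1 : a.val * (a⁻¹).val = 1 := by rw [← Units.val_mul]; simp
    have h2 : ((a⁻¹).val)ᵀ * (a.val)ᵀ = 1 := by
      rw [← Matrix.transpose_mul, h1, Matrix.transpose_one]
    refine ⟨?_, ?_⟩
    · calc ((a⁻¹).val)ᵀ * formQ k * (a⁻¹).val
          = ((a⁻¹).val)ᵀ * ((a.val)ᵀ * formQ k * a.val) * (a⁻¹).val := by rw [ha]
        _ = (((a⁻¹).val)ᵀ * (a.val)ᵀ) * formQ k * (a.val * (a⁻¹).val) := by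
          simp only [Matrix.mul_assoc]
        _ = formQ k := by rw [h1, h2]; simp
    · simpa [Matrix.det_mul, ha'] using congrArg Matrix.det h1

/-- The underlying matrix of an element of `SO₇(k)`. -/
def mat : SO7 k →* Matrix (Fin 7) (Fin 7) k :=
  (Units.coeHom (Matrix (Fin 7) (Fin 7) k)).comp (SO7 k).subtype

/-- The split group `G₂(k)`, the automorphism group of the split octonions, embedded in `SO₇(k)`
through its action on the pure octonions: the elements of `SO₇(k)` which are the matrix, in the
basis `pureBasis`, of the restriction to the pure octonions of an algebra automorphism.
(Every automorphism of the octonions fixes `1`, preserves the pure octonions, and acts on them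
with determinant one by isometries, so this is the whole automorphism group.) -/
def G2 : Subgroup (SO7 k) where
  carrier := {g | ∃ f : Octonion k ≃ₗ[k] Octonion k,
    (∀ x y, f (x * y) = f x * f y) ∧ ∀ v, f (pureOct k v) = pureOct k (mat k g *ᵥ v)}
  one_mem' := ⟨.refl k _, by simp, by simp⟩
  mul_mem' := by
    rintro a b ⟨f, hf, hf'⟩ ⟨f', h, h'⟩
    exact ⟨f'.trans f, by simp [hf, h], by simp [hf', h']⟩
  inv_mem' := by
    rintro a ⟨f, hf, hf'⟩
    refine ⟨f.symm, fun x y => ?_, fun v => ?_⟩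
    · apply f.injective
      simp [hf]
    · apply f.injective
      have h1 : mat k a * mat k a⁻¹ = 1 := by rw [← map_mul, mul_inv_cancel, map_one]
      simp [hf', h1]

end Octonions

/-! ## The parabolic subgroup of `SO₇(k)` and the induced representation -/

section Parabolic

variable (k : Type*) [Field k]

/-- The parabolic subgroup of `SO₇(k)` of block upper triangular matrices, with diagonal blocks
of sizes `2, 3, 2`. Its elements have diagonal blocks `a, b, a*` with `a ∈ GL₂(k)` and
`b ∈ SO₃(k)`. -/
def parabolicSO7 : Subgroup (SO7 k) where
  carrier := {g | (mat k g).BlockTriangular (![0, 0, 1, 1, 1, 2, 2] : Fin 7 → ℕ)}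
  one_mem' := by
    rw [Set.mem_ofPred_eq, map_one]
    exact Matrix.blockTriangular_one
  mul_mem' := by
    intro a b ha hb
    rw [Set.mem_ofPred_eq, map_mul]
    exact Matrix.BlockTriangular.mul ha hb
  inv_mem' := by
    intro a ha
    have h : mat k a⁻¹ = (mat k a)⁻¹ := by simp [mat]
    have : Invertible (mat k a) := a.val.invertible
    simpa [h] using Matrix.blockTriangular_inv_of_blockTriangular ha

/-- The projection `(a, b, u) ↦ a` of the parabolic subgroup onto the factor `GL₂(k)` of its
Levi subgroup `GL₂(k) × SO₃(k)`: the upper left `2 × 2` block. -/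
def toGL2 : parabolicSO7 k →* GL (Fin 2) k :=
  MonoidHom.toHomUnits
    { toFun := fun g => (mat k g.val).submatrix (Fin.castLE (by norm_num)) (Fin.castLE (by norm_num))
      map_one' := by ext i j; fin_cases i <;> fin_cases j <;> simp
      map_mul' := by
        intro a b
        have hb := b.2
        ext i j
        have hz (l : Fin 7) (hl : 2 ≤ l) : mat k b.val l 0 = 0 ∧ mat k b.val l 1 = 0 := by
          constructor <;> apply hb <;> fin_cases l <;> simp_all
        fin_cases i <;> fin_cases j <;>
          simp [Matrix.mul_apply, Fin.sum_univ_succ, hz] }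

variable {k} {W : Type*} [AddCommGroup W] [Module ℂ W]

/-- `I(τ)`, the representation of `SO₇(k)` induced from `τ ⊗ 1` on the parabolic subgroup with Levi
`GL₂(k) × SO₃(k)`: right translation on the functions `ξ : SO₇(k) → W` with
`ξ ((a, b, u) g) = τ(a) ξ(g)`. -/
noncomputable def inducedRep (τ : Representation ℂ (GL (Fin 2) k) W) :=
  Representation.coind (parabolicSO7 k).subtype (τ.comp (toGL2 k))

end Parabolic

/-! ## Root subgroups of `G₂(k)` -/

theorem transpose_seven {k : Type*} (M : Matrix (Fin 7) (Fin 7) k) : Mᵀ =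
  !![M 0 0, M 1 0, M 2 0, M 3 0, M 4 0, M 5 0, M 6 0;
     M 0 1, M 1 1, M 2 1, M 3 1, M 4 1, M 5 1, M 6 1;
     M 0 2, M 1 2, M 2 2, M 3 2, M 4 2, M 5 2, M 6 2;
     M 0 3, M 1 3, M 2 3, M 3 3, M 4 3, M 5 3, M 6 3;
     M 0 4, M 1 4, M 2 4, M 3 4, M 4 4, M 5 4, M 6 4;
     M 0 5, M 1 5, M 2 5, M 3 5, M 4 5, M 5 5, M 6 5;
     M 0 6, M 1 6, M 2 6, M 3 6, M 4 6, M 5 6, M 6 6] := by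
  ext i j
  fin_cases i <;> fin_cases j <;> rfl

section Roots

variable {k : Type*} [Field k]

/-- The positive roots of `G₂`; `α` is the short and `β` the long simple root. -/
inductive PosRoot
  /-- `α` -/
  | a
  /-- `β` -/
  | b
  /-- `α + β` -/
  | ab
  /-- `2α + β` -/
  | aab
  /-- `3α + β` -/
  | aaab
  /-- `3α + 2β` -/
  | aaabb

open PosRoot

/-- The matrix of `x_γ(r)` in the basis `pureBasis`, for a positive root `γ`. -/
def rootMatrix : PosRoot → k → Matrix (Fin 7) (Fin 7) k
  | a, r => !![1, 0, 0, 0, 0, 0, 0;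
               0, 1, 0, -2 * r, 0, -r ^ 2, 0;
               0, 0, 1, 0, 0, 0, 0;
               0, 0, 0, 1, 0, r, 0;
               -r, 0, 0, 0, 1, 0, 0;
               0, 0, 0, 0, 0, 1, 0;
               0, 0, -r, 0, 0, 0, 1]
  | b, r => !![1, r, 0, 0, 0, 0, 0;
               0, 1, 0, 0, 0, 0, 0;
               0, 0, 1, 0, 0, 0, 0;
               0, 0, 0, 1, 0, 0, 0;
               0, 0, 0, 0, 1, 0, 0;
               0, 0, 0, 0, 0, 1, -r;
               0, 0, 0, 0, 0, 0, 1]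
  | ab, r => !![1, 0, 0, -2 * r, 0, 0, -r ^ 2;
                0, 1, 0, 0, 0, 0, 0;
                0, 0, 1, 0, 0, 0, 0;
                0, 0, 0, 1, 0, 0, r;
                0, r, 0, 0, 1, 0, 0;
                0, 0, r, 0, 0, 1, 0;
                0, 0, 0, 0, 0, 0, 1]
  | aab, r => !![1, 0, 0, 0, 0, -r, 0;
                 0, 1, 0, 0, 0, 0, r;
                 0, 0, 1, 0, 0, 0, 0;
                 0, 0, -r, 1, 0, 0, 0;
                 0, 0, r ^ 2, -2 * r, 1, 0, 0;
                 0, 0, 0, 0, 0, 1, 0;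
                 0, 0, 0, 0, 0, 0, 1]
  | aaab, r => !![1, 0, 0, 0, 0, 0, 0;
                  0, 1, r, 0, 0, 0, 0;
                  0, 0, 1, 0, 0, 0, 0;
                  0, 0, 0, 1, 0, 0, 0;
                  0, 0, 0, 0, 1, r, 0;
                  0, 0, 0, 0, 0, 1, 0;
                  0, 0, 0, 0, 0, 0, 1]
  | aaabb, r => !![1, 0, r, 0, 0, 0, 0;
                   0, 1, 0, 0, 0, 0, 0;
                   0, 0, 1, 0, 0, 0, 0;
                   0, 0, 0, 1, 0, 0, 0;
                   0, 0, 0, 0, 1, 0, r;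
                   0, 0, 0, 0, 0, 1, 0;
                   0, 0, 0, 0, 0, 0, 1]

theorem rootMatrix_zero (γ : PosRoot) : rootMatrix γ (0 : k) = 1 := by
  ext i j
  cases γ <;> fin_cases i <;> fin_cases j <;> simp [rootMatrix]


theorem rootMatrix_add (γ : PosRoot) (r s : k) :
    rootMatrix γ (r + s) = rootMatrix γ r * rootMatrix γ s := by
  cases γ <;> simp [rootMatrix, Matrix.vecMul_cons] <;> ring_nf <;> simp

theorem rootMatrix_form (γ : PosRoot) (r : k) :
    (rootMatrix γ r)ᵀ * formQ k * rootMatrix γ r = formQ k := by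
  rw [transpose_seven]
  cases γ <;> simp [rootMatrix, formQ, Matrix.vecMul_cons] <;> ring_nf <;> simp

/-- The root element `x_γ(r)` as an invertible matrix. -/
def rootGL (γ : PosRoot) (r : k) : GL (Fin 7) k where
  val := rootMatrix γ r
  inv := rootMatrix γ (-r)
  val_inv := by rw [← rootMatrix_add]; simp [rootMatrix_zero]
  inv_val := by rw [← rootMatrix_add]; simp [rootMatrix_zero]

theorem rootMatrix_det [NeZero (2 : k)] (γ : PosRoot) (r : k) : (rootMatrix γ r).det = 1 := by
  have hq : (formQ k).det ≠ 0 := by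
    have h : formQ k * !![0, 0, 0, 0, 0, 0, 1;
     0, 0, 0, 0, 0, 1, 0;
     0, 0, 0, 0, -1, 0, 0;
     0, 0, 0, 2⁻¹, 0, 0, 0;
     0, 0, -1, 0, 0, 0, 0;
     0, 1, 0, 0, 0, 0, 0;
     1, 0, 0, 0, 0, 0, 0] = 1 := by
      ext i j
      fin_cases i <;> fin_cases j <;>
        simp [formQ, Matrix.mul_apply, Fin.sum_univ_succ, NeZero.ne]
    have := congrArg Matrix.det h
    rw [Matrix.det_mul, Matrix.det_one] at this
    exact left_ne_zero_of_mul_eq_one this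
  have h1 : r = r / 2 + r / 2 := (add_halves r).symm
  rw [h1, rootMatrix_add, Matrix.det_mul]
  have h2 := congrArg Matrix.det (rootMatrix_form γ (r / 2))
  rw [Matrix.det_mul, Matrix.det_mul, Matrix.det_transpose] at h2
  apply mul_right_cancel₀ hq
  linear_combination h2


theorem pureOct_apply [NeZero (2 : k)] (x : Fin 7 → k) :
    pureOct k x = ⟨⟨0, (x 0 + x 6) / 2, (x 1 + x 5) / 2, (x 2 + x 4) / 2⟩,
      ⟨x 3, (x 0 - x 6) / 2, (x 1 - x 5) / 2, (x 2 - x 4) / 2⟩⟩ := by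
  have h2 : (2 : k) ≠ 0 := NeZero.ne 2
  ext <;> simp [pureOct, Fintype.linearCombination_apply, Fin.sum_univ_succ, pureBasis, Xplus,
    Xminus] <;> field_simp <;> ring

/-- Octonions in coordinates with respect to `1` and `pureBasis`. -/
def octEquiv [NeZero (2 : k)] : (k × (Fin 7 → k)) ≃ₗ[k] Octonion k where
  toFun x := x.1 • (1 : Octonion k) + pureOct k x.2
  map_add' x y := by simp [add_smul]; abel
  map_smul' c x := by simp [mul_smul]
  invFun u := (u.fst.re, ![u.fst.imI + u.snd.imI, u.fst.imJ + u.snd.imJ, u.fst.imK + u.snd.imK,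
    u.snd.re, u.fst.imK - u.snd.imK, u.fst.imJ - u.snd.imJ, u.fst.imI - u.snd.imI])
  left_inv x := by
    obtain ⟨t, x⟩ := x
    have h2 : (2 : k) ≠ 0 := NeZero.ne 2
    simp only [pureOct_apply]
    refine Prod.ext (by simp) ?_
    ext i
    fin_cases i <;> simp <;> field_simp <;> ring
  right_inv u := by
    have h2 : (2 : k) ≠ 0 := NeZero.ne 2
    simp only [pureOct_apply]
    ext <;> simp <;> field_simp <;> ring

theorem octEquiv_apply [NeZero (2 : k)] (x : k × (Fin 7 → k)) :
    octEquiv x = x.1 • (1 : Octonion k) + pureOct k x.2 := rfl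

theorem octEquiv_symm_apply [NeZero (2 : k)] (u : Octonion k) :
    octEquiv.symm u = (u.fst.re, ![u.fst.imI + u.snd.imI, u.fst.imJ + u.snd.imJ,
      u.fst.imK + u.snd.imK, u.snd.re, u.fst.imK - u.snd.imK, u.fst.imJ - u.snd.imJ,
      u.fst.imI - u.snd.imI]) := rfl

/-- The linear automorphism of the octonions which fixes `1` and acts by `x_γ(r)` on pure
octonions. -/
def rootAut [NeZero (2 : k)] (γ : PosRoot) (r : k) : Octonion k ≃ₗ[k] Octonion k :=
  octEquiv.symm.trans (LinearEquiv.trans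
    { toFun := fun x => (x.1, rootMatrix γ r *ᵥ x.2)
      invFun := fun x => (x.1, rootMatrix γ (-r) *ᵥ x.2)
      map_add' := fun x y => by simp [Matrix.mulVec_add]
      map_smul' := fun c x => by simp [Matrix.mulVec_smul]
      left_inv := fun x => by simp [← rootMatrix_add, rootMatrix_zero]
      right_inv := fun x => by simp [← rootMatrix_add, rootMatrix_zero] } octEquiv)

theorem rootAut_apply [NeZero (2 : k)] (γ : PosRoot) (r : k) (u : Octonion k) :
    rootAut γ r u = (octEquiv.symm u).1 • (1 : Octonion k)
      + pureOct k (rootMatrix γ r *ᵥ (octEquiv.symm u).2) := rfl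

/-- The octonion `a X⁺ + b X⁻ + x₁ e₁X⁺ + x₂ e₂X⁺ + x₃ e₃X⁺ + y₃ e₃X⁻ + y₂ e₂X⁻ + y₁ e₁X⁻`. -/
def zorn (a b x1 x2 x3 y3 y2 y1 : k) : Octonion k :=
  ⟨⟨(a + b) / 2, (x1 + y1) / 2, (x2 + y2) / 2, (x3 + y3) / 2⟩,
    ⟨(a - b) / 2, (x1 - y1) / 2, (x2 - y2) / 2, (x3 - y3) / 2⟩⟩

theorem exists_eq_zorn [NeZero (2 : k)] (u : Octonion k) :
    ∃ a b x1 x2 x3 y3 y2 y1, u = zorn a b x1 x2 x3 y3 y2 y1 := by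
  have h2 : (2 : k) ≠ 0 := NeZero.ne 2
  obtain ⟨⟨p, q, r, s⟩, ⟨p', q', r', s'⟩⟩ := u
  refine ⟨p + p', p - p', q + q', r + r', s + s', s - s', r - r', q - q', ?_⟩
  ext <;> simp only [zorn] <;> field_simp <;> ring

theorem zorn_mul [NeZero (2 : k)] (a b x1 x2 x3 y3 y2 y1 A B X1 X2 X3 Y3 Y2 Y1 : k) :
    zorn a b x1 x2 x3 y3 y2 y1 * zorn A B X1 X2 X3 Y3 Y2 Y1 =
      zorn (a * A - y3 * X3 + y2 * X2 + y1 * X1) (b * B + x1 * Y1 + x2 * Y2 - x3 * Y3)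
        (b * X1 + x1 * A + y3 * Y2 - y2 * Y3) (b * X2 + x2 * A - y3 * Y1 + y1 * Y3)
        (b * X3 + x3 * A - y2 * Y1 + y1 * Y2) (a * Y3 + x1 * X2 - x2 * X1 + y3 * B)
        (a * Y2 + x1 * X3 - x3 * X1 + y2 * B) (a * Y1 - x2 * X3 + x3 * X2 + y1 * B) := by
  have h2 : (2 : k) ≠ 0 := NeZero.ne 2
  ext <;> simp [zorn] <;> field_simp <;> ring

theorem octEquiv_zorn [NeZero (2 : k)] (a b x1 x2 x3 y3 y2 y1 : k) :
    zorn a b x1 x2 x3 y3 y2 y1 = octEquiv ((a + b) / 2, ![x1, x2, x3, (a - b) / 2, y3, y2, y1]) := by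
  rw [octEquiv_apply]
  ext <;> simp [zorn, pureOct_apply]

theorem rootAut_mul [NeZero (2 : k)] (γ : PosRoot) (r : k) (u v : Octonion k) :
    rootAut γ r (u * v) = rootAut γ r u * rootAut γ r v := by
  have h2 : (2 : k) ≠ 0 := NeZero.ne 2
  have key (a b x1 x2 x3 y3 y2 y1 : k) : rootAut γ r (zorn a b x1 x2 x3 y3 y2 y1) =
      octEquiv ((a + b) / 2, rootMatrix γ r *ᵥ ![x1, x2, x3, (a - b) / 2, y3, y2, y1]) := by
    rw [octEquiv_zorn, rootAut_apply, octEquiv.symm_apply_apply, octEquiv_apply]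
  have half (x y z w : k) : x + y = 2 * z → x - y = 2 * w → (x + y) / 2 = z ∧ (x - y) / 2 = w := by
    intro h h'
    rw [h, h']
    simp [h2]
  obtain ⟨a, b, x1, x2, x3, y3, y2, y1, rfl⟩ := exists_eq_zorn u
  obtain ⟨A, B, X1, X2, X3, Y3, Y2, Y1, rfl⟩ := exists_eq_zorn v
  cases γ
  · have key' (a b x1 x2 x3 y3 y2 y1 : k) : rootAut .a r (zorn a b x1 x2 x3 y3 y2 y1) =
        zorn (a + r * y2) (b - r * y2) x1 (x2 - r * (a - b) - r ^ 2 * y2) x3 (y3 - r * x1) y2 (y1 - r * x3) := by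
      rw [key, octEquiv_zorn]
      congr 1
      ext i
      · simp; try ring
      · fin_cases i <;> simp [rootMatrix, Matrix.mulVec, dotProduct, Fin.sum_univ_succ] <;>
          field_simp <;> ring
    rw [zorn_mul, key', key', key', zorn_mul]
    congr 1 <;> ring
  · have key' (a b x1 x2 x3 y3 y2 y1 : k) : rootAut .b r (zorn a b x1 x2 x3 y3 y2 y1) =
        zorn a b (x1 + r * x2) x2 x3 y3 (y2 - r * y1) y1 := by
      rw [key, octEquiv_zorn]
      congr 1
      ext i
      · simp; try ring
      · fin_cases i <;> simp [rootMatrix, Matrix.mulVec, dotProduct, Fin.sum_univ_succ] <;>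
          field_simp <;> ring
    rw [zorn_mul, key', key', key', zorn_mul]
    congr 1 <;> ring
  · have key' (a b x1 x2 x3 y3 y2 y1 : k) : rootAut .ab r (zorn a b x1 x2 x3 y3 y2 y1) =
        zorn (a + r * y1) (b - r * y1) (x1 - r * (a - b) - r ^ 2 * y1) x2 x3 (y3 + r * x2) (y2 + r * x3) y1 := by
      rw [key, octEquiv_zorn]
      congr 1
      ext i
      · simp; try ring
      · fin_cases i <;> simp [rootMatrix, Matrix.mulVec, dotProduct, Fin.sum_univ_succ] <;>
          field_simp <;> ring
    rw [zorn_mul, key', key', key', zorn_mul]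
    congr 1 <;> ring
  · have key' (a b x1 x2 x3 y3 y2 y1 : k) : rootAut .aab r (zorn a b x1 x2 x3 y3 y2 y1) =
        zorn (a - r * x3) (b + r * x3) (x1 - r * y2) (x2 + r * y1) x3 (y3 - r * (a - b) + r ^ 2 * x3) y2 y1 := by
      rw [key, octEquiv_zorn]
      congr 1
      ext i
      · simp; try ring
      · fin_cases i <;> simp [rootMatrix, Matrix.mulVec, dotProduct, Fin.sum_univ_succ] <;>
          field_simp <;> ring
    rw [zorn_mul, key', key', key', zorn_mul]
    congr 1 <;> ring
  · have key' (a b x1 x2 x3 y3 y2 y1 : k) : rootAut .aaab r (zorn a b x1 x2 x3 y3 y2 y1) =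
        zorn a b x1 (x2 + r * x3) x3 (y3 + r * y2) y2 y1 := by
      rw [key, octEquiv_zorn]
      congr 1
      ext i
      · simp; try ring
      · fin_cases i <;> simp [rootMatrix, Matrix.mulVec, dotProduct, Fin.sum_univ_succ] <;>
          field_simp <;> ring
    rw [zorn_mul, key', key', key', zorn_mul]
    congr 1 <;> ring
  · have key' (a b x1 x2 x3 y3 y2 y1 : k) : rootAut .aaabb r (zorn a b x1 x2 x3 y3 y2 y1) =
        zorn a b (x1 + r * x3) x2 x3 (y3 + r * y1) y2 y1 := by
      rw [key, octEquiv_zorn]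
      congr 1
      ext i
      · simp; try ring
      · fin_cases i <;> simp [rootMatrix, Matrix.mulVec, dotProduct, Fin.sum_univ_succ] <;>
          field_simp <;> ring
    rw [zorn_mul, key', key', key', zorn_mul]
    congr 1 <;> ring

theorem rootAut_pureOct [NeZero (2 : k)] (γ : PosRoot) (r : k) (v : Fin 7 → k) :
    rootAut γ r (pureOct k v) = pureOct k (rootMatrix γ r *ᵥ v) := by
  have h : octEquiv.symm (pureOct k v) = (0, v) := by
    rw [LinearEquiv.symm_apply_eq, octEquiv_apply]
    simp
  simp [rootAut_apply, h]

/-- Upper unitriangular with respect to the ordering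
`e₃X⁻, e₁X⁺, e₂X⁺, X⁰, e₂X⁻, e₁X⁻, e₃X⁺` of `pureBasis`. -/
def IsUnitri (M : Matrix (Fin 7) (Fin 7) k) : Prop :=
  M.BlockTriangular (![1, 2, 6, 3, 0, 4, 5] : Fin 7 → ℕ) ∧ ∀ i, M i i = 1

theorem IsUnitri.mul {M N : Matrix (Fin 7) (Fin 7) k} (hM : IsUnitri M) (hN : IsUnitri N) :
    IsUnitri (M * N) := by
  refine ⟨hM.1.mul hN.1, fun i => ?_⟩
  rw [Matrix.mul_apply, Finset.sum_eq_single i]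
  · rw [hM.2, hN.2, one_mul]
  · intro j _ hj
    have hne : (![1, 2, 6, 3, 0, 4, 5] : Fin 7 → ℕ) j ≠ (![1, 2, 6, 3, 0, 4, 5] : Fin 7 → ℕ) i := by
      revert i j
      decide
    rcases lt_or_gt_of_ne hne with h | h
    · rw [hM.1 h, zero_mul]
    · rw [hN.1 h, mul_zero]
  · simp

theorem isUnitri_rootMatrix (γ : PosRoot) (r : k) : IsUnitri (rootMatrix γ r) := by
  refine ⟨fun i j h => ?_, fun i => ?_⟩
  · cases γ <;> fin_cases i <;> fin_cases j <;> simp_all [rootMatrix]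
  · cases γ <;> fin_cases i <;> simp [rootMatrix]

/-- The root element `x_γ(r)` of `G₂(k)`, for a positive root `γ`. -/
def rootElt [NeZero (2 : k)] (γ : PosRoot) (r : k) : G2 k :=
  ⟨⟨rootGL γ r, rootMatrix_form γ r, rootMatrix_det γ r⟩,
    rootAut γ r, rootAut_mul γ r, rootAut_pureOct γ r⟩

@[simp] theorem mat_rootElt [NeZero (2 : k)] (γ : PosRoot) (r : k) :
    mat k (rootElt γ r).val = rootMatrix γ r := rfl

theorem rootElt_inv [NeZero (2 : k)] (γ : PosRoot) (r : k) :
    (rootElt γ r)⁻¹ = rootElt γ (-r) := by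
  rw [inv_eq_iff_mul_eq_one]
  apply Subtype.ext
  apply Subtype.ext
  apply Units.ext
  change rootMatrix γ r * rootMatrix γ (-r) = 1
  rw [← rootMatrix_add, add_neg_cancel, rootMatrix_zero]

variable (k) [NeZero (2 : k)]

/-- The subgroup of `G₂(k)` generated by the root subgroups `U_γ`, `γ ∈ S`. -/
def rootSubgroup (S : Set PosRoot) : Subgroup (G2 k) :=
  Subgroup.closure {g | ∃ γ ∈ S, ∃ r, g = rootElt γ r}

/-- The maximal unipotent subgroup `U`, the unipotent radical of the Borel subgroup `B`. -/
def unipU : Subgroup (G2 k) := rootSubgroup k Set.univ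

/-- The unipotent radical `V` of the maximal parabolic subgroup `P = MV` with `U_β ⊆ M`. -/
def unipV : Subgroup (G2 k) := rootSubgroup k {b}ᶜ

/-- The unipotent radical `V'` of the maximal parabolic subgroup `P' = M'V'` with `U_α ⊆ M'`. -/
def unipV' : Subgroup (G2 k) := rootSubgroup k {a}ᶜ

variable {k}

theorem isUnitri_of_mem_unipU {g : G2 k} (hg : g ∈ unipU k) : IsUnitri (mat k g.val) := by
  suffices IsUnitri (mat k g.val) ∧ IsUnitri (mat k g⁻¹.val) from this.1
  induction hg using Subgroup.closure_induction with
  | mem x hx =>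
    obtain ⟨γ, -, r, rfl⟩ := hx
    rw [rootElt_inv]
    exact ⟨isUnitri_rootMatrix γ r, isUnitri_rootMatrix γ (-r)⟩
  | one => simp [IsUnitri, Matrix.blockTriangular_one]
  | mul x y _ _ hx hy =>
    rw [mul_inv_rev]
    simp only [Subgroup.coe_mul, map_mul]
    exact ⟨hx.1.mul hy.1, hy.2.mul hx.2⟩
  | inv x _ hx => exact ⟨hx.2, by simpa using hx.1⟩

/-- The generic character `ψ_U` of `U` attached to an additive character `ψ` of `k`:
`x_α(x) x_β(y) u' ↦ ψ(x + y)`, for `u'` in the product of the root subgroups of the non-simple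
positive roots. It is given by the formula `u ↦ ψ(u₁₂ + u₄₆)` in terms of matrix entries. -/
def whittakerChar (ψ : AddChar k ℂ) : unipU k →* ℂ where
  toFun u := ψ (mat k u.val.val 0 1 + mat k u.val.val 3 5)
  map_one' := by simp
  map_mul' u v := by
    have hu := isUnitri_of_mem_unipU u.2
    have hv := isUnitri_of_mem_unipU v.2
    have h1 : mat k (u * v).val.val 0 1 = mat k u.val.val 0 1 + mat k v.val.val 0 1 := by
      simp only [Subgroup.coe_mul, map_mul, Matrix.mul_apply, Fin.sum_univ_seven]
      rw [hu.2, hv.2, hu.1 (i := 0) (j := 4) (by decide), hv.1 (i := 2) (j := 1) (by decide),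
        hv.1 (i := 3) (j := 1) (by decide), hv.1 (i := 5) (j := 1) (by decide),
        hv.1 (i := 6) (j := 1) (by decide)]
      ring
    have h2 : mat k (u * v).val.val 3 5 = mat k u.val.val 3 5 + mat k v.val.val 3 5 := by
      simp only [Subgroup.coe_mul, map_mul, Matrix.mul_apply, Fin.sum_univ_seven]
      rw [hu.2, hv.2, hu.1 (i := 3) (j := 0) (by decide), hu.1 (i := 3) (j := 1) (by decide),
        hu.1 (i := 3) (j := 4) (by decide), hv.1 (i := 2) (j := 5) (by decide),
        hv.1 (i := 6) (j := 5) (by decide)]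
      ring
    rw [h1, h2, ← AddChar.map_add_eq_mul]
    congr 1
    ring

theorem rootElt_mem_unipU (γ : PosRoot) (r : k) : rootElt γ r ∈ unipU k :=
  Subgroup.subset_closure ⟨γ, trivial, r, rfl⟩

theorem whittakerChar_alpha (ψ : AddChar k ℂ) (r : k) :
    whittakerChar ψ ⟨rootElt a r, rootElt_mem_unipU a r⟩ = ψ r := by
  simp [whittakerChar, rootMatrix]

theorem whittakerChar_beta (ψ : AddChar k ℂ) (r : k) :
    whittakerChar ψ ⟨rootElt b r, rootElt_mem_unipU b r⟩ = ψ r := by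
  simp [whittakerChar, rootMatrix]

theorem whittakerChar_of_ne (ψ : AddChar k ℂ) (γ : PosRoot) (ha : γ ≠ a) (hb : γ ≠ b) (r : k) :
    whittakerChar ψ ⟨rootElt γ r, rootElt_mem_unipU γ r⟩ = 1 := by
  cases γ <;> simp_all [whittakerChar, rootMatrix]

/-! ## Cuspidal and generic representations -/

variable {V : Type*} [AddCommGroup V] [Module ℂ V]

/-- A representation of `G₂(k)` is cuspidal if its Jacquet module (the space of coinvariants)
for the unipotent radical of every proper parabolic subgroup vanishes. The proper parabolic
subgroups are the conjugates of the standard ones `B`, `P` and `P'`. -/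
def IsCuspidal (ρ : Representation ℂ (G2 k) V) : Prop :=
  ∀ N ∈ ({unipU k, unipV k, unipV' k} : Set (Subgroup (G2 k))), ∀ g : G2 k,
    Subsingleton (Representation.Coinvariants
      (ρ.comp (N.map (MulAut.conj g).toMonoidHom).subtype : Representation ℂ _ V))

/-- A representation of `G₂(k)` is generic if `Hom_U(ρ, ψ_U) ≠ 0` for a nontrivial additive
character `ψ` of `k`. -/
def IsGeneric (ρ : Representation ℂ (G2 k) V) : Prop :=
  ∃ ψ : AddChar k ℂ, ψ ≠ 1 ∧ ∃ l : V →ₗ[ℂ] ℂ, l ≠ 0 ∧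
    ∀ (u : unipU k) (v : V), l (ρ u v) = whittakerChar ψ u * l v

end Roots

/-- A representation `τ` of `GL₂(k)` is generic if `Hom_N(τ, ψ) ≠ 0` for a nontrivial additive
character `ψ` of `k`, where `N` is the group of matrices `(1 x; 0 1)`. -/
def IsGenericGL2 {k : Type*} [Field k] {W : Type*} [AddCommGroup W] [Module ℂ W]
    (τ : Representation ℂ (GL (Fin 2) k) W) : Prop :=
  ∃ ψ : AddChar k ℂ, ψ ≠ 1 ∧ ∃ l : W →ₗ[ℂ] ℂ, l ≠ 0 ∧
    ∀ (x : k) (w : W), l (τ (Matrix.GeneralLinearGroup.upperRightHom x) w) = ψ x * l w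

end G2SO7

/-! ## Multiplicity one in the style of Gelfand, and characters of one-parameter groups -/

namespace Representation

/-! ### Hecke operators of a character of a subgroup, and Gelfand's commutativity argument. -/

section Gelfand

variable {G V : Type*} [Group G] [AddCommGroup V] [Module ℂ V] {ρ : Representation ℂ G V}

/-! The proof is Mackey theory for the action of `G₂(k)` on isotropic planes in the pure octonions,
the coset space behind `I(τ)`. There are two orbits (`exists_map_plane`). A plane with zero product
is fixed pointwise by a conjugate of `V'`, so cuspidality of `Π` kills its contribution
(`IsCuspidal.apply_deltaFun_eq_zero`). For the plane of `e₁X⁺, e₂X⁺` the stabilizer is the Levi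
subgroup `GL₂(k)` of `P` times the group `planeFixer`, which is made of the root groups of `2α+β`,
`3α+β`, `3α+2β`. Hence an intertwining map `Φ` amounts to a `GL₂(k)`-map `w ↦ Φ (deltaFun τ 1 w)`
from `τ` into the vectors of `Π` fixed by `planeFixer`.

On these vectors `V` acts through a quotient `k²`, and a Kirillov-type argument applies: by
cuspidality for `P` the trivial character of `k²` does not occur, `GL₂(k)` permutes the others
transitively, and by cuspidality for `P'` the group `U_β` has no invariants among the eigenvectors
of the chosen nontrivial character. So every nonzero `P`-stable space meeting them nontrivially
contains a Whittaker vector (`IsCuspidal.exists_whittaker_vector`). Whittaker functionals of `Π` are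
unique up to scalars, so composing `Φ` with one, `l`, gives an injection
(`eq_zero_of_toFunctional_eq_zero`) into the `ψ`-Whittaker functionals of `τ`. These form at most a
line, which gives dimension at most one.

Both uniqueness statements for Whittaker functionals come from Gelfand's trick: an anti-involution
fixing every double coset that can support a bi-equivariant function makes the Hecke operators
commute. For `G₂(k)` this is checked over the Bruhat decomposition (`bruhat`,
`isGelfandInvolution_whittakerChar`), for `GL₂(k)` directly (`isGelfandInvolution_upperHom`).

A nonzero intertwining map is written down by averaging (`sumMap`). It is nonzero because the Bessel
function of a Whittaker vector, restricted to `GL₂(k)`, is supported on the upper unipotents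
(`exists_eq_upperHom_of_apply_ne_zero`). -/

theorem IsIrreducible.span_orbit_eq_top (hρ : ρ.IsIrreducible) {v : V} (hv : v ≠ 0) :
    Submodule.span ℂ (Set.range fun g => ρ g v) = ⊤ := by
  let S : Subrepresentation ρ :=
    { toSubmodule := Submodule.span ℂ (Set.range fun g => ρ g v)
      apply_mem_toSubmodule := fun g w hw => by
        induction hw using Submodule.span_induction with
        | mem x hx =>
          obtain ⟨h, rfl⟩ := hx
          exact Submodule.subset_span ⟨g * h, by simp⟩
        | zero => simp
        | add x y _ _ hx hy => rw [map_add]; exact Submodule.add_mem _ hx hy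
        | smul c x _ hx => rw [map_smul]; exact Submodule.smul_mem _ c hx }
  have hS : S = ⊤ := by
    refine (hρ.eq_bot_or_eq_top S).resolve_left fun h => hv ?_
    have h1 : v ∈ S.toSubmodule := Submodule.subset_span ⟨1, by simp⟩
    rw [h] at h1
    exact (Submodule.mem_bot ℂ).1 h1
  exact congrArg Subrepresentation.toSubmodule hS

theorem IsIrreducible.finiteDimensional [Finite G] (hρ : ρ.IsIrreducible) :
    FiniteDimensional ℂ V := by
  by_cases h : ∃ v : V, v ≠ 0
  · obtain ⟨v, hv⟩ := h
    exact ⟨(Set.finite_range fun g => ρ g v).toFinset, by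
      simpa using hρ.span_orbit_eq_top hv⟩
  · push Not at h
    have : Subsingleton V := ⟨fun a b => by rw [h a, h b]⟩
    infer_instance

variable {N : Type*} [Group N] [Fintype N] (ι : N →* G) (χ : N →* ℂ) (ρ)

/-- The operator `∑ n, χ(n)⁻¹ ρ(n)`, a multiple of the projection onto the `χ`-eigenvectors
of `N`. -/
noncomputable def charProj : V →ₗ[ℂ] V := ∑ n, χ n⁻¹ • ρ (ι n)

variable {ρ}

theorem char_inv_mul_self {N : Type*} [Group N] (χ : N →* ℂ) (n : N) : χ n⁻¹ * χ n = 1 := by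
  rw [← map_mul, inv_mul_cancel, map_one]

theorem charProj_apply (v : V) : charProj ρ ι χ v = ∑ n, χ n⁻¹ • ρ (ι n) v := by
  simp [charProj]

theorem rep_charProj (n : N) (v : V) : ρ (ι n) (charProj ρ ι χ v) = χ n • charProj ρ ι χ v := by
  rw [charProj_apply, map_sum, Finset.smul_sum]
  refine Fintype.sum_equiv (Equiv.mulLeft n) _ _ fun m => ?_
  simp only [Equiv.coe_mulLeft, map_smul, mul_inv_rev, map_mul, Module.End.mul_apply, smul_smul]
  rw [mul_left_comm, mul_comm (χ n), char_inv_mul_self, mul_one]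

theorem charProj_rep (n : N) (v : V) : charProj ρ ι χ (ρ (ι n) v) = χ n • charProj ρ ι χ v := by
  rw [charProj_apply, charProj_apply, Finset.smul_sum]
  refine Fintype.sum_equiv (Equiv.mulRight n) _ _ fun m => ?_
  simp only [Equiv.coe_mulRight, mul_inv_rev, map_mul, Module.End.mul_apply, smul_smul]
  rw [← mul_assoc, mul_comm (χ n), char_inv_mul_self, one_mul]

theorem charProj_of_eigen {v : V} (hv : ∀ n, ρ (ι n) v = χ n • v) :
    charProj ρ ι χ v = (Fintype.card N : ℂ) • v := by
  rw [charProj_apply]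
  simp only [hv, smul_smul, char_inv_mul_self, one_smul]
  simp [Nat.cast_smul_eq_nsmul]

theorem map_charProj {l : V →ₗ[ℂ] ℂ} (hl : ∀ n v, l (ρ (ι n) v) = χ n * l v) (v : V) :
    l (charProj ρ ι χ v) = Fintype.card N * l v := by
  rw [charProj_apply, map_sum]
  simp only [map_smul, hl, smul_eq_mul, ← mul_assoc, char_inv_mul_self]
  simp

/-- The operator `e ρ(g) e`, for `e` the projection `charProj`. -/
noncomputable def heckeOp (ρ : Representation ℂ G V) (ι : N →* G) (χ : N →* ℂ) (g : G) :
    V →ₗ[ℂ] V :=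
  charProj ρ ι χ ∘ₗ ρ g ∘ₗ charProj ρ ι χ

theorem heckeOp_apply (g : G) (v : V) :
    heckeOp ρ ι χ g v = charProj ρ ι χ (ρ g (charProj ρ ι χ v)) := rfl

theorem heckeOp_left (n : N) (g : G) : heckeOp ρ ι χ (ι n * g) = χ n • heckeOp ρ ι χ g := by
  ext v
  simp [heckeOp_apply, charProj_rep]

theorem heckeOp_right (n : N) (g : G) : heckeOp ρ ι χ (g * ι n) = χ n • heckeOp ρ ι χ g := by
  ext v
  simp [heckeOp_apply, rep_charProj]

/-- The two inner projections give `e² = |N| e`; the remaining one is expanded as a sum over `N`. -/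
theorem heckeOp_mul (g h : G) (v : V) :
    heckeOp ρ ι χ g (heckeOp ρ ι χ h v) =
      (Fintype.card N : ℂ) • ∑ n, χ n⁻¹ • heckeOp ρ ι χ (g * ι n * h) v := by
  rw [heckeOp_apply, heckeOp_apply, charProj_of_eigen ι χ (rep_charProj ι χ · _), map_smul,
    map_smul, charProj_apply ι χ (ρ h _), map_sum, map_sum]
  simp [heckeOp_apply]


/-- Gelfand's condition on an anti-automorphism `θ` of `G` which preserves the character `χ` of
the subgroup `N`: every `g` which supports a `χ`-bi-equivariant function is equivalent to
`θ g`. -/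
structure IsGelfandInvolution (ι : N →* G) (χ : N →* ℂ) (θ : G → G) (σ : Equiv.Perm N) :
    Prop where
  map_mul : ∀ g h, θ (g * h) = θ h * θ g
  map_incl : ∀ n, θ (ι n) = ι (σ n)
  map_char : ∀ n, χ (σ n) = χ n
  support : ∀ g, (∃ n n', ι n * g = g * ι n' ∧ χ n ≠ χ n') ∨
    ∃ n n', θ g = ι n * g * ι n' ∧ χ n * χ n' = 1

variable {ι χ} {θ : G → G} {σ : Equiv.Perm N}

/-- In the first case of `support`, moving `n` across `g` multiplies the operator by two different
scalars, so it vanishes, and applying `θ` to the relation kills the operator of `θ g` as well. In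
the second case the two scalars cancel. -/
theorem heckeOp_anti (h : IsGelfandInvolution ι χ θ σ) (g : G) :
    heckeOp ρ ι χ (θ g) = heckeOp ρ ι χ g := by
  rcases h.support g with ⟨n, n', hn, hne⟩ | ⟨n, n', hn, h1⟩
  · have h0 : heckeOp ρ ι χ g = 0 := by
      have := congrArg (heckeOp ρ ι χ) hn
      rw [heckeOp_left, heckeOp_right, ← sub_eq_zero, ← sub_smul] at this
      exact (smul_eq_zero.1 this).resolve_left (sub_ne_zero.2 hne)
    have := congrArg (fun x => heckeOp ρ ι χ (θ x)) hn
    simp only [h.map_mul, h.map_incl] at this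
    rw [heckeOp_left, heckeOp_right, h.map_char, h.map_char, ← sub_eq_zero, ← sub_smul] at this
    rw [h0, (smul_eq_zero.1 this).resolve_left (sub_ne_zero.2 hne)]
  · rw [hn, heckeOp_right, heckeOp_left, smul_smul, mul_comm, h1, one_smul]

/-- Gelfand's trick: a product of Hecke operators is a combination of the operators of `a n b`.
These do not change under `θ`, which reverses the order of the factors. -/
theorem heckeOp_comm (h : IsGelfandInvolution ι χ θ σ) (g g' : G) (v : V) :
    heckeOp ρ ι χ g (heckeOp ρ ι χ g' v) = heckeOp ρ ι χ g' (heckeOp ρ ι χ g v) := by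
  have key (a b : G) : heckeOp ρ ι χ a (heckeOp ρ ι χ b v) =
      heckeOp ρ ι χ (θ b) (heckeOp ρ ι χ (θ a) v) := by
    rw [heckeOp_mul, heckeOp_mul]
    congr 1
    refine Fintype.sum_equiv σ _ _ fun n => ?_
    rw [← h.map_incl, ← h.map_mul, ← h.map_mul, heckeOp_anti h, ← mul_assoc]
    congr 1
    have h1 := char_inv_mul_self χ (σ n)
    have h2 := char_inv_mul_self χ n
    have h3 : χ n ≠ 0 := right_ne_zero_of_mul_eq_one h2
    rw [h.map_char] at h1
    exact mul_right_cancel₀ h3 (h2.trans h1.symm)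
  rw [key, heckeOp_anti h, heckeOp_anti h]

/-- The projection maps `V`, spanned by the translates of `v`, onto the eigenspace, and it sends `ρ
g v` to a multiple of `heckeOp ρ ι χ g v`. -/
theorem IsIrreducible.mem_span_heckeOp (hρ : ρ.IsIrreducible) {v w : V} (hv0 : v ≠ 0)
    (hv : ∀ n, ρ (ι n) v = χ n • v) (hw : ∀ n, ρ (ι n) w = χ n • w) :
    w ∈ Submodule.span ℂ (Set.range fun g => heckeOp ρ ι χ g v) := by
  have hc : (Fintype.card N : ℂ) ≠ 0 := by simp
  have key (x : V) : charProj ρ ι χ x ∈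
      Submodule.span ℂ (Set.range fun g => heckeOp ρ ι χ g v) := by
    have hx : x ∈ Submodule.span ℂ (Set.range fun g => ρ g v) := by
      rw [hρ.span_orbit_eq_top hv0]
      trivial
    induction hx using Submodule.span_induction with
    | mem x hx =>
      obtain ⟨g, rfl⟩ := hx
      have : charProj ρ ι χ (ρ g v) = (Fintype.card N : ℂ)⁻¹ • heckeOp ρ ι χ g v := by
        rw [heckeOp_apply, charProj_of_eigen ι χ hv, map_smul, map_smul, inv_smul_smul₀ hc]
      simp only [this]
      exact Submodule.smul_mem _ _ (Submodule.subset_span ⟨g, rfl⟩)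
    | zero => simp
    | add x y _ _ hx hy => rw [map_add]; exact Submodule.add_mem _ hx hy
    | smul c x _ hx => rw [map_smul]; exact Submodule.smul_mem _ c hx
  have := Submodule.smul_mem _ (Fintype.card N : ℂ)⁻¹ (key w)
  rwa [charProj_of_eigen ι χ hw, inv_smul_smul₀ hc] at this

/-- In an irreducible representation the eigenspace of a character with a Gelfand involution is
at most one-dimensional. -/
theorem IsIrreducible.exists_smul_eq_of_gelfand [Finite G] (hρ : ρ.IsIrreducible)
    (h : IsGelfandInvolution ι χ θ σ) {v w : V} (hv0 : v ≠ 0)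
    (hv : ∀ n, ρ (ι n) v = χ n • v) (hw : ∀ n, ρ (ι n) w = χ n • w) : ∃ c : ℂ, c • v = w := by
  have := hρ.finiteDimensional
  let E : Submodule ℂ V :=
    { carrier := {x | ∀ n, ρ (ι n) x = χ n • x}
      add_mem' := fun hx hy n => by rw [map_add, hx n, hy n, smul_add]
      zero_mem' := fun n => by simp
      smul_mem' := fun c x hx n => by rw [map_smul, hx n, smul_comm] }
  have hE (g : G) (x : V) : heckeOp ρ ι χ g x ∈ E := fun n => rep_charProj ι χ n _
  have hEn : Nontrivial E := ⟨⟨v, hv⟩, 0, fun h => hv0 (congrArg Subtype.val h)⟩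
  -- Schur's lemma for the commuting Hecke operators: any eigenvector `y` in `E` generates `E` under
  -- them, so the eigenvalue of `y` is the scalar by which the operator of `g` acts on all of `E`.
  have scal (g : G) : ∃ μ : ℂ, ∀ x ∈ E, heckeOp ρ ι χ g x = μ • x := by
    obtain ⟨μ, hμ⟩ := Module.End.exists_eigenvalue
      ((heckeOp ρ ι χ g).restrict fun x (_ : x ∈ E) => hE g x)
    obtain ⟨⟨y, hy⟩, hy'⟩ := hμ.exists_hasEigenvector
    have hy0 : y ≠ 0 := fun h => hy'.2 (Subtype.ext h)
    have hyμ : heckeOp ρ ι χ g y = μ • y := congrArg Subtype.val hy'.apply_eq_smul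
    refine ⟨μ, fun x hx => ?_⟩
    have hx' := hρ.mem_span_heckeOp hy0 hy hx
    clear hx
    induction hx' using Submodule.span_induction with
    | mem x hx =>
      obtain ⟨g', rfl⟩ := hx
      simp only
      rw [heckeOp_comm h, hyμ, map_smul]
    | zero => simp
    | add x y _ _ hx hy => rw [map_add, hx, hy, smul_add]
    | smul c x _ hx => rw [map_smul, hx, smul_comm]
  choose μ hμ using scal
  have hw' := hρ.mem_span_heckeOp hv0 hv hw
  rw [← Submodule.mem_span_singleton]
  refine Submodule.span_le.2 ?_ hw'
  rintro _ ⟨g, rfl⟩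
  exact Submodule.mem_span_singleton.2 ⟨μ g, (hμ g v hv).symm⟩

/-- A nonzero equivariant functional has a dual eigenvector. -/
theorem exists_eigenvector_of_functional {l : V →ₗ[ℂ] ℂ} (hl0 : l ≠ 0)
    (hl : ∀ n v, l (ρ (ι n) v) = χ n * l v) :
    ∃ v, l v = 1 ∧ ∀ n, ρ (ι n) v = χ n • v := by
  obtain ⟨v, hv⟩ : ∃ v, l v ≠ 0 := by
    by_contra! h
    exact hl0 (LinearMap.ext h)
  have hc : (Fintype.card N : ℂ) ≠ 0 := by simp
  refine ⟨(Fintype.card N * l v : ℂ)⁻¹ • charProj ρ ι χ v, ?_, fun n => ?_⟩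
  · rw [map_smul, map_charProj ι χ hl, smul_eq_mul, inv_mul_cancel₀ (mul_ne_zero hc hv)]
  · rw [map_smul, rep_charProj, smul_comm]

theorem IsIrreducible.functional_apply_ne_zero_of_gelfand [Finite G] (hρ : ρ.IsIrreducible)
    (h : IsGelfandInvolution ι χ θ σ) {l : V →ₗ[ℂ] ℂ} (hl0 : l ≠ 0)
    (hl : ∀ n v, l (ρ (ι n) v) = χ n * l v) {v : V} (hv0 : v ≠ 0)
    (hv : ∀ n, ρ (ι n) v = χ n • v) : l v ≠ 0 := by
  obtain ⟨v', h1, hv'⟩ := exists_eigenvector_of_functional hl0 hl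
  obtain ⟨c, hc⟩ := hρ.exists_smul_eq_of_gelfand h hv0 hv hv'
  intro h0
  rw [← hc, map_smul, h0, smul_zero] at h1
  exact zero_ne_one h1

/-- An equivariant functional is determined by its restriction to the eigenvectors, through
`map_charProj`, and these form a line. -/
theorem IsIrreducible.functional_eq_smul_of_gelfand [Finite G] (hρ : ρ.IsIrreducible)
    (h : IsGelfandInvolution ι χ θ σ) {l l' : V →ₗ[ℂ] ℂ} (hl0 : l ≠ 0)
    (hl : ∀ n v, l (ρ (ι n) v) = χ n * l v) (hl' : ∀ n v, l' (ρ (ι n) v) = χ n * l' v) :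
    ∃ c : ℂ, l' = c • l := by
  obtain ⟨v, h1, hv⟩ := exists_eigenvector_of_functional hl0 hl
  have hv0 : v ≠ 0 := by rintro rfl; simp at h1
  have hc : (Fintype.card N : ℂ) ≠ 0 := by simp
  refine ⟨l' v, LinearMap.ext fun w => ?_⟩
  obtain ⟨c, hcw⟩ := hρ.exists_smul_eq_of_gelfand h hv0 hv (rep_charProj ι χ · w)
  have e1 := map_charProj ι χ hl w
  have e2 := map_charProj ι χ hl' w
  rw [← hcw, map_smul, smul_eq_mul] at e1 e2
  apply mul_left_cancel₀ hc
  rw [LinearMap.smul_apply, smul_eq_mul, ← e2, mul_left_comm, ← e1, h1]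
  ring

end Gelfand

/-! ### Averaging over finite groups and additive characters of a finite field. -/

/-- If the coinvariants of a finite group vanish, so do the invariants. -/
theorem eq_zero_of_subsingleton_coinvariants {K V : Type*} [Group K] [Finite K] [AddCommGroup V]
    [Module ℂ V] (ρ : Representation ℂ K V) [Subsingleton ρ.Coinvariants] {v : V}
    (hv : ∀ g, ρ g v = v) : v = 0 := by
  have := Fintype.ofFinite K
  have hc : (Fintype.card K : ℂ) ≠ 0 := by simp
  -- The averaging operator kills the vectors `ρ g x - x`, but multiplies an invariant vector by the
  -- order of `K`.
  let A : V →ₗ[ℂ] V := ∑ g, ρ g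
  have hA : A v = (Fintype.card K : ℂ) • v := by
    simp [A, hv, Nat.cast_smul_eq_nsmul]
  have hker : v ∈ Coinvariants.ker ρ :=
    (Coinvariants.mk_eq_zero ρ).1 (Subsingleton.elim _ _)
  have hA0 : A v = 0 := by
    refine Submodule.span_le (p := LinearMap.ker A).2 ?_ hker
    rintro _ ⟨⟨g, x⟩, rfl⟩
    change A (ρ g x - x) = 0
    rw [map_sub, sub_eq_zero]
    simp only [A, LinearMap.coe_sum, Finset.sum_apply]
    exact Fintype.sum_equiv (Equiv.mulRight g) _ _ fun m => by simp
  rw [hA0] at hA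
  exact (smul_eq_zero.1 hA.symm).resolve_left hc

/-- A nonzero space stable under a one-parameter group of operators over a finite field contains
an eigenvector. -/
theorem exists_addChar_eigenvector {k V : Type*} [Field k] [Finite k] [AddCommGroup V]
    [Module ℂ V] (T : Multiplicative k →* (V →ₗ[ℂ] V)) (Z : Submodule ℂ V)
    (hZ : ∀ r, ∀ z ∈ Z, T (.ofAdd r) z ∈ Z) {y : V} (hy : y ∈ Z) (hy0 : y ≠ 0) :
    ∃ χ : AddChar k ℂ, ∃ z ∈ Z, z ≠ 0 ∧ ∀ r, T (.ofAdd r) z = χ r • z := by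
  classical
  have := Fintype.ofFinite k
  have hT (r s : k) (v : V) : T (.ofAdd (r + s)) v = T (.ofAdd r) (T (.ofAdd s) v) := by
    rw [ofAdd_add, map_mul, Module.End.mul_apply]
  -- Up to a factor, `y' χ` is the `χ`-component of `y`. By Fourier inversion these sum to a nonzero
  -- multiple of `y`, so one of them is nonzero.
  let y' (χ : AddChar k ℂ) : V := ∑ r, χ (-r) • T (.ofAdd r) y
  have hsum : ∑ χ, y' χ = (Fintype.card k : ℂ) • y := by
    simp only [y']
    rw [Finset.sum_comm]
    simp only [← Finset.sum_smul, AddChar.sum_apply_eq_ite, neg_eq_zero, ite_smul, zero_smul,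
      Finset.sum_ite_eq', Finset.mem_univ, if_true]
    simp
  obtain ⟨χ, hχ⟩ : ∃ χ, y' χ ≠ 0 := by
    by_contra! h
    simp only [h, Finset.sum_const_zero] at hsum
    exact (smul_ne_zero (by simp) hy0) hsum.symm
  refine ⟨χ, y' χ, Z.sum_mem fun r _ => Z.smul_mem _ (hZ r y hy), hχ, fun s => ?_⟩
  simp only [y', map_sum, map_smul, Finset.smul_sum]
  refine Fintype.sum_equiv (Equiv.addLeft s) _ _ fun r => ?_
  simp only [Equiv.coe_addLeft, smul_smul, ← AddChar.map_add_eq_mul, ← hT]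
  congr 2
  abel

end Representation

/-- A nontrivial character of a field is primitive, so `a ↦ ψ(a ·)` is injective, and there are as
many characters as elements. -/
theorem AddChar.exists_forall_eq_mul {k : Type*} [Field k] [Finite k] {ψ : AddChar k ℂ}
    (hψ : ψ ≠ 1) (χ : AddChar k ℂ) : ∃ a : k, ∀ x, χ x = ψ (a * x) := by
  have := Fintype.ofFinite k
  have hinj : Function.Injective fun a => AddChar.mulShift ψ a :=
    AddChar.to_mulShift_inj_of_isPrimitive (AddChar.IsPrimitive.of_ne_one hψ)
  have hsurj := ((Fintype.bijective_iff_injective_and_card _).2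
    ⟨hinj, AddChar.card_eq.symm⟩).2
  obtain ⟨a, ha⟩ := hsurj χ
  exact ⟨a, fun x => by rw [← ha]; rfl⟩

namespace G2SO7

/-! ### `G₂(k)` as the stabilizer of the cross product on pure octonions. -/

section CrossProduct

variable {k : Type*} [Field k]

/-- The cross product: the pure part of the product of two pure octonions, in coordinates. -/
def cross (v w : Fin 7 → k) : Fin 7 → k :=
  ![v 0 * w 3 - v 3 * w 0 + v 4 * w 5 - v 5 * w 4,
    v 1 * w 3 - v 3 * w 1 + v 6 * w 4 - v 4 * w 6,
    v 2 * w 3 - v 3 * w 2 + v 6 * w 5 - v 5 * w 6,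
    (v 2 * w 4 - v 4 * w 2 + v 5 * w 1 - v 1 * w 5 + v 6 * w 0 - v 0 * w 6) / 2,
    v 3 * w 4 - v 4 * w 3 + v 0 * w 1 - v 1 * w 0,
    v 3 * w 5 - v 5 * w 3 + v 0 * w 2 - v 2 * w 0,
    v 3 * w 6 - v 6 * w 3 + v 2 * w 1 - v 1 * w 2]

/-- The bilinear form with Gram matrix `formQ`. -/
def bilQ (v w : Fin 7 → k) : k := v ⬝ᵥ formQ k *ᵥ w

theorem bilQ_apply (v w : Fin 7 → k) : bilQ v w =
    v 0 * w 6 + v 1 * w 5 - v 2 * w 4 + 2 * (v 3 * w 3) - v 4 * w 2 + v 5 * w 1 + v 6 * w 0 := by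
  simp [bilQ, formQ, Matrix.mulVec, dotProduct, Fin.sum_univ_succ]
  ring

theorem bilQ_mulVec {M : Matrix (Fin 7) (Fin 7) k} (hM : Mᵀ * formQ k * M = formQ k)
    (v w : Fin 7 → k) : bilQ (M *ᵥ v) (M *ᵥ w) = bilQ v w := by
  unfold bilQ
  rw [Matrix.mulVec_mulVec, Matrix.dotProduct_mulVec, Matrix.vecMul_mulVec, ← Matrix.mul_assoc, hM,
    ← Matrix.dotProduct_mulVec]

theorem bilQ_mat (g : SO7 k) (v w : Fin 7 → k) :
    bilQ (mat k g *ᵥ v) (mat k g *ᵥ w) = bilQ v w :=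
  bilQ_mulVec g.2.1 v w

/-- The product is encoded by the form and the cross product. Thus a special orthogonal matrix
belongs to `G₂(k)` exactly when it preserves `cross`. -/
theorem octEquiv_mul [NeZero (2 : k)] (t t' : k) (v w : Fin 7 → k) :
    octEquiv (t, v) * octEquiv (t', w) =
      octEquiv (t * t' + bilQ v w / 2, t • w + t' • v + cross v w) := by
  have h2 : (2 : k) ≠ 0 := NeZero.ne 2
  simp only [octEquiv_apply, pureOct_apply, bilQ_apply]
  ext <;> simp [cross] <;> field_simp <;> ring

theorem pureOct_eq_octEquiv [NeZero (2 : k)] (v : Fin 7 → k) : pureOct k v = octEquiv (0, v) := by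
  simp [octEquiv_apply]

/-- Elements of `G₂(k)` preserve the cross product. -/
theorem cross_mulVec [NeZero (2 : k)] (g : G2 k) (v w : Fin 7 → k) :
    cross (mat k g.1 *ᵥ v) (mat k g.1 *ᵥ w) = mat k g.1 *ᵥ cross v w := by
  obtain ⟨g, f, hf, hv⟩ := g
  have h1 : f 1 = 1 := by
    have := hf 1 (f.symm 1)
    have one_mul' (x : Octonion k) : (1 : Octonion k) * x = x := by ext <;> simp
    have mul_one' (x : Octonion k) : x * (1 : Octonion k) = x := by ext <;> simp
    rw [one_mul', LinearEquiv.apply_symm_apply, mul_one'] at this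
    exact this.symm
  have h2 : f (octEquiv (bilQ v w / 2, cross v w)) =
      octEquiv (bilQ (mat k g *ᵥ v) (mat k g *ᵥ w) / 2, cross (mat k g *ᵥ v) (mat k g *ᵥ w)) := by
    have := hf (octEquiv (0, v)) (octEquiv (0, w))
    rw [← pureOct_eq_octEquiv w, ← pureOct_eq_octEquiv v, hv, hv] at this
    simpa [pureOct_eq_octEquiv, octEquiv_mul] using this
  rw [octEquiv_apply, map_add, map_smul, h1, hv, bilQ_mat] at h2
  rw [octEquiv_apply, add_right_inj, pureOct_eq_octEquiv, pureOct_eq_octEquiv] at h2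
  exact (congrArg Prod.snd (octEquiv.injective h2)).symm

/-- A special orthogonal matrix which preserves the cross product is in `G₂(k)`. -/
theorem mem_G2_of_cross [NeZero (2 : k)] (g : SO7 k)
    (hg : ∀ v w, cross (mat k g *ᵥ v) (mat k g *ᵥ w) = mat k g *ᵥ cross v w) : g ∈ G2 k := by
  have e1 : mat k g⁻¹ * mat k g = 1 := by rw [← map_mul, inv_mul_cancel, map_one]
  have e2 : mat k g * mat k g⁻¹ = 1 := by rw [← map_mul, mul_inv_cancel, map_one]
  let f : (k × (Fin 7 → k)) ≃ₗ[k] (k × (Fin 7 → k)) :=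
    { toFun := fun x => (x.1, mat k g *ᵥ x.2)
      invFun := fun x => (x.1, mat k g⁻¹ *ᵥ x.2)
      map_add' := fun x y => by simp [Matrix.mulVec_add]
      map_smul' := fun c x => by simp [Matrix.mulVec_smul]
      left_inv := fun x => by simp [e1]
      right_inv := fun x => by simp [e2] }
  have hfa (t : k) (v : Fin 7 → k) : f (t, v) = (t, mat k g *ᵥ v) := rfl
  refine ⟨octEquiv.symm.trans (f.trans octEquiv), fun x y => ?_, fun v => ?_⟩
  · obtain ⟨⟨t, v⟩, rfl⟩ := octEquiv.surjective x
    obtain ⟨⟨t', w⟩, rfl⟩ := octEquiv.surjective y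
    simp only [octEquiv_mul, LinearEquiv.trans_apply, LinearEquiv.symm_apply_apply, hfa,
      bilQ_mat, hg, Matrix.mulVec_add, Matrix.mulVec_smul]
  · simp only [pureOct_eq_octEquiv, LinearEquiv.trans_apply, LinearEquiv.symm_apply_apply, hfa]

theorem G2.ext [NeZero (2 : k)] {g h : G2 k} (hgh : mat k g.1 = mat k h.1) : g = h :=
  Subtype.ext (Subtype.ext (Units.ext hgh))

end CrossProduct

/-! ### The Levi subgroup of `P` and the reflection in `α`. -/

section Elements

variable {k : Type*} [Field k]

/-- The matrix in `pureBasis` of the element of `G₂(k)` which acts by `(a b; c d)` on the span of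
`e₁X⁺, e₂X⁺` and fixes `X⁰`; `e` is the inverse of the determinant. -/
def leviMatrix (a b c d e : k) : Matrix (Fin 7) (Fin 7) k :=
  !![a, b, 0, 0, 0, 0, 0;
     c, d, 0, 0, 0, 0, 0;
     0, 0, e, 0, 0, 0, 0;
     0, 0, 0, 1, 0, 0, 0;
     0, 0, 0, 0, a * d - b * c, 0, 0;
     0, 0, 0, 0, 0, a * e, -(b * e);
     0, 0, 0, 0, 0, -(c * e), d * e]

theorem leviMatrix_mul (a b c d e a' b' c' d' e' : k) :
    leviMatrix a b c d e * leviMatrix a' b' c' d' e' =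
      leviMatrix (a * a' + b * c') (a * b' + b * d') (c * a' + d * c') (c * b' + d * d')
        (e * e') := by
  ext i j
  fin_cases i <;> fin_cases j <;>
    simp [leviMatrix, Matrix.mul_apply, Fin.sum_univ_succ] <;> ring

theorem leviMatrix_det {a b c d e : k} (h : (a * d - b * c) * e = 1) :
    (leviMatrix a b c d e).det = 1 := by
  have : (leviMatrix a b c d e).det = ((a * d - b * c) * e) ^ 3 := by
    simp [leviMatrix, Matrix.det_succ_row_zero, Fin.sum_univ_succ, Fin.succAbove]
    ring
  rw [this, h, one_pow]

/-- The matrix of a representative of the simple reflection in `α`. -/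
def reflMatrix : Matrix (Fin 7) (Fin 7) k :=
  !![0, 0, 0, 0, 1, 0, 0;
     0, 0, 0, 0, 0, 1, 0;
     0, 0, 0, 0, 0, 0, -1;
     0, 0, 0, -1, 0, 0, 0;
     1, 0, 0, 0, 0, 0, 0;
     0, 1, 0, 0, 0, 0, 0;
     0, 0, -1, 0, 0, 0, 0]

theorem reflMatrix_det : (reflMatrix (k := k)).det = 1 := by
  simp [reflMatrix, Matrix.det_succ_row_zero, Fin.sum_univ_succ, Fin.succAbove]
  norm_num

theorem form_of_bilQ {M : Matrix (Fin 7) (Fin 7) k}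
    (hM : ∀ v w, bilQ (M *ᵥ v) (M *ᵥ w) = bilQ v w) : Mᵀ * formQ k * M = formQ k := by
  ext i j
  have := hM (Pi.single i 1) (Pi.single j 1)
  unfold bilQ at this
  rw [Matrix.mulVec_mulVec, Matrix.dotProduct_mulVec, Matrix.vecMul_mulVec, ← Matrix.mul_assoc,
    ← Matrix.dotProduct_mulVec] at this
  simpa using this

theorem leviMatrix_mulVec (a b c d e : k) (v : Fin 7 → k) : leviMatrix a b c d e *ᵥ v =
    ![a * v 0 + b * v 1, c * v 0 + d * v 1, e * v 2, v 3, (a * d - b * c) * v 4,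
      a * e * v 5 - b * e * v 6, d * e * v 6 - c * e * v 5] := by
  ext i
  fin_cases i <;> simp [leviMatrix, Matrix.mulVec, dotProduct, Fin.sum_univ_succ] <;> ring

theorem leviMatrix_form {a b c d e : k} (h : (a * d - b * c) * e = 1) :
    (leviMatrix a b c d e)ᵀ * formQ k * leviMatrix a b c d e = formQ k := by
  refine form_of_bilQ fun v w => ?_
  simp [leviMatrix_mulVec, bilQ_apply]
  linear_combination
    (v 0 * w 6 + v 6 * w 0 + v 1 * w 5 + v 5 * w 1 - v 2 * w 4 - v 4 * w 2) * h

theorem reflMatrix_mulVec (v : Fin 7 → k) :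
    reflMatrix *ᵥ v = ![v 4, v 5, -v 6, -v 3, v 0, v 1, -v 2] := by
  ext i
  fin_cases i <;> simp [reflMatrix, Matrix.mulVec, dotProduct, Fin.sum_univ_succ]

theorem reflMatrix_form : (reflMatrix (k := k))ᵀ * formQ k * reflMatrix = formQ k := by
  rw [transpose_seven]
  simp [reflMatrix, formQ, Matrix.vecMul_cons]

theorem reflMatrix_mul_self : reflMatrix (k := k) * reflMatrix = 1 := by
  ext i j
  fin_cases i <;> fin_cases j <;> simp [reflMatrix, Matrix.mul_apply, Fin.sum_univ_succ]

theorem leviMatrix_one : leviMatrix (k := k) 1 0 0 1 1 = 1 := by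
  ext i j
  fin_cases i <;> fin_cases j <;> simp [leviMatrix]

theorem GL2_det_mul_inv (A : GL (Fin 2) k) :
    (A 0 0 * A 1 1 - A 0 1 * A 1 0) * (A.val.det)⁻¹ = 1 := by
  rw [← Matrix.det_fin_two]
  exact mul_inv_cancel₀ A.det_ne_zero

theorem leviMatrix_cross {a b c d e : k} (h : (a * d - b * c) * e = 1) (v w : Fin 7 → k) :
    cross (leviMatrix a b c d e *ᵥ v) (leviMatrix a b c d e *ᵥ w) =
      leviMatrix a b c d e *ᵥ cross v w := by
  simp only [leviMatrix_mulVec]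
  ext i
  fin_cases i
  · simp [cross]
    linear_combination (a * (v 4 * w 5 - v 5 * w 4) - b * (v 4 * w 6 - v 6 * w 4)) * h
  · simp [cross]
    linear_combination (c * (v 4 * w 5 - v 5 * w 4) + d * (v 6 * w 4 - v 4 * w 6)) * h
  · simp [cross]
    linear_combination e * (v 6 * w 5 - v 5 * w 6) * h
  · simp [cross]
    linear_combination (v 2 * w 4 - v 4 * w 2 + v 5 * w 1 - v 1 * w 5 + v 6 * w 0 - v 0 * w 6)
      / 2 * h
  all_goals
    simp [cross]
    ring

theorem leviMatrix_inv (A : GL (Fin 2) k) :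
    leviMatrix (A 0 0) (A 0 1) (A 1 0) (A 1 1) A.val.det⁻¹ *
      leviMatrix (A⁻¹ 0 0) (A⁻¹ 0 1) (A⁻¹ 1 0) (A⁻¹ 1 1) (A⁻¹.val.det)⁻¹ = 1 := by
  have h : A.val * A⁻¹.val = 1 := by rw [← Units.val_mul, mul_inv_cancel, Units.val_one]
  have h' (i j : Fin 2) : (A.val * A⁻¹.val) i j = (1 : Matrix _ _ k) i j := by rw [h]
  simp only [Matrix.mul_apply, Fin.sum_univ_two] at h'
  rw [leviMatrix_mul, h', h', h', h', ← mul_inv, ← Matrix.det_mul, h]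
  simpa using leviMatrix_one

variable [NeZero (2 : k)]

/-- The representative `reflMatrix` of the simple reflection in `α`, in `G₂(k)`. -/
def reflA : G2 k :=
  ⟨⟨⟨reflMatrix, reflMatrix, reflMatrix_mul_self, reflMatrix_mul_self⟩, reflMatrix_form,
    reflMatrix_det⟩, mem_G2_of_cross _ fun v w => by
      change cross (reflMatrix *ᵥ v) (reflMatrix *ᵥ w) = reflMatrix *ᵥ cross v w
      have h2 : (2 : k) ≠ 0 := NeZero.ne 2
      ext i
      fin_cases i <;>
        simp [reflMatrix_mulVec, cross] <;> ring⟩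

@[simp] theorem mat_reflA : mat k (reflA (k := k)).1 = reflMatrix := rfl

/-- The Levi subgroup `GL₂(k)` of the parabolic subgroup `P`. -/
def levi : GL (Fin 2) k →* G2 k where
  toFun A :=
    ⟨⟨⟨leviMatrix (A 0 0) (A 0 1) (A 1 0) (A 1 1) A.val.det⁻¹,
      leviMatrix (A⁻¹ 0 0) (A⁻¹ 0 1) (A⁻¹ 1 0) (A⁻¹ 1 1) (A⁻¹.val.det)⁻¹,
      leviMatrix_inv A, by simpa using leviMatrix_inv A⁻¹⟩, leviMatrix_form (GL2_det_mul_inv A),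
      leviMatrix_det (GL2_det_mul_inv A)⟩, mem_G2_of_cross _ (leviMatrix_cross (GL2_det_mul_inv A))⟩
  map_one' := by
    apply G2.ext
    change leviMatrix _ _ _ _ _ = (1 : Matrix (Fin 7) (Fin 7) k)
    simp [leviMatrix_one]
  map_mul' A B := by
    apply G2.ext
    change leviMatrix (k := k) _ _ _ _ _ = leviMatrix _ _ _ _ _ * leviMatrix _ _ _ _ _
    rw [leviMatrix_mul]
    simp [Matrix.mul_apply, Fin.sum_univ_two, mul_comm]

theorem mat_levi (A : GL (Fin 2) k) :
    mat k (levi A).1 = leviMatrix (A 0 0) (A 0 1) (A 1 0) (A 1 1) A.val.det⁻¹ := rfl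

end Elements
-- Stabilizers of a line and of a plane.
section Stabilizers

variable {k : Type*} [Field k]

theorem rootMatrix_a_mulVec (r : k) (v : Fin 7 → k) : rootMatrix .a r *ᵥ v =
    ![v 0, v 1 - 2 * r * v 3 - r ^ 2 * v 5, v 2, v 3 + r * v 5, v 4 - r * v 0, v 5,
      v 6 - r * v 2] := by
  ext i
  fin_cases i <;> simp [rootMatrix, Matrix.mulVec, dotProduct, Fin.sum_univ_succ] <;> ring

theorem rootMatrix_b_mulVec (r : k) (v : Fin 7 → k) : rootMatrix .b r *ᵥ v =
    ![v 0 + r * v 1, v 1, v 2, v 3, v 4, v 5 - r * v 6, v 6] := by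
  ext i
  fin_cases i <;> simp [rootMatrix, Matrix.mulVec, dotProduct, Fin.sum_univ_succ] <;> ring

theorem rootMatrix_ab_mulVec (r : k) (v : Fin 7 → k) : rootMatrix .ab r *ᵥ v =
    ![v 0 - 2 * r * v 3 - r ^ 2 * v 6, v 1, v 2, v 3 + r * v 6, v 4 + r * v 1, v 5 + r * v 2,
      v 6] := by
  ext i
  fin_cases i <;> simp [rootMatrix, Matrix.mulVec, dotProduct, Fin.sum_univ_succ] <;> ring

theorem rootMatrix_aab_mulVec (r : k) (v : Fin 7 → k) : rootMatrix .aab r *ᵥ v =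
    ![v 0 - r * v 5, v 1 + r * v 6, v 2, v 3 - r * v 2, v 4 - 2 * r * v 3 + r ^ 2 * v 2, v 5,
      v 6] := by
  ext i
  fin_cases i <;> simp [rootMatrix, Matrix.mulVec, dotProduct, Fin.sum_univ_succ] <;> ring

theorem rootMatrix_aaab_mulVec (r : k) (v : Fin 7 → k) : rootMatrix .aaab r *ᵥ v =
    ![v 0, v 1 + r * v 2, v 2, v 3, v 4 + r * v 5, v 5, v 6] := by
  ext i
  fin_cases i <;> simp [rootMatrix, Matrix.mulVec, dotProduct, Fin.sum_univ_succ]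

theorem rootMatrix_aaabb_mulVec (r : k) (v : Fin 7 → k) : rootMatrix .aaabb r *ᵥ v =
    ![v 0 + r * v 2, v 1, v 2, v 3, v 4 + r * v 6, v 5, v 6] := by
  ext i
  fin_cases i <;> simp [rootMatrix, Matrix.mulVec, dotProduct, Fin.sum_univ_succ]

theorem mat_inv_mulVec {g : SO7 k} {v w : Fin 7 → k} (h : mat k g *ᵥ v = w) :
    mat k g⁻¹ *ᵥ w = v := by
  rw [← h, Matrix.mulVec_mulVec, ← map_mul, inv_mul_cancel, map_one, Matrix.one_mulVec]

theorem mat_mul_mulVec (g h : SO7 k) (v : Fin 7 → k) :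
    mat k (g * h) *ᵥ v = mat k g *ᵥ (mat k h *ᵥ v) := by
  rw [map_mul, Matrix.mulVec_mulVec]

/-- The element of `GL₂(k)` with given entries. -/
def mkGL2 (a b c d : k) (h : a * d - b * c ≠ 0) : GL (Fin 2) k :=
  Matrix.GeneralLinearGroup.mkOfDetNeZero !![a, b; c, d] (by rwa [Matrix.det_fin_two_of])

@[simp] theorem coe_mkGL2 (a b c d : k) (h : a * d - b * c ≠ 0) :
    (mkGL2 a b c d h).val = !![a, b; c, d] := rfl

variable [NeZero (2 : k)]

/-- The three vectors `e₁X⁺, e₂X⁺, e₃X⁺` generate the pure octonions under the cross product. -/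
theorem eq_one_of_fixes {g : G2 k} (h0 : mat k g.1 *ᵥ ![1, 0, 0, 0, 0, 0, 0] = ![1, 0, 0, 0, 0, 0, 0])
    (h1 : mat k g.1 *ᵥ ![0, 1, 0, 0, 0, 0, 0] = ![0, 1, 0, 0, 0, 0, 0])
    (h2 : mat k g.1 *ᵥ ![0, 0, 1, 0, 0, 0, 0] = ![0, 0, 1, 0, 0, 0, 0]) : g = 1 := by
  have t2 : (2 : k) ≠ 0 := NeZero.ne 2
  have h4 := cross_mulVec g ![1, 0, 0, 0, 0, 0, 0] ![0, 1, 0, 0, 0, 0, 0]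
  have h5 := cross_mulVec g ![1, 0, 0, 0, 0, 0, 0] ![0, 0, 1, 0, 0, 0, 0]
  have h6 := cross_mulVec g ![0, 0, 1, 0, 0, 0, 0] ![0, 1, 0, 0, 0, 0, 0]
  rw [h0, h1] at h4
  rw [h0, h2] at h5
  rw [h1, h2] at h6
  simp only [cross] at h4 h5 h6
  simp at h4 h5 h6
  -- The factor 2 cancels the division by 2 in the `X⁰`-coordinate of `cross`, so that this product
  -- is `X⁰`.
  have h3 := cross_mulVec g ![0, 0, 2, 0, 0, 0, 0] ![0, 0, 0, 0, 1, 0, 0]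
  have e2 : (![0, 0, 2, 0, 0, 0, 0] : Fin 7 → k) = (2 : k) • ![0, 0, 1, 0, 0, 0, 0] := by simp
  rw [← h4, e2, Matrix.mulVec_smul, h2] at h3
  simp only [cross] at h3
  simp [t2] at h3
  apply G2.ext
  rw [Subgroup.coe_one, map_one]
  apply Matrix.ext_of_mulVec_single
  intro i
  rw [Matrix.one_mulVec]
  have e (i : Fin 7) : (Pi.single i (1 : k) : Fin 7 → k) =
    ![if i = 0 then 1 else 0, if i = 1 then 1 else 0, if i = 2 then 1 else 0,
      if i = 3 then 1 else 0, if i = 4 then 1 else 0, if i = 5 then 1 else 0,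
      if i = 6 then 1 else 0] := by
    ext j
    fin_cases i <;> fin_cases j <;> simp
  rw [e]
  fin_cases i
  · simpa using h0
  · simpa using h1
  · simpa using h2
  · simpa using h3.symm
  · simpa using h4.symm
  · simpa using h5.symm
  · simpa using h6.symm

theorem eq_of_agree {g h : G2 k}
    (h0 : mat k g.1 *ᵥ ![1, 0, 0, 0, 0, 0, 0] = mat k h.1 *ᵥ ![1, 0, 0, 0, 0, 0, 0])
    (h1 : mat k g.1 *ᵥ ![0, 1, 0, 0, 0, 0, 0] = mat k h.1 *ᵥ ![0, 1, 0, 0, 0, 0, 0])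
    (h2 : mat k g.1 *ᵥ ![0, 0, 1, 0, 0, 0, 0] = mat k h.1 *ᵥ ![0, 0, 1, 0, 0, 0, 0]) : g = h := by
  have key {v : Fin 7 → k} (hv : mat k g.1 *ᵥ v = mat k h.1 *ᵥ v) :
      mat k (h⁻¹ * g).1 *ᵥ v = v := by
    rw [Subgroup.coe_mul, mat_mul_mulVec, hv]
    exact mat_inv_mulVec rfl
  exact (inv_mul_eq_one.1 (eq_one_of_fixes (key h0) (key h1) (key h2))).symm

theorem mat_levi_mulVec (A : GL (Fin 2) k) (v : Fin 7 → k) : mat k (levi A).1 *ᵥ v =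
    ![A 0 0 * v 0 + A 0 1 * v 1, A 1 0 * v 0 + A 1 1 * v 1, A.val.det⁻¹ * v 2, v 3,
      A.val.det * v 4, A 0 0 * A.val.det⁻¹ * v 5 - A 0 1 * A.val.det⁻¹ * v 6,
      A 1 1 * A.val.det⁻¹ * v 6 - A 1 0 * A.val.det⁻¹ * v 5] := by
  rw [mat_levi, leviMatrix_mulVec, Matrix.det_fin_two A.val]

/-- Such a `g` also fixes the product `e₃X⁻` of the two vectors, so it is determined by the image
`y` of `e₃X⁺`. Invariance of the form leaves only `y 0`, `y 1`, `y 3` free, which are the parameters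
of the three root groups. -/
theorem exists_eq_of_fixes_plane {g : G2 k}
    (h0 : mat k g.1 *ᵥ ![1, 0, 0, 0, 0, 0, 0] = ![1, 0, 0, 0, 0, 0, 0])
    (h1 : mat k g.1 *ᵥ ![0, 1, 0, 0, 0, 0, 0] = ![0, 1, 0, 0, 0, 0, 0]) :
    ∃ r s t, g = rootElt .aaabb r * rootElt .aaab s * rootElt .aab t := by
  have t2 : (2 : k) ≠ 0 := NeZero.ne 2
  obtain ⟨y, hy⟩ : ∃ y, mat k g.1 *ᵥ ![0, 0, 1, 0, 0, 0, 0] = y := ⟨_, rfl⟩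
  have h4 := cross_mulVec g ![1, 0, 0, 0, 0, 0, 0] ![0, 1, 0, 0, 0, 0, 0]
  rw [h0, h1] at h4
  simp only [cross] at h4
  simp at h4
  have b0 := bilQ_mat g.1 ![1, 0, 0, 0, 0, 0, 0] ![0, 0, 1, 0, 0, 0, 0]
  have b1 := bilQ_mat g.1 ![0, 1, 0, 0, 0, 0, 0] ![0, 0, 1, 0, 0, 0, 0]
  have b2 := bilQ_mat g.1 ![0, 0, 1, 0, 0, 0, 0] ![0, 0, 1, 0, 0, 0, 0]
  have b4 := bilQ_mat g.1 ![0, 0, 0, 0, 1, 0, 0] ![0, 0, 1, 0, 0, 0, 0]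
  rw [h0, hy] at b0
  rw [h1, hy] at b1
  rw [hy] at b2
  rw [← h4, hy] at b4
  simp only [bilQ_apply] at b0 b1 b2 b4
  simp at b0 b1 b2 b4
  have y4 : y 4 = y 3 ^ 2 := by
    rw [b0, b1, b4] at b2
    apply mul_left_cancel₀ t2
    linear_combination -b2
  refine ⟨y 0, y 1, -y 3, eq_of_agree ?_ ?_ ?_⟩
  · rw [h0]
    simp only [Subgroup.coe_mul, mat_mul_mulVec, mat_rootElt, rootMatrix_aab_mulVec,
      rootMatrix_aaab_mulVec, rootMatrix_aaabb_mulVec]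
    simp
  · rw [h1]
    simp only [Subgroup.coe_mul, mat_mul_mulVec, mat_rootElt, rootMatrix_aab_mulVec,
      rootMatrix_aaab_mulVec, rootMatrix_aaabb_mulVec]
    simp
  · rw [hy]
    simp only [Subgroup.coe_mul, mat_mul_mulVec, mat_rootElt, rootMatrix_aab_mulVec,
      rootMatrix_aaab_mulVec, rootMatrix_aaabb_mulVec]
    ext i
    fin_cases i <;> simp [b0, b1, b4, y4]

theorem rootElt_mem_unipV {γ : PosRoot} (hγ : γ ≠ .b) (r : k) : rootElt γ r ∈ unipV k :=
  Subgroup.subset_closure ⟨γ, hγ, r, rfl⟩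

theorem unipV_le_unipU : unipV k ≤ unipU k :=
  Subgroup.closure_mono fun _ ⟨γ, _, r, h⟩ => ⟨γ, trivial, r, h⟩

theorem mem_unipV_of_fixes_plane {g : G2 k}
    (h0 : mat k g.1 *ᵥ ![1, 0, 0, 0, 0, 0, 0] = ![1, 0, 0, 0, 0, 0, 0])
    (h1 : mat k g.1 *ᵥ ![0, 1, 0, 0, 0, 0, 0] = ![0, 1, 0, 0, 0, 0, 0]) : g ∈ unipV k := by
  obtain ⟨r, s, t, rfl⟩ := exists_eq_of_fixes_plane h0 h1
  exact mul_mem (mul_mem (rootElt_mem_unipV (by simp) r) (rootElt_mem_unipV (by simp) s))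
    (rootElt_mem_unipV (by simp) t)

theorem mem_unipV_of_mulVec {g : G2 k} {p q : k}
    (h0 : mat k g.1 *ᵥ ![1, 0, 0, 0, 0, 0, 0] = ![1, 0, 0, 0, p, 0, 0])
    (h1 : mat k g.1 *ᵥ ![0, 1, 0, 0, 0, 0, 0] = ![0, 1, 0, 0, q, 0, 0]) : g ∈ unipV k := by
  -- The two factors clear the `e₃X⁻`-components, which reduces to an element fixing the plane.
  have hm : rootElt .ab (-q) * rootElt .a p * g ∈ unipV k := by
    apply mem_unipV_of_fixes_plane
    · simp only [Subgroup.coe_mul, mat_mul_mulVec, mat_rootElt, h0, rootMatrix_a_mulVec,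
        rootMatrix_ab_mulVec]
      simp
    · simp only [Subgroup.coe_mul, mat_mul_mulVec, mat_rootElt, h1, rootMatrix_a_mulVec,
        rootMatrix_ab_mulVec]
      simp
  exact ((unipV k).mul_mem_cancel_left
    (mul_mem (rootElt_mem_unipV (by simp) _) (rootElt_mem_unipV (by simp) _))).1 hm

theorem mat_levi_mkGL2_mulVec (a b c d : k) (h : a * d - b * c ≠ 0) (v : Fin 7 → k) :
    mat k (levi (mkGL2 a b c d h)).1 *ᵥ v = ![a * v 0 + b * v 1, c * v 0 + d * v 1,
      (a * d - b * c)⁻¹ * v 2, v 3, (a * d - b * c) * v 4,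
      a * (a * d - b * c)⁻¹ * v 5 - b * (a * d - b * c)⁻¹ * v 6,
      d * (a * d - b * c)⁻¹ * v 6 - c * (a * d - b * c)⁻¹ * v 5] := by
  rw [mat_levi_mulVec, coe_mkGL2, Matrix.det_fin_two_of]
  rfl

/-- The stabilizer of the line of `e₃X⁻` is `P = MV`. -/
theorem exists_eq_levi_mul_of_stabilizes_line {g : G2 k} {c : k}
    (hg : mat k g.1 *ᵥ ![0, 0, 0, 0, 1, 0, 0] = ![0, 0, 0, 0, c, 0, 0]) :
    ∃ A, ∃ v ∈ unipV k, g = levi A * v := by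
  have t2 : (2 : k) ≠ 0 := NeZero.ne 2
  have hc : c ≠ 0 := by
    rintro rfl
    have := mat_inv_mulVec hg
    have e : (![0, 0, 0, 0, 0, 0, 0] : Fin 7 → k) = 0 := by simp
    rw [e, Matrix.mulVec_zero] at this
    simpa using congrFun this 4
  obtain ⟨x, hx⟩ : ∃ x, mat k g.1 *ᵥ ![1, 0, 0, 0, 0, 0, 0] = x := ⟨_, rfl⟩
  obtain ⟨y, hy⟩ : ∃ y, mat k g.1 *ᵥ ![0, 1, 0, 0, 0, 0, 0] = y := ⟨_, rfl⟩
  -- The annihilator of `e₃X⁻` under the cross product is the span of `e₁X⁺, e₂X⁺, e₃X⁻`, so `g`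
  -- preserves this space.
  have ker {z w : Fin 7 → k} (hz : mat k g.1 *ᵥ z = w)
      (h0 : cross ![0, 0, 0, 0, 1, 0, 0] z = 0) : w = ![w 0, w 1, 0, 0, w 4, 0, 0] := by
    have h := cross_mulVec g ![0, 0, 0, 0, 1, 0, 0] z
    rw [h0, hg, hz, Matrix.mulVec_zero] at h
    simp [cross, hc, t2] at h
    ext i
    fin_cases i <;> simp [h]
  have hx' := ker hx (by simp [cross])
  have hy' := ker hy (by simp [cross])
  have hxy := cross_mulVec g ![1, 0, 0, 0, 0, 0, 0] ![0, 1, 0, 0, 0, 0, 0]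
  have e4 : cross (k := k) ![1, 0, 0, 0, 0, 0, 0] ![0, 1, 0, 0, 0, 0, 0] =
    ![0, 0, 0, 0, 1, 0, 0] := by simp [cross]
  rw [e4, hg, hx, hy] at hxy
  -- Since `e₃X⁻` is the product of `e₁X⁺` and `e₂X⁺`, the eigenvalue `c` is the determinant of the
  -- Levi block.
  have hd := congrFun hxy 4
  rw [hx', hy'] at hd
  simp [cross] at hd
  have hd' : x 0 * y 1 - y 0 * x 1 ≠ 0 := by
    rw [mul_comm (y 0), hd]
    exact hc
  have hd'' : x 0 * y 1 - y 0 * x 1 = c := by rw [mul_comm (y 0), hd]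
  refine ⟨mkGL2 (x 0) (y 0) (x 1) (y 1) hd', (levi (mkGL2 (x 0) (y 0) (x 1) (y 1) hd'))⁻¹ * g,
    mem_unipV_of_mulVec (p := x 4 / c) (q := y 4 / c) ?_ ?_, by group⟩
  · rw [Subgroup.coe_mul, mat_mul_mulVec, hx]
    apply mat_inv_mulVec
    refine Eq.trans ?_ hx'.symm
    rw [mat_levi_mkGL2_mulVec, hd'']
    ext i
    fin_cases i <;> simp <;> field_simp
  · rw [Subgroup.coe_mul, mat_mul_mulVec, hy]
    apply mat_inv_mulVec
    refine Eq.trans ?_ hy'.symm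
    rw [mat_levi_mkGL2_mulVec, hd'']
    ext i
    fin_cases i <;> simp <;> field_simp

end Stabilizers
-- Orbits on isotropic vectors and isotropic planes.
section Orbits

variable {k : Type*} [Field k] [NeZero (2 : k)]

theorem mat_reflA_mulVec (v : Fin 7 → k) :
    mat k reflA.1 *ᵥ v = ![v 4, v 5, -v 6, -v 3, v 0, v 1, -v 2] := by
  rw [mat_reflA, reflMatrix_mulVec]

/-- A representative of the simple reflection in `β`. -/
def reflB : G2 k := levi (mkGL2 0 1 1 0 (by simp))

theorem mat_reflB_mulVec (v : Fin 7 → k) :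
    mat k reflB.1 *ᵥ v = ![v 1, v 0, -v 2, v 3, -v 4, v 6, v 5] := by
  rw [reflB, mat_levi_mkGL2_mulVec]
  simp

/-- `x` is in the `U`-orbit of a multiple of `y`. -/
def InUOrbit (x y : Fin 7 → k) : Prop :=
  ∃ u ∈ unipU k, ∃ c : k, c ≠ 0 ∧ mat k u.1 *ᵥ x = c • y

theorem InUOrbit.of_rootMatrix {x y : Fin 7 → k} (γ : PosRoot) (r : k)
    (h : InUOrbit (rootMatrix γ r *ᵥ x) y) : InUOrbit x y := by
  obtain ⟨u, hu, c, hc, h⟩ := h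
  refine ⟨u * rootElt γ r, mul_mem hu (rootElt_mem_unipU γ r), c, hc, ?_⟩
  rw [Subgroup.coe_mul, mat_mul_mulVec]
  exact h

theorem bilQ_self (v : Fin 7 → k) : bilQ v v = 2 * (v 0 * v 6 + v 1 * v 5 - v 2 * v 4 + v 3 ^ 2) := by
  rw [bilQ_apply]
  ring

theorem isotropic_eq {v : Fin 7 → k} (hv : bilQ v v = 0) :
    v 0 * v 6 + v 1 * v 5 - v 2 * v 4 + v 3 ^ 2 = 0 := by
  rw [bilQ_self] at hv
  exact (mul_eq_zero.1 hv).resolve_left (NeZero.ne 2)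

theorem isotropic_rootMatrix {v : Fin 7 → k} (hv : bilQ v v = 0) (γ : PosRoot) (r : k) :
    bilQ (rootMatrix γ r *ᵥ v) (rootMatrix γ r *ᵥ v) = 0 := by
  rw [bilQ_mulVec (rootMatrix_form γ r), hv]

/-- In this lemma and the next four, the pivot is the last nonzero coordinate in the ordering of
`IsUnitri`. Root elements clear the other coordinates in an order that preserves the zeros already
made; isotropy supplies the one zero that they do not. For the pivots `x 1` and `x 0` this is the
`X⁰`-coordinate, for the others the coordinate paired with the pivot. -/
theorem inUOrbit_two {x : Fin 7 → k} (hx : bilQ x x = 0) (h2 : x 2 ≠ 0) :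
    InUOrbit x ![0, 0, 1, 0, 0, 0, 0] := by
  have s0 (x : Fin 7 → k) (hx : bilQ x x = 0) (h2 : x 2 ≠ 0) (h6 : x 6 = 0) (h5 : x 5 = 0)
      (h3 : x 3 = 0) (h1 : x 1 = 0) (h0 : x 0 = 0) : InUOrbit x ![0, 0, 1, 0, 0, 0, 0] := by
    have h4 := isotropic_eq hx
    simp [h0, h1, h3, h2] at h4
    refine ⟨1, one_mem _, x 2, h2, ?_⟩
    rw [Subgroup.coe_one, map_one, Matrix.one_mulVec]
    ext i
    fin_cases i <;> simp [h0, h1, h3, h4, h5, h6]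
  have s1 (x : Fin 7 → k) (hx : bilQ x x = 0) (h2 : x 2 ≠ 0) (h6 : x 6 = 0) (h5 : x 5 = 0)
      (h3 : x 3 = 0) (h1 : x 1 = 0) : InUOrbit x ![0, 0, 1, 0, 0, 0, 0] := by
    apply InUOrbit.of_rootMatrix .aaabb (-(x 0 / x 2))
    apply s0 _ (isotropic_rootMatrix hx _ _) <;> rw [rootMatrix_aaabb_mulVec] <;>
      simp [h6, h5, h3, h1, h2]
  have s2 (x : Fin 7 → k) (hx : bilQ x x = 0) (h2 : x 2 ≠ 0) (h6 : x 6 = 0) (h5 : x 5 = 0)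
      (h3 : x 3 = 0) : InUOrbit x ![0, 0, 1, 0, 0, 0, 0] := by
    apply InUOrbit.of_rootMatrix .aaab (-(x 1 / x 2))
    apply s1 _ (isotropic_rootMatrix hx _ _) <;> rw [rootMatrix_aaab_mulVec] <;>
      simp [h6, h5, h3, h2]
  have s3 (x : Fin 7 → k) (hx : bilQ x x = 0) (h2 : x 2 ≠ 0) (h6 : x 6 = 0) (h5 : x 5 = 0) :
      InUOrbit x ![0, 0, 1, 0, 0, 0, 0] := by
    apply InUOrbit.of_rootMatrix .aab (x 3 / x 2)
    apply s2 _ (isotropic_rootMatrix hx _ _) <;> rw [rootMatrix_aab_mulVec] <;>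
      simp [h6, h5, h2]
  have s4 (x : Fin 7 → k) (hx : bilQ x x = 0) (h2 : x 2 ≠ 0) (h6 : x 6 = 0) :
      InUOrbit x ![0, 0, 1, 0, 0, 0, 0] := by
    apply InUOrbit.of_rootMatrix .ab (-(x 5 / x 2))
    apply s3 _ (isotropic_rootMatrix hx _ _) <;> rw [rootMatrix_ab_mulVec] <;>
      simp [h6, h2]
  apply InUOrbit.of_rootMatrix .a (x 6 / x 2)
  apply s4 _ (isotropic_rootMatrix hx _ _) <;> rw [rootMatrix_a_mulVec] <;> simp [h2]

theorem inUOrbit_six {x : Fin 7 → k} (hx : bilQ x x = 0) (h2 : x 2 = 0) (h6 : x 6 ≠ 0) :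
    InUOrbit x ![0, 0, 0, 0, 0, 0, 1] := by
  have s0 (x : Fin 7 → k) (hx : bilQ x x = 0) (h2 : x 2 = 0) (h6 : x 6 ≠ 0) (h5 : x 5 = 0)
      (h3 : x 3 = 0) (h1 : x 1 = 0) (h4 : x 4 = 0) : InUOrbit x ![0, 0, 0, 0, 0, 0, 1] := by
    have h0 := isotropic_eq hx
    simp [h4, h1, h3, h6] at h0
    refine ⟨1, one_mem _, x 6, h6, ?_⟩
    rw [Subgroup.coe_one, map_one, Matrix.one_mulVec]
    ext i
    fin_cases i <;> simp [h0, h1, h3, h4, h5, h2]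
  have s1 (x : Fin 7 → k) (hx : bilQ x x = 0) (h2 : x 2 = 0) (h6 : x 6 ≠ 0) (h5 : x 5 = 0)
      (h3 : x 3 = 0) (h1 : x 1 = 0) : InUOrbit x ![0, 0, 0, 0, 0, 0, 1] := by
    apply InUOrbit.of_rootMatrix .aaabb (-(x 4 / x 6))
    apply s0 _ (isotropic_rootMatrix hx _ _) <;> rw [rootMatrix_aaabb_mulVec] <;>
      simp [h6, h5, h3, h1, h2]
  have s2 (x : Fin 7 → k) (hx : bilQ x x = 0) (h2 : x 2 = 0) (h6 : x 6 ≠ 0) (h5 : x 5 = 0)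
      (h3 : x 3 = 0) : InUOrbit x ![0, 0, 0, 0, 0, 0, 1] := by
    apply InUOrbit.of_rootMatrix .aab (-(x 1 / x 6))
    apply s1 _ (isotropic_rootMatrix hx _ _) <;> rw [rootMatrix_aab_mulVec] <;>
      simp [h6, h5, h3, h2]
  have s3 (x : Fin 7 → k) (hx : bilQ x x = 0) (h2 : x 2 = 0) (h6 : x 6 ≠ 0) (h5 : x 5 = 0) :
      InUOrbit x ![0, 0, 0, 0, 0, 0, 1] := by
    apply InUOrbit.of_rootMatrix .ab (-(x 3 / x 6))
    apply s2 _ (isotropic_rootMatrix hx _ _) <;> rw [rootMatrix_ab_mulVec] <;>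
      simp [h6, h5, h2]
  apply InUOrbit.of_rootMatrix .b (x 5 / x 6)
  apply s3 _ (isotropic_rootMatrix hx _ _) <;> rw [rootMatrix_b_mulVec] <;> simp [h2, h6]

theorem inUOrbit_five {x : Fin 7 → k} (hx : bilQ x x = 0) (h2 : x 2 = 0) (h6 : x 6 = 0)
    (h5 : x 5 ≠ 0) : InUOrbit x ![0, 0, 0, 0, 0, 1, 0] := by
  have s0 (x : Fin 7 → k) (hx : bilQ x x = 0) (h2 : x 2 = 0) (h6 : x 6 = 0) (h5 : x 5 ≠ 0)
      (h3 : x 3 = 0) (h0 : x 0 = 0) (h4 : x 4 = 0) : InUOrbit x ![0, 0, 0, 0, 0, 1, 0] := by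
    have h1 := isotropic_eq hx
    simp [h4, h0, h3, h5] at h1
    refine ⟨1, one_mem _, x 5, h5, ?_⟩
    rw [Subgroup.coe_one, map_one, Matrix.one_mulVec]
    ext i
    fin_cases i <;> simp [h0, h1, h3, h4, h6, h2]
  have s1 (x : Fin 7 → k) (hx : bilQ x x = 0) (h2 : x 2 = 0) (h6 : x 6 = 0) (h5 : x 5 ≠ 0)
      (h3 : x 3 = 0) (h0 : x 0 = 0) : InUOrbit x ![0, 0, 0, 0, 0, 1, 0] := by
    apply InUOrbit.of_rootMatrix .aaab (-(x 4 / x 5))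
    apply s0 _ (isotropic_rootMatrix hx _ _) <;> rw [rootMatrix_aaab_mulVec] <;>
      simp [h6, h5, h3, h0, h2]
  have s2 (x : Fin 7 → k) (hx : bilQ x x = 0) (h2 : x 2 = 0) (h6 : x 6 = 0) (h5 : x 5 ≠ 0)
      (h3 : x 3 = 0) : InUOrbit x ![0, 0, 0, 0, 0, 1, 0] := by
    apply InUOrbit.of_rootMatrix .aab (x 0 / x 5)
    apply s1 _ (isotropic_rootMatrix hx _ _) <;> rw [rootMatrix_aab_mulVec] <;>
      simp [h6, h5, h3, h2]
  apply InUOrbit.of_rootMatrix .a (-(x 3 / x 5))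
  apply s2 _ (isotropic_rootMatrix hx _ _) <;> rw [rootMatrix_a_mulVec] <;> simp [h2, h6, h5]

theorem inUOrbit_one {x : Fin 7 → k} (hx : bilQ x x = 0) (h2 : x 2 = 0) (h6 : x 6 = 0)
    (h5 : x 5 = 0) (h1 : x 1 ≠ 0) : InUOrbit x ![0, 1, 0, 0, 0, 0, 0] := by
  have h3 := isotropic_eq hx
  simp [h2, h6, h5] at h3
  have s1 (x : Fin 7 → k) (h2 : x 2 = 0) (h6 : x 6 = 0) (h5 : x 5 = 0) (h3 : x 3 = 0)
      (h1 : x 1 ≠ 0) (h0 : x 0 = 0) : InUOrbit x ![0, 1, 0, 0, 0, 0, 0] := by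
    apply InUOrbit.of_rootMatrix .ab (-(x 4 / x 1))
    refine ⟨1, one_mem _, x 1, h1, ?_⟩
    rw [Subgroup.coe_one, map_one, Matrix.one_mulVec, rootMatrix_ab_mulVec]
    ext i
    fin_cases i <;> simp [h0, h1, h3, h5, h6, h2]
  apply InUOrbit.of_rootMatrix .b (-(x 0 / x 1))
  apply s1 <;> rw [rootMatrix_b_mulVec] <;> simp [h2, h6, h5, h3, h1]

theorem inUOrbit_zero {x : Fin 7 → k} (hx : bilQ x x = 0) (h2 : x 2 = 0) (h6 : x 6 = 0)
    (h5 : x 5 = 0) (h1 : x 1 = 0) (h0 : x 0 ≠ 0) : InUOrbit x ![1, 0, 0, 0, 0, 0, 0] := by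
  have h3 := isotropic_eq hx
  simp [h2, h6, h5] at h3
  apply InUOrbit.of_rootMatrix .a (x 4 / x 0)
  refine ⟨1, one_mem _, x 0, h0, ?_⟩
  rw [Subgroup.coe_one, map_one, Matrix.one_mulVec, rootMatrix_a_mulVec]
  ext i
  fin_cases i <;> simp [h0, h1, h3, h5, h6, h2]

/-- Representatives of the elements `w` of the Weyl group with `w(β) > 0`. -/
inductive IsMinimalRep : G2 k → Prop
  | one : IsMinimalRep 1
  | a : IsMinimalRep reflA
  | ba : IsMinimalRep (reflB * reflA)
  | aba : IsMinimalRep (reflA * (reflB * reflA))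
  | baba : IsMinimalRep (reflB * (reflA * (reflB * reflA)))
  | ababa : IsMinimalRep (reflA * (reflB * (reflA * (reflB * reflA))))

/-- These are the six Schubert cells of `G₂/P`, viewed as the variety of isotropic lines: the cell
is read off from the pivot, and `w` carries `e₃X⁻` to the pivot vector up to sign. -/
theorem exists_inUOrbit {x : Fin 7 → k} (hx : bilQ x x = 0) (hx0 : x ≠ 0) :
    ∃ w, IsMinimalRep w ∧ InUOrbit x (mat k w.1 *ᵥ ![0, 0, 0, 0, 1, 0, 0]) := by
  -- The sign is needed because the longest of the six words sends `e₃X⁻` to `-e₃X⁺`.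
  have neg {x y : Fin 7 → k} (h : InUOrbit x y) : InUOrbit x (-y) := by
    obtain ⟨u, hu, c, hc, h⟩ := h
    exact ⟨u, hu, -c, neg_ne_zero.2 hc, by rw [h]; simp⟩
  by_cases h2 : x 2 = 0
  swap
  · refine ⟨_, .ababa, ?_⟩
    simp only [Subgroup.coe_mul, mat_mul_mulVec, mat_reflA_mulVec, mat_reflB_mulVec]
    simpa using neg (inUOrbit_two hx h2)
  by_cases h6 : x 6 = 0
  swap
  · refine ⟨_, .baba, ?_⟩
    simp only [Subgroup.coe_mul, mat_mul_mulVec, mat_reflA_mulVec, mat_reflB_mulVec]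
    simpa using inUOrbit_six hx h2 h6
  by_cases h5 : x 5 = 0
  swap
  · refine ⟨_, .aba, ?_⟩
    simp only [Subgroup.coe_mul, mat_mul_mulVec, mat_reflA_mulVec, mat_reflB_mulVec]
    simpa using inUOrbit_five hx h2 h6 h5
  by_cases h1 : x 1 = 0
  swap
  · refine ⟨_, .ba, ?_⟩
    simp only [Subgroup.coe_mul, mat_mul_mulVec, mat_reflA_mulVec, mat_reflB_mulVec]
    simpa using inUOrbit_one hx h2 h6 h5 h1
  by_cases h0 : x 0 = 0
  swap
  · refine ⟨_, .a, ?_⟩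
    rw [mat_reflA_mulVec]
    simpa using inUOrbit_zero hx h2 h6 h5 h1 h0
  refine ⟨_, .one, 1, one_mem _, x 4, ?_, ?_⟩
  · intro h4
    have h3 := isotropic_eq hx
    simp [h2, h6, h5] at h3
    apply hx0
    ext i
    fin_cases i <;> simp [h0, h1, h2, h3, h4, h5, h6]
  · have h3 := isotropic_eq hx
    simp [h2, h6, h5] at h3
    simp only [Subgroup.coe_one, map_one, Matrix.one_mulVec]
    ext i
    fin_cases i <;> simp [h0, h1, h2, h3, h5, h6]

theorem exists_mulVec_eq {x : Fin 7 → k} (hx : bilQ x x = 0) (hx0 : x ≠ 0) :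
    ∃ g : G2 k, ∃ c : k, c ≠ 0 ∧ mat k g.1 *ᵥ x = ![0, 0, 0, 0, c, 0, 0] := by
  obtain ⟨w, -, u, -, c, hc, h⟩ := exists_inUOrbit hx hx0
  refine ⟨w⁻¹ * u, c, hc, ?_⟩
  rw [Subgroup.coe_mul, mat_mul_mulVec, h, Matrix.mulVec_smul, Subgroup.coe_inv,
    mat_inv_mulVec rfl]
  simp

/-- There are two orbits of `G₂(k)` on isotropic planes: the planes with nonzero product, conjugate
to the span of `e₁X⁺, e₂X⁺`, and the others, conjugate to the span of `e₁X⁺, e₃X⁻`. -/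
theorem exists_map_plane {x y : Fin 7 → k} (hx : bilQ x x = 0) (hy : bilQ y y = 0)
    (hxy : bilQ x y = 0) (hx0 : x ≠ 0) : ∃ g : G2 k,
      (∃ a b c d, mat k g.1 *ᵥ x = ![a, b, 0, 0, 0, 0, 0] ∧
        mat k g.1 *ᵥ y = ![c, d, 0, 0, 0, 0, 0]) ∨
      (∃ a b c d, mat k g.1 *ᵥ x = ![a, 0, 0, 0, b, 0, 0] ∧
        mat k g.1 *ᵥ y = ![c, 0, 0, 0, d, 0, 0]) := by
  obtain ⟨g, c, hc, hg⟩ := exists_mulVec_eq hx hx0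
  rw [← bilQ_mat g.1, hg] at hxy
  rw [← bilQ_mat g.1] at hy
  clear hx hx0
  obtain ⟨z, hz⟩ : ∃ z, mat k g.1 *ᵥ y = z := ⟨_, rfl⟩
  rw [hz] at hy hxy
  have h2 : z 2 = 0 := by simpa [bilQ_apply, hc] using hxy
  clear hxy
  suffices H : ∃ h : G2 k,
      (∃ a b p q, mat k h.1 *ᵥ ![0, 0, 0, 0, c, 0, 0] = ![a, b, 0, 0, 0, 0, 0] ∧
        mat k h.1 *ᵥ z = ![p, q, 0, 0, 0, 0, 0]) ∨
      (∃ a b p q, mat k h.1 *ᵥ ![0, 0, 0, 0, c, 0, 0] = ![a, 0, 0, 0, b, 0, 0] ∧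
        mat k h.1 *ᵥ z = ![p, 0, 0, 0, q, 0, 0]) by
    obtain ⟨h, hh⟩ := H
    refine ⟨h * g, ?_⟩
    rwa [Subgroup.coe_mul, mat_mul_mulVec, mat_mul_mulVec, hg, hz]
  clear hg hz
  -- Given `z 2 = 0` and isotropy, this is the condition that the cross product of `e₃X⁻` and `z`
  -- vanishes; it separates the two orbits.
  by_cases h56 : z 5 = 0 ∧ z 6 = 0
  · obtain ⟨h5, h6⟩ := h56
    have h3 := isotropic_eq hy
    simp [h2, h5, h6] at h3
    by_cases h1 : z 1 = 0
    · refine ⟨1, .inr ⟨0, c, z 0, z 4, ?_, ?_⟩⟩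
      · simp
      · rw [Subgroup.coe_one, map_one, Matrix.one_mulVec]
        ext i
        fin_cases i <;> simp [h1, h2, h3, h5, h6]
    · refine ⟨levi (mkGL2 0 1 1 (-(z 0 / z 1)) (by simp)), .inr ⟨0, -c, z 1, -z 4, ?_, ?_⟩⟩
      · rw [mat_levi_mkGL2_mulVec]
        simp
      · rw [mat_levi_mkGL2_mulVec]
        simp [h1, h2, h3, h5, h6]
  -- When `z 6 = 0` the plane can be moved to the span of `e₃X⁻, e₂X⁻`, which `reflA` carries to
  -- that of `e₁X⁺, e₂X⁺`. A Levi element reduces the remaining case to this one.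
  · have s0 (c : k) (z : Fin 7 → k) (hz : bilQ z z = 0) (h2 : z 2 = 0) (h6 : z 6 = 0)
        (h5 : z 5 ≠ 0) : ∃ h : G2 k,
        (∃ a b p q, mat k h.1 *ᵥ ![0, 0, 0, 0, c, 0, 0] = ![a, b, 0, 0, 0, 0, 0] ∧
          mat k h.1 *ᵥ z = ![p, q, 0, 0, 0, 0, 0]) := by
      refine ⟨reflA * (rootElt .aab (z 0 / z 5) * rootElt .a (-(z 3 / z 5))), c, 0,
        z 4 + z 3 / z 5 * z 0, z 5, ?_, ?_⟩
      · simp only [Subgroup.coe_mul, mat_mul_mulVec, mat_rootElt, rootMatrix_aab_mulVec,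
          rootMatrix_a_mulVec, mat_reflA_mulVec]
        simp
      · have h1 : z 1 = -(z 3 ^ 2 / z 5) := by
          have := isotropic_eq hz
          simp [h2, h6] at this
          field_simp
          linear_combination this
        simp only [Subgroup.coe_mul, mat_mul_mulVec, mat_rootElt, rootMatrix_aab_mulVec,
          rootMatrix_a_mulVec, mat_reflA_mulVec]
        ext i
        fin_cases i <;> simp [h2, h6, h5, h1] <;> field_simp <;> ring
    by_cases h6 : z 6 = 0
    · have h5 : z 5 ≠ 0 := fun h => h56 ⟨h, h6⟩
      obtain ⟨h, hh⟩ := s0 c z hy h2 h6 h5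
      exact ⟨h, .inl hh⟩
    · obtain ⟨h, hh⟩ := s0 (-z 6 * c) (mat k (levi (mkGL2 0 1 (z 6) (z 5) (by simpa using h6))).1 *ᵥ z)
        (by rw [bilQ_mat, hy]) (by rw [mat_levi_mkGL2_mulVec]; simp [h2])
        (by rw [mat_levi_mkGL2_mulVec]; simp; ring)
        (by rw [mat_levi_mkGL2_mulVec]; simp [h6])
      refine ⟨h * levi (mkGL2 0 1 (z 6) (z 5) (by simpa using h6)), .inl ?_⟩
      rw [Subgroup.coe_mul, mat_mul_mulVec, mat_mul_mulVec, mat_levi_mkGL2_mulVec _ _ _ _ _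
        ![0, 0, 0, 0, c, 0, 0]]
      simpa using hh

end Orbits
-- Action of Weyl and torus representatives on root groups, and the Bruhat decomposition.
section Bruhat

variable {k : Type*} [Field k] [NeZero (2 : k)]

theorem G2.ext_mulVec {g h : G2 k} (hgh : ∀ v, mat k g.1 *ᵥ v = mat k h.1 *ᵥ v) : g = h :=
  G2.ext (Matrix.ext_of_mulVec_single fun i => hgh _)

theorem reflA_semiconj_rootElt_b (r : k) : SemiconjBy reflA (rootElt .b r) (rootElt .aaab r) := by
  refine G2.ext_mulVec fun v => ?_
  simp only [Subgroup.coe_mul, mat_mul_mulVec, mat_rootElt, mat_reflA_mulVec,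
    rootMatrix_b_mulVec, rootMatrix_aaab_mulVec]
  ext i
  fin_cases i <;> simp <;> ring

theorem reflA_semiconj_rootElt_ab (r : k) : SemiconjBy reflA (rootElt .ab r) (rootElt .aab (-r)) := by
  refine G2.ext_mulVec fun v => ?_
  simp only [Subgroup.coe_mul, mat_mul_mulVec, mat_rootElt, mat_reflA_mulVec,
    rootMatrix_ab_mulVec, rootMatrix_aab_mulVec]
  ext i
  fin_cases i <;> simp <;> ring

theorem reflA_semiconj_rootElt_aab (r : k) : SemiconjBy reflA (rootElt .aab r) (rootElt .ab (-r)) := by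
  refine G2.ext_mulVec fun v => ?_
  simp only [Subgroup.coe_mul, mat_mul_mulVec, mat_rootElt, mat_reflA_mulVec,
    rootMatrix_ab_mulVec, rootMatrix_aab_mulVec]
  ext i
  fin_cases i <;> simp <;> ring

theorem reflA_semiconj_rootElt_aaab (r : k) : SemiconjBy reflA (rootElt .aaab r) (rootElt .b r) := by
  refine G2.ext_mulVec fun v => ?_
  simp only [Subgroup.coe_mul, mat_mul_mulVec, mat_rootElt, mat_reflA_mulVec,
    rootMatrix_b_mulVec, rootMatrix_aaab_mulVec]
  ext i
  fin_cases i <;> simp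

theorem reflA_semiconj_rootElt_aaabb (r : k) :
    SemiconjBy reflA (rootElt .aaabb r) (rootElt .aaabb (-r)) := by
  refine G2.ext_mulVec fun v => ?_
  simp only [Subgroup.coe_mul, mat_mul_mulVec, mat_rootElt, mat_reflA_mulVec,
    rootMatrix_aaabb_mulVec]
  ext i
  fin_cases i <;> simp

theorem reflB_semiconj_rootElt_a (r : k) : SemiconjBy reflB (rootElt .a r) (rootElt .ab r) := by
  refine G2.ext_mulVec fun v => ?_
  simp only [Subgroup.coe_mul, mat_mul_mulVec, mat_rootElt, mat_reflB_mulVec,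
    rootMatrix_a_mulVec, rootMatrix_ab_mulVec]
  ext i
  fin_cases i <;> simp <;> ring

theorem reflB_semiconj_rootElt_ab (r : k) : SemiconjBy reflB (rootElt .ab r) (rootElt .a r) := by
  refine G2.ext_mulVec fun v => ?_
  simp only [Subgroup.coe_mul, mat_mul_mulVec, mat_rootElt, mat_reflB_mulVec,
    rootMatrix_a_mulVec, rootMatrix_ab_mulVec]
  ext i
  fin_cases i <;> simp <;> ring

theorem reflB_semiconj_rootElt_aab (r : k) : SemiconjBy reflB (rootElt .aab r) (rootElt .aab (-r)) := by
  refine G2.ext_mulVec fun v => ?_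
  simp only [Subgroup.coe_mul, mat_mul_mulVec, mat_rootElt, mat_reflB_mulVec,
    rootMatrix_aab_mulVec]
  ext i
  fin_cases i <;> simp <;> ring

theorem reflB_semiconj_rootElt_aaab (r : k) :
    SemiconjBy reflB (rootElt .aaab r) (rootElt .aaabb (-r)) := by
  refine G2.ext_mulVec fun v => ?_
  simp only [Subgroup.coe_mul, mat_mul_mulVec, mat_rootElt, mat_reflB_mulVec,
    rootMatrix_aaab_mulVec, rootMatrix_aaabb_mulVec]
  ext i
  fin_cases i <;> simp <;> ring

theorem reflB_semiconj_rootElt_aaabb (r : k) :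
    SemiconjBy reflB (rootElt .aaabb r) (rootElt .aaab (-r)) := by
  refine G2.ext_mulVec fun v => ?_
  simp only [Subgroup.coe_mul, mat_mul_mulVec, mat_rootElt, mat_reflB_mulVec,
    rootMatrix_aaab_mulVec, rootMatrix_aaabb_mulVec]
  ext i
  fin_cases i <;> simp <;> ring

/-- The torus element acting by `s, t` on `e₁X⁺, e₂X⁺`. -/
def torus (s t : k) (hs : s ≠ 0) (ht : t ≠ 0) : G2 k := levi (mkGL2 s 0 0 t (by simp [hs, ht]))

section
variable {s t : k} (hs : s ≠ 0) (ht : t ≠ 0)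

theorem mat_torus_mulVec (v : Fin 7 → k) : mat k (torus s t hs ht).1 *ᵥ v =
    ![s * v 0, t * v 1, (s * t)⁻¹ * v 2, v 3, s * t * v 4, t⁻¹ * v 5, s⁻¹ * v 6] := by
  rw [torus, mat_levi_mkGL2_mulVec]
  ext i
  fin_cases i <;> simp <;> field_simp <;> simp

theorem torus_semiconj_rootElt_a (r : k) :
    SemiconjBy (torus s t hs ht) (rootElt .a r) (rootElt .a (t * r)) := by
  refine G2.ext_mulVec fun v => ?_
  simp only [Subgroup.coe_mul, mat_mul_mulVec, mat_rootElt, mat_torus_mulVec, rootMatrix_a_mulVec]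
  ext i
  fin_cases i <;> simp <;> field_simp

theorem torus_semiconj_rootElt_b (r : k) :
    SemiconjBy (torus s t hs ht) (rootElt .b r) (rootElt .b (s / t * r)) := by
  refine G2.ext_mulVec fun v => ?_
  simp only [Subgroup.coe_mul, mat_mul_mulVec, mat_rootElt, mat_torus_mulVec, rootMatrix_b_mulVec]
  ext i
  fin_cases i <;> simp <;> field_simp

theorem torus_semiconj_rootElt_ab (r : k) :
    SemiconjBy (torus s t hs ht) (rootElt .ab r) (rootElt .ab (s * r)) := by
  refine G2.ext_mulVec fun v => ?_
  simp only [Subgroup.coe_mul, mat_mul_mulVec, mat_rootElt, mat_torus_mulVec, rootMatrix_ab_mulVec]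
  ext i
  fin_cases i <;> simp <;> field_simp

theorem torus_semiconj_rootElt_aab (r : k) :
    SemiconjBy (torus s t hs ht) (rootElt .aab r) (rootElt .aab (s * t * r)) := by
  refine G2.ext_mulVec fun v => ?_
  simp only [Subgroup.coe_mul, mat_mul_mulVec, mat_rootElt, mat_torus_mulVec, rootMatrix_aab_mulVec]
  ext i
  fin_cases i <;> simp <;> field_simp

theorem torus_semiconj_rootElt_aaab (r : k) :
    SemiconjBy (torus s t hs ht) (rootElt .aaab r) (rootElt .aaab (s * t ^ 2 * r)) := by
  refine G2.ext_mulVec fun v => ?_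
  simp only [Subgroup.coe_mul, mat_mul_mulVec, mat_rootElt, mat_torus_mulVec,
    rootMatrix_aaab_mulVec]
  ext i
  fin_cases i <;> simp <;> field_simp

theorem torus_semiconj_rootElt_aaabb (r : k) :
    SemiconjBy (torus s t hs ht) (rootElt .aaabb r) (rootElt .aaabb (s ^ 2 * t * r)) := by
  refine G2.ext_mulVec fun v => ?_
  simp only [Subgroup.coe_mul, mat_mul_mulVec, mat_rootElt, mat_torus_mulVec,
    rootMatrix_aaabb_mulVec]
  ext i
  fin_cases i <;> simp <;> field_simp

theorem exists_torus_semiconj_rootElt (γ : PosRoot) (r : k) :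
    ∃ r', SemiconjBy (torus s t hs ht) (rootElt γ r) (rootElt γ r') := by
  cases γ
  · exact ⟨_, torus_semiconj_rootElt_a hs ht r⟩
  · exact ⟨_, torus_semiconj_rootElt_b hs ht r⟩
  · exact ⟨_, torus_semiconj_rootElt_ab hs ht r⟩
  · exact ⟨_, torus_semiconj_rootElt_aab hs ht r⟩
  · exact ⟨_, torus_semiconj_rootElt_aaab hs ht r⟩
  · exact ⟨_, torus_semiconj_rootElt_aaabb hs ht r⟩

end

theorem conj_mem_rootSubgroup {S : Set PosRoot} {g : G2 k}
    (hg : ∀ γ ∈ S, ∀ r, g * rootElt γ r * g⁻¹ ∈ rootSubgroup k S) {u : G2 k}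
    (hu : u ∈ rootSubgroup k S) : g * u * g⁻¹ ∈ rootSubgroup k S := by
  have : rootSubgroup k S ≤ (rootSubgroup k S).comap (MulAut.conj g).toMonoidHom := by
    refine (Subgroup.closure_le _).2 ?_
    rintro _ ⟨γ, hγ, r, rfl⟩
    exact hg γ hγ r
  exact this hu

theorem torus_conj_mem {s t : k} (hs : s ≠ 0) (ht : t ≠ 0) {S : Set PosRoot} {u : G2 k}
    (hu : u ∈ rootSubgroup k S) :
    torus s t hs ht * u * (torus s t hs ht)⁻¹ ∈ rootSubgroup k S := by
  refine conj_mem_rootSubgroup (fun γ hγ r => ?_) hu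
  obtain ⟨r', hr⟩ := exists_torus_semiconj_rootElt hs ht γ r
  rw [hr.eq, mul_inv_cancel_right]
  exact Subgroup.subset_closure ⟨γ, hγ, r', rfl⟩

theorem levi_of_lower_eq_zero (A : GL (Fin 2) k) (h : A 1 0 = 0) :
    ∃ s t hs ht r, levi A = torus s t hs ht * rootElt .b r := by
  have hd := A.det_ne_zero
  rw [Matrix.det_fin_two, h, mul_zero, sub_zero] at hd
  have h0 := left_ne_zero_of_mul hd
  have h1 := right_ne_zero_of_mul hd
  refine ⟨A 0 0, A 1 1, h0, h1, A 0 1 / A 0 0, ?_⟩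
  refine G2.ext_mulVec fun v => ?_
  simp only [Subgroup.coe_mul, mat_mul_mulVec, mat_rootElt, mat_torus_mulVec, rootMatrix_b_mulVec,
    mat_levi_mulVec, Matrix.det_fin_two A.val, h]
  ext i
  fin_cases i <;> simp <;> field_simp
  simp

theorem levi_of_lower_ne_zero (A : GL (Fin 2) k) (h : A 1 0 ≠ 0) :
    ∃ s t hs ht p q,
      levi A = rootElt .b p * (reflB * torus s t hs ht) * rootElt .b q := by
  have hd := A.det_ne_zero
  rw [Matrix.det_fin_two] at hd
  have h1 : A 0 1 - A 0 0 * A 1 1 / A 1 0 ≠ 0 := by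
    intro h'
    apply hd
    field_simp at h'
    linear_combination -h'
  refine ⟨A 1 0, A 0 1 - A 0 0 * A 1 1 / A 1 0, h, h1, A 0 0 / A 1 0, A 1 1 / A 1 0, ?_⟩
  have hdet : A.val.det = -(A 1 0 * (A 0 1 - A 0 0 * A 1 1 / A 1 0)) := by
    rw [Matrix.det_fin_two]
    field_simp
    ring
  refine G2.ext_mulVec fun v => ?_
  simp only [Subgroup.coe_mul, mat_mul_mulVec, mat_rootElt, mat_torus_mulVec, rootMatrix_b_mulVec,
    mat_levi_mulVec, hdet, mat_reflB_mulVec]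
  obtain ⟨m, hm⟩ : ∃ m, A 0 1 - A 0 0 * A 1 1 / A 1 0 = m := ⟨_, rfl⟩
  have hm' : A 0 1 = m + A 0 0 * A 1 1 / A 1 0 := by rw [← hm]; ring
  rw [hm] at h1 ⊢
  ext i
  fin_cases i <;> simp [hm'] <;> field_simp <;> ring

theorem ba_semiconj (r : k) :
    SemiconjBy (reflB * reflA) (rootElt .b r) (rootElt .aaabb (-r)) :=
  (reflB_semiconj_rootElt_aaab r).mul_left (reflA_semiconj_rootElt_b r)

theorem aba_semiconj (r : k) :
    SemiconjBy (reflA * (reflB * reflA)) (rootElt .b r) (rootElt .aaabb r) := by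
  simpa only [neg_neg] using (reflA_semiconj_rootElt_aaabb (-r)).mul_left (ba_semiconj r)

theorem baba_semiconj (r : k) :
    SemiconjBy (reflB * (reflA * (reflB * reflA))) (rootElt .b r) (rootElt .aaab (-r)) :=
  (reflB_semiconj_rootElt_aaabb r).mul_left (aba_semiconj r)

theorem ababa_semiconj (r : k) :
    SemiconjBy (reflA * (reflB * (reflA * (reflB * reflA)))) (rootElt .b r) (rootElt .b (-r)) :=
  (reflA_semiconj_rootElt_aaab (-r)).mul_left (baba_semiconj r)

theorem IsMinimalRep.mul_rootElt_b {w : G2 k} (hw : IsMinimalRep w) (r : k) :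
    ∃ u ∈ unipU k, w * rootElt .b r = u * w := by
  cases hw with
  | one => exact ⟨_, rootElt_mem_unipU .b r, by rw [one_mul, mul_one]⟩
  | a => exact ⟨_, rootElt_mem_unipU _ _, (reflA_semiconj_rootElt_b r).eq⟩
  | ba => exact ⟨_, rootElt_mem_unipU _ _, (ba_semiconj r).eq⟩
  | aba => exact ⟨_, rootElt_mem_unipU _ _, (aba_semiconj r).eq⟩
  | baba => exact ⟨_, rootElt_mem_unipU _ _, (baba_semiconj r).eq⟩
  | ababa => exact ⟨_, rootElt_mem_unipU _ _, (ababa_semiconj r).eq⟩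

/-- The Bruhat decomposition of `G₂(k)`. -/
theorem bruhat (g : G2 k) : ∃ u ∈ unipU k, ∃ w, IsMinimalRep w ∧ ∃ (s t : k) (hs : s ≠ 0)
    (ht : t ≠ 0), ∃ u' ∈ unipU k, g = u * (w * torus s t hs ht) * u' ∨
      g = u * (w * (reflB * torus s t hs ht)) * u' := by
  obtain ⟨w, hw, u, hu, c, hc, h⟩ := exists_inUOrbit (x := mat k g.1 *ᵥ ![0, 0, 0, 0, 1, 0, 0])
    (by rw [bilQ_mat, bilQ_apply]; simp) (by
      intro h
      have := mat_inv_mulVec h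
      rw [Matrix.mulVec_zero] at this
      simpa using congrFun this 4)
  have h' : mat k (w⁻¹ * (u * g)).1 *ᵥ ![0, 0, 0, 0, 1, 0, 0] = ![0, 0, 0, 0, c, 0, 0] := by
    rw [Subgroup.coe_mul, mat_mul_mulVec, Subgroup.coe_mul, mat_mul_mulVec, h, Matrix.mulVec_smul,
      Subgroup.coe_inv, mat_inv_mulVec rfl]
    simp
  obtain ⟨A, v, hv, hA⟩ := exists_eq_levi_mul_of_stabilizes_line h'
  -- The cell of the line `g⟨e₃X⁻⟩` fixes `w`; what remains stabilizes the line of `e₃X⁻` and lies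
  -- in `MV`. The Bruhat decomposition of `GL₂(k)` then splits the Levi factor.
  have hg : g = u⁻¹ * (w * levi A) * v := by
    rw [← mul_right_inj u, ← mul_right_inj w⁻¹, hA]
    group
  have hv' := unipV_le_unipU hv
  by_cases hA0 : A 1 0 = 0
  · obtain ⟨s, t, hs, ht, r, h⟩ := levi_of_lower_eq_zero A hA0
    refine ⟨u⁻¹, inv_mem hu, w, hw, s, t, hs, ht, rootElt .b r * v,
      mul_mem (rootElt_mem_unipU _ _) hv', .inl ?_⟩
    rw [hg, h]
    group
  · obtain ⟨s, t, hs, ht, p, q, h⟩ := levi_of_lower_ne_zero A hA0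
    -- As `w(β) > 0`, the left unipotent factor of the big cell of `GL₂(k)` passes across `w` into
    -- `U`.
    obtain ⟨u', hu', hw'⟩ := hw.mul_rootElt_b p
    refine ⟨u⁻¹ * u', mul_mem (inv_mem hu) hu', w, hw, s, t, hs, ht, rootElt .b q * v,
      mul_mem (rootElt_mem_unipU _ _) hv', .inr ?_⟩
    rw [hg, h, mul_assoc (rootElt _ _), ← mul_assoc w, hw']
    group

end Bruhat

/-! ### The anti-involution of `G₂(k)`. -/

section Gelfand

variable {k : Type*} [Field k] [NeZero (2 : k)]

/-- The torus element with `α = β = -1`. -/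
def signElt : G2 k := torus 1 (-1) one_ne_zero (neg_ne_zero.2 one_ne_zero)

theorem signElt_mul_self : signElt (k := k) * signElt = 1 := by
  refine G2.ext_mulVec fun v => ?_
  simp only [Subgroup.coe_mul, mat_mul_mulVec, signElt, mat_torus_mulVec, Subgroup.coe_one,
    map_one, Matrix.one_mulVec]
  ext i
  fin_cases i <;> simp

theorem signElt_inv : (signElt (k := k))⁻¹ = signElt :=
  inv_eq_of_mul_eq_one_left signElt_mul_self

/-- The anti-involution of `G₂(k)` which fixes the simple root elements. -/
def antiInvolution (g : G2 k) : G2 k := signElt * g⁻¹ * signElt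

theorem antiInvolution_mul (g h : G2 k) :
    antiInvolution (g * h) = antiInvolution h * antiInvolution g := by
  simp only [antiInvolution, mul_inv_rev, mul_assoc]
  rw [← mul_assoc signElt signElt, signElt_mul_self, one_mul]

theorem antiInvolution_antiInvolution (g : G2 k) : antiInvolution (antiInvolution g) = g := by
  simp only [antiInvolution, mul_inv_rev, signElt_inv, inv_inv, mul_assoc, signElt_mul_self,
    mul_one]
  rw [← mul_assoc, signElt_mul_self, one_mul]

theorem antiInvolution_mem {u : G2 k} (hu : u ∈ unipU k) : antiInvolution u ∈ unipU k := by
  have := torus_conj_mem (k := k) one_ne_zero (neg_ne_zero.2 one_ne_zero) (inv_mem hu)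
  change signElt * u⁻¹ * signElt⁻¹ ∈ _ at this
  rwa [signElt_inv] at this

/-- The restriction of `antiInvolution` to `U`. -/
def antiInvolutionU : Equiv.Perm (unipU k) where
  toFun u := ⟨antiInvolution u, antiInvolution_mem u.2⟩
  invFun u := ⟨antiInvolution u, antiInvolution_mem u.2⟩
  left_inv u := Subtype.ext (antiInvolution_antiInvolution _)
  right_inv u := Subtype.ext (antiInvolution_antiInvolution _)

theorem mat_signElt : mat k (signElt (k := k)).1 = Matrix.diagonal ![1, -1, -1, 1, -1, -1, 1] := by
  apply Matrix.ext_of_mulVec_single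
  intro i
  rw [signElt, mat_torus_mulVec]
  ext j
  fin_cases i <;> fin_cases j <;> simp [Matrix.mulVec_diagonal]

/-- Conjugation by `signElt` negates both matrix entries in the formula for the character, and so
inverts it; taking `u⁻¹` inverts it once more. -/
theorem whittakerChar_antiInvolutionU (ψ : AddChar k ℂ) (u : unipU k) :
    whittakerChar ψ (antiInvolutionU u) = whittakerChar ψ u := by
  have h1 : whittakerChar ψ u⁻¹ * whittakerChar ψ u = 1 :=
    Representation.char_inv_mul_self (whittakerChar ψ) u
  have h2 : whittakerChar ψ (antiInvolutionU u) * whittakerChar ψ u⁻¹ = 1 := by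
    change ψ (mat k (signElt * (u : G2 k)⁻¹ * signElt).1 0 1 +
      mat k (signElt * (u : G2 k)⁻¹ * signElt).1 3 5) *
      ψ (mat k ((u : G2 k)⁻¹).1 0 1 + mat k ((u : G2 k)⁻¹).1 3 5) = 1
    rw [← AddChar.map_add_eq_mul]
    convert ψ.map_zero_eq_one
    simp only [Subgroup.coe_mul, map_mul, mat_signElt, Matrix.mul_diagonal, Matrix.diagonal_mul]
    simp
    ring
  have h3 : whittakerChar ψ u⁻¹ ≠ 0 := left_ne_zero_of_mul_eq_one h1
  apply mul_right_cancel₀ h3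
  rw [h2, mul_comm, h1]

/-- The hypothesis says that `signElt * n` squares to one. It contains no inverse, so it can be
verified on coordinates. -/
theorem antiInvolution_eq_self {n : G2 k} (hn : n * (signElt * n) = signElt) :
    antiInvolution n = n := by
  have h : n⁻¹ * signElt = signElt * n := by rw [inv_mul_eq_iff_eq_mul, hn]
  rw [antiInvolution, mul_assoc, h, ← mul_assoc, signElt_mul_self, one_mul]

end Gelfand
-- Double cosets supporting Whittaker bi-equivariant functions.
section Support

variable {k : Type*} [Field k] {ψ : AddChar k ℂ}

theorem exists_addChar_mul_ne (hψ : ψ ≠ 1) {c : k} (hc : c ≠ 1) : ∃ r, ψ (c * r) ≠ ψ r := by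
  obtain ⟨x, hx⟩ := AddChar.ne_one_iff.1 hψ
  refine ⟨(c - 1)⁻¹ * x, fun h => hx ?_⟩
  have h1 : c * ((c - 1)⁻¹ * x) = x + (c - 1)⁻¹ * x := by
    have := sub_ne_zero.2 hc
    field_simp
    ring
  rw [h1, AddChar.map_add_eq_mul] at h
  have h2 : ψ ((c - 1)⁻¹ * x) ≠ 0 := (AddChar.val_isUnit ψ _).ne_zero
  exact mul_right_cancel₀ h2 (by rw [h, one_mul])

variable [NeZero (2 : k)]

/-- `n` supports a bi-equivariant function only if it is fixed by `antiInvolution`. -/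
def IsSupportAdapted (ψ : AddChar k ℂ) (n : G2 k) : Prop :=
  (∃ u u' : unipU k, u * n = n * u' ∧ whittakerChar ψ u ≠ whittakerChar ψ u') ∨
    antiInvolution n = n

theorem isSupportAdapted_of_semiconj {n : G2 k} {γ δ : PosRoot} {r r' : k}
    (h : SemiconjBy n (rootElt γ r) (rootElt δ r'))
    (hne : whittakerChar ψ ⟨rootElt δ r', rootElt_mem_unipU δ r'⟩ ≠
      whittakerChar ψ ⟨rootElt γ r, rootElt_mem_unipU γ r⟩) : IsSupportAdapted ψ n :=
  .inl ⟨_, _, h.eq.symm, hne⟩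

variable {s t : k} {hs : s ≠ 0} {ht : t ≠ 0}

/-- If `w` sends `α` to a positive root that is not simple, the character is trivial on the image of
`U_α` but not on `U_α`. -/
theorem isSupportAdapted_of_alpha (hψ : ψ ≠ 1) {w : G2 k} {δ : PosRoot} {f : k → k}
    (ha : δ ≠ .a) (hb : δ ≠ .b) (h : ∀ r, SemiconjBy w (rootElt .a r) (rootElt δ (f r))) :
    IsSupportAdapted ψ (w * torus s t hs ht) := by
  obtain ⟨r, hr⟩ := AddChar.ne_one_iff.1 hψ
  refine isSupportAdapted_of_semiconj ((h _).mul_left (torus_semiconj_rootElt_a hs ht r)) ?_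
  rw [whittakerChar_of_ne _ _ ha hb, whittakerChar_alpha]
  exact hr.symm

theorem isSupportAdapted_of_beta (hψ : ψ ≠ 1) {w : G2 k} {δ : PosRoot} {f : k → k}
    (ha : δ ≠ .a) (hb : δ ≠ .b) (h : ∀ r, SemiconjBy w (rootElt .b r) (rootElt δ (f r))) :
    IsSupportAdapted ψ (w * torus s t hs ht) := by
  obtain ⟨r, hr⟩ := AddChar.ne_one_iff.1 hψ
  refine isSupportAdapted_of_semiconj ((h _).mul_left (torus_semiconj_rootElt_b hs ht r)) ?_
  rw [whittakerChar_of_ne _ _ ha hb, whittakerChar_beta]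
  exact hr.symm

theorem isSupportAdapted_torus (hψ : ψ ≠ 1) : IsSupportAdapted ψ (torus s t hs ht) := by
  -- The values of `α` and `β` on the torus element are `t` and `s / t`. If either differs from 1
  -- the characters disagree; otherwise the element is 1.
  by_cases h1 : t = 1
  swap
  · obtain ⟨r, hr⟩ := exists_addChar_mul_ne hψ h1
    refine isSupportAdapted_of_semiconj (torus_semiconj_rootElt_a hs ht r) ?_
    rwa [whittakerChar_alpha, whittakerChar_alpha]
  by_cases h2 : s / t = 1
  swap
  · obtain ⟨r, hr⟩ := exists_addChar_mul_ne hψ h2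
    refine isSupportAdapted_of_semiconj (torus_semiconj_rootElt_b hs ht r) ?_
    rwa [whittakerChar_beta, whittakerChar_beta]
  subst h1
  rw [div_one] at h2
  subst h2
  refine .inr (antiInvolution_eq_self (G2.ext_mulVec fun v => ?_))
  simp only [Subgroup.coe_mul, mat_mul_mulVec, mat_torus_mulVec, signElt]
  simp

theorem isSupportAdapted_ababa (hψ : ψ ≠ 1) :
    IsSupportAdapted ψ (reflA * (reflB * (reflA * (reflB * reflA))) * torus s t hs ht) := by
  by_cases h1 : -(s / t) = 1
  swap
  · obtain ⟨r, hr⟩ := exists_addChar_mul_ne hψ h1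
    refine isSupportAdapted_of_semiconj
      ((ababa_semiconj _).mul_left (torus_semiconj_rootElt_b hs ht r)) ?_
    rwa [whittakerChar_beta, whittakerChar_beta, ← neg_mul]
  have h2 : s = -t := by
    field_simp at h1
    linear_combination -h1
  subst h2
  refine .inr (antiInvolution_eq_self (G2.ext_mulVec fun v => ?_))
  simp only [Subgroup.coe_mul, mat_mul_mulVec, mat_torus_mulVec, mat_reflA_mulVec,
    mat_reflB_mulVec, signElt, Matrix.cons_val]
  ext i
  fin_cases i <;> simp <;> field_simp

theorem ab_semiconj (r : k) :
    SemiconjBy (reflA * reflB) (rootElt .a r) (rootElt .aab (-r)) :=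
  (reflA_semiconj_rootElt_ab r).mul_left (reflB_semiconj_rootElt_a r)

theorem bab_semiconj (r : k) :
    SemiconjBy (reflB * reflA * reflB) (rootElt .a r) (rootElt .aab r) := by
  rw [mul_assoc]
  simpa only [neg_neg] using (reflB_semiconj_rootElt_aab (-r)).mul_left (ab_semiconj r)

theorem abab_semiconj (r : k) :
    SemiconjBy (reflA * (reflB * reflA) * reflB) (rootElt .a r) (rootElt .ab (-r)) := by
  rw [mul_assoc]
  exact (reflA_semiconj_rootElt_aab r).mul_left (bab_semiconj r)

theorem babab_semiconj (r : k) :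
    SemiconjBy (reflB * (reflA * (reflB * reflA)) * reflB) (rootElt .a r) (rootElt .a (-r)) := by
  rw [mul_assoc]
  exact (reflB_semiconj_rootElt_ab (-r)).mul_left (abab_semiconj r)

theorem isSupportAdapted_babab (hψ : ψ ≠ 1) :
    IsSupportAdapted ψ (reflB * (reflA * (reflB * reflA)) * reflB * torus s t hs ht) := by
  by_cases h1 : -t = 1
  swap
  · obtain ⟨r, hr⟩ := exists_addChar_mul_ne hψ h1
    refine isSupportAdapted_of_semiconj
      ((babab_semiconj _).mul_left (torus_semiconj_rootElt_a hs ht r)) ?_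
    rwa [whittakerChar_alpha, whittakerChar_alpha, ← neg_mul]
  have h2 : t = -1 := by linear_combination -h1
  subst h2
  refine .inr (antiInvolution_eq_self (G2.ext_mulVec fun v => ?_))
  simp only [Subgroup.coe_mul, mat_mul_mulVec, mat_torus_mulVec, mat_reflA_mulVec,
    mat_reflB_mulVec, signElt, Matrix.cons_val]
  ext i
  fin_cases i <;> simp <;> field_simp

theorem isSupportAdapted_longest : IsSupportAdapted ψ
    (reflA * (reflB * (reflA * (reflB * reflA))) * reflB * torus s t hs ht) := by
  refine .inr (antiInvolution_eq_self (G2.ext_mulVec fun v => ?_))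
  simp only [Subgroup.coe_mul, mat_mul_mulVec, mat_torus_mulVec, mat_reflA_mulVec,
    mat_reflB_mulVec, signElt, Matrix.cons_val]
  ext i
  fin_cases i <;> simp <;> field_simp

/-- All of these `w` except 1 and `ababa` send `β` to a positive root that is not simple. The word
`ababa` fixes `β`, with a sign that forces `s = -t`. -/
theorem IsMinimalRep.isSupportAdapted_mul_torus (hψ : ψ ≠ 1) {w : G2 k} (hw : IsMinimalRep w) :
    IsSupportAdapted ψ (w * torus s t hs ht) := by
  cases hw with
  | one => rw [one_mul]; exact isSupportAdapted_torus hψ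
  | a => exact isSupportAdapted_of_beta hψ (by simp) (by simp) reflA_semiconj_rootElt_b
  | ba => exact isSupportAdapted_of_beta hψ (by simp) (by simp) ba_semiconj
  | aba => exact isSupportAdapted_of_beta hψ (by simp) (by simp) aba_semiconj
  | baba => exact isSupportAdapted_of_beta hψ (by simp) (by simp) baba_semiconj
  | ababa => exact isSupportAdapted_ababa hψ

/-- The first four words send `α` to a positive root that is not simple. The word `babab` fixes `α`,
forcing `t = -1`, and over the longest element the anti-involution fixes every representative. -/
theorem IsMinimalRep.isSupportAdapted_mul_reflB_mul_torus (hψ : ψ ≠ 1) {w : G2 k}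
    (hw : IsMinimalRep w) : IsSupportAdapted ψ (w * (reflB * torus s t hs ht)) := by
  rw [← mul_assoc]
  cases hw with
  | one =>
    rw [one_mul]
    exact isSupportAdapted_of_alpha hψ (by simp) (by simp) reflB_semiconj_rootElt_a
  | a => exact isSupportAdapted_of_alpha hψ (by simp) (by simp) ab_semiconj
  | ba => exact isSupportAdapted_of_alpha hψ (by simp) (by simp) bab_semiconj
  | aba => exact isSupportAdapted_of_alpha hψ (by simp) (by simp) abab_semiconj
  | baba => exact isSupportAdapted_babab hψ
  | ababa => exact isSupportAdapted_longest

/-- The condition passes from `n` to `u n u'`: the character of `U` is invariant under conjugation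
in `U`, and the factors that relate `θ(u') n θ(u)` to `u n u'` have cancelling characters because
`θ` preserves the character. -/
theorem IsSupportAdapted.support {n u u' : G2 k} (hn : IsSupportAdapted ψ n) (hu : u ∈ unipU k)
    (hu' : u' ∈ unipU k) :
    (∃ v v' : unipU k, (unipU k).subtype v * (u * n * u') = u * n * u' * (unipU k).subtype v' ∧
      whittakerChar ψ v ≠ whittakerChar ψ v') ∨
    ∃ v v' : unipU k, antiInvolution (u * n * u') =
      (unipU k).subtype v * (u * n * u') * (unipU k).subtype v' ∧
      whittakerChar ψ v * whittakerChar ψ v' = 1 := by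
  have conj (a b : unipU k) : whittakerChar ψ (a * b * a⁻¹) = whittakerChar ψ b := by
    rw [map_mul, map_mul, mul_right_comm, ← map_mul, mul_inv_cancel, map_one, one_mul]
  lift u to unipU k using hu
  lift u' to unipU k using hu'
  rcases hn with ⟨v, v', h, hne⟩ | h
  · refine .inl ⟨u * v * u⁻¹, u'⁻¹ * v' * u'⁻¹⁻¹, ?_, by rwa [conj, conj]⟩
    have h' : (v : G2 k) = n * v' * n⁻¹ := by rw [← h, mul_inv_cancel_right]
    simp only [Subgroup.coe_subtype, Subgroup.coe_mul, Subgroup.coe_inv, h']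
    group
  · refine .inr ⟨antiInvolutionU u' * u⁻¹, u'⁻¹ * antiInvolutionU u, ?_, ?_⟩
    · rw [antiInvolution_mul, antiInvolution_mul, h]
      simp only [Subgroup.coe_subtype, Subgroup.coe_mul, Subgroup.coe_inv, antiInvolutionU,
        Equiv.coe_fn_mk]
      group
    · rw [map_mul, map_mul, whittakerChar_antiInvolutionU, whittakerChar_antiInvolutionU]
      have h1 := Representation.char_inv_mul_self (whittakerChar ψ) u
      have h2 := Representation.char_inv_mul_self (whittakerChar ψ) u'
      linear_combination whittakerChar ψ u⁻¹ * whittakerChar ψ u * h2 + h1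

/-- The Whittaker character of `U` has a Gelfand involution. -/
theorem isGelfandInvolution_whittakerChar (hψ : ψ ≠ 1) : Representation.IsGelfandInvolution
    (unipU k).subtype (whittakerChar ψ) antiInvolution antiInvolutionU where
  map_mul := antiInvolution_mul
  map_incl _ := rfl
  map_char := whittakerChar_antiInvolutionU ψ
  support g := by
    obtain ⟨u, hu, w, hw, s, t, hs, ht, u', hu', rfl | rfl⟩ := bruhat g
    · exact (hw.isSupportAdapted_mul_torus hψ).support hu hu'
    · exact (hw.isSupportAdapted_mul_reflB_mul_torus hψ).support hu hu'

end Support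

/-! ### Uniqueness of Whittaker functionals for `GL₂(k)`. -/

section GL2

variable {k : Type*} [Field k]

/-- The anti-involution `(a b; c d) ↦ (d b; c a)` of `GL₂(k)`. -/
def antiInvolutionGL2 (A : GL (Fin 2) k) : GL (Fin 2) k :=
  mkGL2 (A 1 1) (A 0 1) (A 1 0) (A 0 0) (by
    have := A.det_ne_zero
    rwa [Matrix.det_fin_two, mul_comm (A 0 0)] at this)

/-- The upper triangular unipotent subgroup of `GL₂(k)`. -/
def upperHom (k : Type*) [Field k] : Multiplicative k →* GL (Fin 2) k :=
  AddChar.toMonoidHom Matrix.GeneralLinearGroup.upperRightHom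

/-- An upper triangular matrix with unequal diagonal entries rescales the unipotent subgroup, hence
supports nothing; with equal entries it is fixed. In the big cell, conjugation by an upper unipotent
matrix exchanges the diagonal entries. -/
theorem isGelfandInvolution_upperHom {ψ : AddChar k ℂ} (hψ : ψ ≠ 1) :
    Representation.IsGelfandInvolution (upperHom k) ψ.toMonoidHom antiInvolutionGL2
      (Equiv.refl _) where
  map_mul A B := by
    ext i j
    fin_cases i <;> fin_cases j <;>
      simp [antiInvolutionGL2, Matrix.mul_apply, Fin.sum_univ_two] <;> ring
  map_incl r := by
    ext i j
    fin_cases i <;> fin_cases j <;> simp [antiInvolutionGL2, upperHom]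
  map_char _ := rfl
  support A := by
    have hd := A.det_ne_zero
    rw [Matrix.det_fin_two] at hd
    by_cases hc : A 1 0 = 0
    · rw [hc, mul_zero, sub_zero] at hd
      have ha := left_ne_zero_of_mul hd
      by_cases h1 : A 1 1 / A 0 0 = 1
      · refine .inr ⟨1, 1, ?_, by simp⟩
        have h2 : A 1 1 = A 0 0 := by rwa [div_eq_one_iff_eq ha] at h1
        rw [map_one, one_mul, mul_one]
        ext i j
        fin_cases i <;> fin_cases j <;> simp [antiInvolutionGL2, h2]
      · obtain ⟨r, hr⟩ := exists_addChar_mul_ne hψ h1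
        refine .inl ⟨.ofAdd r, .ofAdd (A 1 1 / A 0 0 * r), ?_, hr.symm⟩
        ext i j
        fin_cases i <;> fin_cases j <;>
          simp [upperHom, Matrix.mul_apply, Fin.sum_univ_two, hc]
        field_simp
        ring
    · refine .inr ⟨.ofAdd ((A 1 1 - A 0 0) / A 1 0), .ofAdd (-((A 1 1 - A 0 0) / A 1 0)), ?_, ?_⟩
      · ext i j
        fin_cases i <;> fin_cases j <;>
          simp [antiInvolutionGL2, upperHom, Matrix.mul_apply, Matrix.vecMul, dotProduct,
            Fin.sum_univ_two]
        all_goals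
          field_simp
          ring
      · have h := ψ.map_add_eq_mul ((A 1 1 - A 0 0) / A 1 0) (-((A 1 1 - A 0 0) / A 1 0))
        rw [add_neg_cancel, AddChar.map_zero_eq_one] at h
        exact h.symm

end GL2
-- Vectors fixed by `planeFixer`, and the existence of Whittaker vectors.
section Kirillov

variable {k : Type*} [Field k] [NeZero (2 : k)]

theorem levi_upperHom (r : k) : levi (upperHom k (.ofAdd r)) = rootElt .b r := by
  refine G2.ext_mulVec fun v => ?_
  rw [mat_levi_mulVec, mat_rootElt, rootMatrix_b_mulVec]
  ext i
  fin_cases i <;> simp [upperHom]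

/-- The root subgroup of `γ` as a homomorphism. -/
def rootHom (γ : PosRoot) : Multiplicative k →* G2 k where
  toFun r := rootElt γ r.toAdd
  map_one' := G2.ext (rootMatrix_zero γ)
  map_mul' r s := G2.ext (rootMatrix_add γ r.toAdd s.toAdd)

/-- The elements of `G₂(k)` which fix `e₁X⁺` and `e₂X⁺`. -/
def planeFixer (k : Type*) [Field k] [NeZero (2 : k)] : Subgroup (G2 k) where
  carrier := {g | mat k g.1 *ᵥ ![1, 0, 0, 0, 0, 0, 0] = ![1, 0, 0, 0, 0, 0, 0] ∧
    mat k g.1 *ᵥ ![0, 1, 0, 0, 0, 0, 0] = ![0, 1, 0, 0, 0, 0, 0]}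
  one_mem' := by simp
  mul_mem' {g h} hg hh := by
    constructor
    · rw [Subgroup.coe_mul, mat_mul_mulVec, hh.1, hg.1]
    · rw [Subgroup.coe_mul, mat_mul_mulVec, hh.2, hg.2]
  inv_mem' {g} hg := ⟨mat_inv_mulVec hg.1, mat_inv_mulVec hg.2⟩

theorem rootElt_mem_planeFixer {γ : PosRoot} (ha : γ ≠ .a) (hb : γ ≠ .b) (hab : γ ≠ .ab) (r : k) :
    rootElt γ r ∈ planeFixer k := by
  constructor <;> cases γ <;>
    simp_all [rootMatrix_aab_mulVec, rootMatrix_aaab_mulVec, rootMatrix_aaabb_mulVec]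

theorem planeFixer_mulVec {g : G2 k} (hg : g ∈ planeFixer k) (x y z : k) :
    mat k g.1 *ᵥ ![x, y, 0, 0, z, 0, 0] = ![x, y, 0, 0, z, 0, 0] := by
  have h4 := cross_mulVec g ![1, 0, 0, 0, 0, 0, 0] ![0, 1, 0, 0, 0, 0, 0]
  rw [hg.1, hg.2] at h4
  have e4 : cross (k := k) ![1, 0, 0, 0, 0, 0, 0] ![0, 1, 0, 0, 0, 0, 0] =
    ![0, 0, 0, 0, 1, 0, 0] := by simp [cross]
  rw [e4] at h4
  have e : (![x, y, 0, 0, z, 0, 0] : Fin 7 → k) = x • ![1, 0, 0, 0, 0, 0, 0] +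
      y • ![0, 1, 0, 0, 0, 0, 0] + z • ![0, 0, 0, 0, 1, 0, 0] := by simp
  rw [e, Matrix.mulVec_add, Matrix.mulVec_add, Matrix.mulVec_smul, Matrix.mulVec_smul,
    Matrix.mulVec_smul, hg.1, hg.2, ← h4]

/-- The group `planeFixer` also fixes `e₃X⁻`, so it acts trivially on the span into which `p` maps
the plane. -/
theorem conj_mem_planeFixer {g p : G2 k} (hg : g ∈ planeFixer k) {a b c a' b' c' : k}
    (h0 : mat k p.1 *ᵥ ![1, 0, 0, 0, 0, 0, 0] = ![a, b, 0, 0, c, 0, 0])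
    (h1 : mat k p.1 *ᵥ ![0, 1, 0, 0, 0, 0, 0] = ![a', b', 0, 0, c', 0, 0]) :
    p⁻¹ * g * p ∈ planeFixer k := by
  constructor
  · rw [Subgroup.coe_mul, mat_mul_mulVec, Subgroup.coe_mul, mat_mul_mulVec, h0,
      planeFixer_mulVec hg, ← h0, Subgroup.coe_inv, mat_inv_mulVec rfl]
  · rw [Subgroup.coe_mul, mat_mul_mulVec, Subgroup.coe_mul, mat_mul_mulVec, h1,
      planeFixer_mulVec hg, ← h1, Subgroup.coe_inv, mat_inv_mulVec rfl]

variable {V : Type*} [AddCommGroup V] [Module ℂ V] (ρ : Representation ℂ (G2 k) V)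

/-- The vectors fixed by `planeFixer`. -/
def planeInv : Submodule ℂ V where
  carrier := {z | ∀ g ∈ planeFixer k, ρ g z = z}
  add_mem' hx hy g hg := by rw [map_add, hx g hg, hy g hg]
  zero_mem' g _ := map_zero _
  smul_mem' c x hx g hg := by rw [map_smul, hx g hg]

/-- The vectors on which the root subgroup of `γ` acts by the character `r ↦ ψ (m * r)`. -/
def rootEigen (ψ : AddChar k ℂ) (γ : PosRoot) (m : k) : Submodule ℂ V where
  carrier := {z | ∀ r, ρ (rootElt γ r) z = ψ (m * r) • z}
  add_mem' hx hy r := by rw [map_add, hx r, hy r, smul_add]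
  zero_mem' r := by simp
  smul_mem' c x hx r := by rw [map_smul, hx r, smul_comm]

variable {ρ} {ψ : AddChar k ℂ}

/-- The translate `ρ g z` depends only on the images of `e₁X⁺` and `e₂X⁺`, so relations modulo
`planeFixer` need checking on two vectors only. -/
theorem rep_congr {z : V} (hz : z ∈ planeInv ρ) {g h : G2 k}
    (h0 : mat k g.1 *ᵥ ![1, 0, 0, 0, 0, 0, 0] = mat k h.1 *ᵥ ![1, 0, 0, 0, 0, 0, 0])
    (h1 : mat k g.1 *ᵥ ![0, 1, 0, 0, 0, 0, 0] = mat k h.1 *ᵥ ![0, 1, 0, 0, 0, 0, 0]) :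
    ρ g z = ρ h z := by
  have hm : h⁻¹ * g ∈ planeFixer k := by
    constructor
    · rw [Subgroup.coe_mul, mat_mul_mulVec, h0, Subgroup.coe_inv, mat_inv_mulVec rfl]
    · rw [Subgroup.coe_mul, mat_mul_mulVec, h1, Subgroup.coe_inv, mat_inv_mulVec rfl]
  calc ρ g z = ρ (h * (h⁻¹ * g)) z := by rw [mul_inv_cancel_left]
    _ = ρ h z := by rw [map_mul, Module.End.mul_apply, hz _ hm]

theorem rep_mem_planeInv {z : V} (hz : z ∈ planeInv ρ) {p : G2 k} {a b c a' b' c' : k}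
    (h0 : mat k p.1 *ᵥ ![1, 0, 0, 0, 0, 0, 0] = ![a, b, 0, 0, c, 0, 0])
    (h1 : mat k p.1 *ᵥ ![0, 1, 0, 0, 0, 0, 0] = ![a', b', 0, 0, c', 0, 0]) :
    ρ p z ∈ planeInv ρ := by
  intro g hg
  have := hz _ (conj_mem_planeFixer hg h0 h1)
  rw [← Module.End.mul_apply, ← map_mul]
  conv_rhs => rw [← this, ← Module.End.mul_apply, ← map_mul]
  congr 2
  group

theorem levi_mem_planeInv {z : V} (hz : z ∈ planeInv ρ) (A : GL (Fin 2) k) :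
    ρ (levi A) z ∈ planeInv ρ := by
  apply rep_mem_planeInv hz (a := A 0 0) (b := A 1 0) (c := 0) (a' := A 0 1) (b' := A 1 1)
    (c' := 0) <;> rw [mat_levi_mulVec] <;> simp

theorem rootElt_a_mem_planeInv {z : V} (hz : z ∈ planeInv ρ) (r : k) :
    ρ (rootElt .a r) z ∈ planeInv ρ := by
  apply rep_mem_planeInv hz (a := 1) (b := 0) (c := -r) (a' := 0) (b' := 1) (c' := 0) <;>
    rw [mat_rootElt, rootMatrix_a_mulVec] <;> simp

theorem rootElt_ab_mem_planeInv {z : V} (hz : z ∈ planeInv ρ) (r : k) :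
    ρ (rootElt .ab r) z ∈ planeInv ρ := by
  apply rep_mem_planeInv hz (a := 1) (b := 0) (c := 0) (a' := 0) (b' := 1) (c' := r) <;>
    rw [mat_rootElt, rootMatrix_ab_mulVec] <;> simp

/-- Modulo `planeFixer` the root groups of `α` and `α+β` form a plane `k²` on which the Levi
subgroup acts linearly. The pair `(m', n')` is the transform of the character `(m, n)`, multiplied
through by the determinant. -/
theorem levi_mem_rootEigen {z : V} (hz : z ∈ planeInv ρ) {m n m' n' : k}
    (ha : z ∈ rootEigen ρ ψ .a m) (hab : z ∈ rootEigen ρ ψ .ab n) (A : GL (Fin 2) k)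
    (hm : m' * A.val.det = m * A 0 0 - n * A 0 1) (hn : n' * A.val.det = n * A 1 1 - m * A 1 0) :
    ρ (levi A) z ∈ rootEigen ρ ψ .a m' ∧ ρ (levi A) z ∈ rootEigen ρ ψ .ab n' := by
  have hd := A.det_ne_zero
  have key {g : G2 k} {p q : k}
      (h0 : mat k (g * levi A).1 *ᵥ ![1, 0, 0, 0, 0, 0, 0] =
        mat k (levi A * (rootElt .a p * rootElt .ab q)).1 *ᵥ ![1, 0, 0, 0, 0, 0, 0])
      (h1 : mat k (g * levi A).1 *ᵥ ![0, 1, 0, 0, 0, 0, 0] =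
        mat k (levi A * (rootElt .a p * rootElt .ab q)).1 *ᵥ ![0, 1, 0, 0, 0, 0, 0]) :
      ρ g (ρ (levi A) z) = ψ (m * p + n * q) • ρ (levi A) z := by
    rw [← Module.End.mul_apply, ← map_mul, rep_congr hz h0 h1]
    simp only [map_mul, Module.End.mul_apply]
    rw [hab q, map_smul, ha p, smul_smul, map_smul, ← AddChar.map_add_eq_mul, add_comm]
  constructor
  · intro r
    rw [key (p := r * A 0 0 / A.val.det) (q := -(r * A 0 1 / A.val.det))]
    · congr 2
      field_simp
      linear_combination -r * hm
    · simp only [Subgroup.coe_mul, mat_mul_mulVec, mat_rootElt, mat_levi_mulVec,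
        rootMatrix_a_mulVec, rootMatrix_ab_mulVec, Matrix.cons_val]
      ext i
      fin_cases i <;> simp
      field_simp
    · simp only [Subgroup.coe_mul, mat_mul_mulVec, mat_rootElt, mat_levi_mulVec,
        rootMatrix_a_mulVec, rootMatrix_ab_mulVec, Matrix.cons_val]
      ext i
      fin_cases i <;> simp
      field_simp
  · intro r
    rw [key (p := -(r * A 1 0 / A.val.det)) (q := r * A 1 1 / A.val.det)]
    · congr 2
      field_simp
      linear_combination -r * hn
    · simp only [Subgroup.coe_mul, mat_mul_mulVec, mat_rootElt, mat_levi_mulVec,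
        rootMatrix_a_mulVec, rootMatrix_ab_mulVec, Matrix.cons_val]
      ext i
      fin_cases i <;> simp
      field_simp
    · simp only [Subgroup.coe_mul, mat_mul_mulVec, mat_rootElt, mat_levi_mulVec,
        rootMatrix_a_mulVec, rootMatrix_ab_mulVec, Matrix.cons_val]
      ext i
      fin_cases i <;> simp
      field_simp

theorem eq_zero_of_rootSubgroup_invariant {S : Set PosRoot} {z : V}
    (h : ∀ γ ∈ S, ∀ r, ρ (rootElt γ r) z = z) {u : G2 k} (hu : u ∈ rootSubgroup k S) :
    ρ u z = z := by
  induction hu using Subgroup.closure_induction with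
  | mem x hx =>
    obtain ⟨γ, hγ, r, rfl⟩ := hx
    exact h γ hγ r
  | one => simp
  | mul x y _ _ hx hy => rw [map_mul, Module.End.mul_apply, hy, hx]
  | inv x _ hx =>
    conv_lhs => rw [← hx]
    rw [← Module.End.mul_apply, ← map_mul, inv_mul_cancel, map_one, Module.End.one_apply]

theorem IsCuspidal.eq_zero [Finite k] (hρ : IsCuspidal ρ) {N : Subgroup (G2 k)}
    (hN : N ∈ ({unipU k, unipV k, unipV' k} : Set (Subgroup (G2 k)))) (g : G2 k) {z : V}
    (hz : ∀ n ∈ N, ρ (g * n * g⁻¹) z = z) : z = 0 := by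
  have := hρ N hN g
  refine Representation.eq_zero_of_subsingleton_coinvariants
    (ρ.comp (N.map (MulAut.conj g).toMonoidHom).subtype) ?_
  rintro ⟨_, n, hn, rfl⟩
  exact hz n hn

theorem rootElt_mem_rootEigen_zero {z : V} {γ : PosRoot} (hz : z ∈ rootEigen ρ ψ γ 0) (r : k) :
    ρ (rootElt γ r) z = z := by
  rw [hz r, zero_mul, AddChar.map_zero_eq_one, one_smul]

theorem whittaker_of_rootEigen {z : V} (hz : z ∈ planeInv ρ) (ha : z ∈ rootEigen ρ ψ .a 1)
    (hb : z ∈ rootEigen ρ ψ .b 1) (hab : z ∈ rootEigen ρ ψ .ab 0) (u : unipU k) :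
    ρ u z = whittakerChar ψ u • z := by
  obtain ⟨u, hu⟩ := u
  have key : ∀ u ∈ unipU k, ∀ hu : u ∈ unipU k, ρ u z = whittakerChar ψ ⟨u, hu⟩ • z := by
    intro u hu'
    induction hu' using Subgroup.closure_induction with
    | mem x hx =>
      obtain ⟨γ, -, r, rfl⟩ := hx
      intro hu
      by_cases h1 : γ = .a
      · subst h1
        rw [whittakerChar_alpha, ha r, one_mul]
      by_cases h2 : γ = .b
      · subst h2
        rw [whittakerChar_beta, hb r, one_mul]
      rw [whittakerChar_of_ne _ _ h1 h2, one_smul]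
      by_cases h3 : γ = .ab
      · exact h3 ▸ rootElt_mem_rootEigen_zero hab r
      · exact hz _ (rootElt_mem_planeFixer h1 h2 h3 r)
    | one =>
      intro hu
      have e : (⟨1, hu⟩ : unipU k) = 1 := Subtype.ext (by simp)
      rw [e, map_one, map_one, one_smul, Module.End.one_apply]
    | mul x y hx' hy' hx hy =>
      intro hu
      have e : (⟨x * y, hu⟩ : unipU k) = ⟨x, hx'⟩ * ⟨y, hy'⟩ := Subtype.ext (by simp)
      rw [e, map_mul (whittakerChar ψ), map_mul, Module.End.mul_apply, hy hy', map_smul, hx hx',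
        smul_smul, mul_comm]
    | inv x hx' hx =>
      intro hu
      have e : (⟨x⁻¹, hu⟩ : unipU k) = ⟨x, hx'⟩⁻¹ := Subtype.ext (by simp)
      have h1 := Representation.char_inv_mul_self (whittakerChar ψ) ⟨x, hx'⟩
      have h2 : ρ x⁻¹ (ρ x z) = z := by
        rw [← Module.End.mul_apply, ← map_mul, inv_mul_cancel, map_one, Module.End.one_apply]
      rw [hx hx', map_smul] at h2
      rw [e]
      conv_rhs => rw [← h2, smul_smul, h1, one_smul]
  exact key u hu hu

/-- In a cuspidal representation, a nonzero subspace stable under `P` which contains a vector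
invariant under `planeFixer` contains a Whittaker vector. -/
theorem IsCuspidal.exists_whittaker_vector [Finite k] (hρ : IsCuspidal ρ) (hψ : ψ ≠ 1)
    {Z : Submodule ℂ V} (hZl : ∀ A, ∀ z ∈ Z, ρ (levi A) z ∈ Z)
    (hZa : ∀ r, ∀ z ∈ Z, ρ (rootElt .a r) z ∈ Z) (hZab : ∀ r, ∀ z ∈ Z, ρ (rootElt .ab r) z ∈ Z)
    {y : V} (hy : y ∈ Z) (hyU : y ∈ planeInv ρ) (hy0 : y ≠ 0) :
    ∃ z ∈ Z, z ≠ 0 ∧ ∀ u : unipU k, ρ u z = whittakerChar ψ u • z := by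
  have hinj (g : G2 k) {z : V} (hz : z ≠ 0) : ρ g z ≠ 0 := by
    intro h
    apply hz
    have := congrArg (ρ g⁻¹) h
    rwa [← Module.End.mul_apply, ← map_mul, inv_mul_cancel, map_one, Module.End.one_apply,
      map_zero] at this
  -- The action of `V` on the invariants of `planeFixer` factors through `k²`; it is diagonalized in
  -- two steps.
  obtain ⟨χ₁, z₁, hz₁, hz₁0, hz₁χ⟩ := Representation.exists_addChar_eigenvector
    (ρ.comp (rootHom .ab)) (Z ⊓ planeInv ρ)
    (fun r z hz => ⟨hZab r z hz.1, rootElt_ab_mem_planeInv hz.2 r⟩) ⟨hy, hyU⟩ hy0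
  obtain ⟨n, hn⟩ := AddChar.exists_forall_eq_mul hψ χ₁
  have hz₁n : z₁ ∈ rootEigen ρ ψ .ab n := fun r => by rw [← hn]; exact hz₁χ r
  obtain ⟨χ₂, z₂, hz₂, hz₂0, hz₂χ⟩ := Representation.exists_addChar_eigenvector
    (ρ.comp (rootHom .a)) (Z ⊓ planeInv ρ ⊓ rootEigen ρ ψ .ab n)
    -- The two root groups commute modulo `planeFixer`, so the eigenspace of the first is stable
    -- under the second.
    (fun r z hz => ⟨⟨hZa r z hz.1.1, rootElt_a_mem_planeInv hz.1.2 r⟩, fun s => by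
      change ρ (rootElt .ab s) (ρ (rootElt .a r) z) = _ • ρ (rootElt .a r) z
      rw [← map_smul, ← hz.2 s, ← Module.End.mul_apply, ← Module.End.mul_apply, ← map_mul,
        ← map_mul]
      apply rep_congr hz.1.2 <;>
      · simp only [Subgroup.coe_mul, mat_mul_mulVec, mat_rootElt, rootMatrix_a_mulVec,
          rootMatrix_ab_mulVec]
        simp⟩) ⟨hz₁, hz₁n⟩ hz₁0
  obtain ⟨m, hm⟩ := AddChar.exists_forall_eq_mul hψ χ₂
  have hz₂m : z₂ ∈ rootEigen ρ ψ .a m := fun r => by rw [← hm]; exact hz₂χ r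
  -- If both characters were trivial, `z₂` would be invariant under `V`, against cuspidality for
  -- `P`.
  have hmn : m ≠ 0 ∨ n ≠ 0 := by
    by_contra! h
    obtain ⟨rfl, rfl⟩ := h
    refine hz₂0 (hρ.eq_zero (N := unipV k) (by simp) 1 fun u hu => ?_)
    rw [one_mul, inv_one, mul_one]
    refine eq_zero_of_rootSubgroup_invariant (fun γ hγ r => ?_) hu
    by_cases ha : γ = .a
    · exact ha ▸ rootElt_mem_rootEigen_zero hz₂m r
    by_cases hab : γ = .ab
    · exact hab ▸ rootElt_mem_rootEigen_zero hz₂.2 r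
    exact hz₂.1.2 _ (rootElt_mem_planeFixer ha hγ hab r)
  -- `GL₂(k)` is transitive on the nontrivial characters of `k²`; this `A` moves `(m, n)` to `(1,
  -- 0)`, which `U_β` fixes.
  obtain ⟨A, hA⟩ : ∃ A : GL (Fin 2) k, 1 * A.val.det = m * A 0 0 - n * A 0 1 ∧
      0 * A.val.det = n * A 1 1 - m * A 1 0 := by
    by_cases h0 : m = 0
    · have hn0 : n ≠ 0 := hmn.resolve_left (not_not.2 h0)
      refine ⟨mkGL2 0 1 n m (by simpa using hn0), ?_, ?_⟩ <;> simp [Matrix.det_fin_two, mul_comm]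
    · refine ⟨mkGL2 1 0 n m (by simpa using h0), ?_, ?_⟩ <;> simp [Matrix.det_fin_two, mul_comm]
  obtain ⟨ha₃, hab₃⟩ := levi_mem_rootEigen hz₂.1.2 hz₂m hz₂.2 A hA.1 hA.2
  obtain ⟨χ₄, z₄, hz₄, hz₄0, hz₄χ⟩ := Representation.exists_addChar_eigenvector
    (ρ.comp (rootHom .b)) (Z ⊓ planeInv ρ ⊓ (rootEigen ρ ψ .a 1 ⊓ rootEigen ρ ψ .ab 0))
    (fun r z hz => by
      change ρ (rootElt .b r) z ∈ _
      rw [← levi_upperHom]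
      exact ⟨⟨hZl _ z hz.1.1, levi_mem_planeInv hz.1.2 _⟩,
        levi_mem_rootEigen hz.1.2 hz.2.1 hz.2.2 _ (by simp [upperHom]) (by simp [upperHom])⟩)
    ⟨⟨hZl A _ hz₂.1.1, levi_mem_planeInv hz₂.1.2 A⟩, ha₃, hab₃⟩ (hinj _ hz₂0)
  obtain ⟨j, hj⟩ := AddChar.exists_forall_eq_mul hψ χ₄
  have hz₄j : z₄ ∈ rootEigen ρ ψ .b j := fun r => by rw [← hj]; exact hz₄χ r
  -- For `j = 0` the vector would be invariant under `V'`, against cuspidality for `P'`.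
  have hj0 : j ≠ 0 := by
    rintro rfl
    refine hz₄0 (hρ.eq_zero (N := unipV' k) (by simp) 1 fun u hu => ?_)
    rw [one_mul, inv_one, mul_one]
    refine eq_zero_of_rootSubgroup_invariant (fun γ hγ r => ?_) hu
    by_cases hb : γ = .b
    · exact hb ▸ rootElt_mem_rootEigen_zero hz₄j r
    by_cases hab : γ = .ab
    · exact hab ▸ rootElt_mem_rootEigen_zero hz₄.2.2 r
    exact hz₄.1.2 _ (rootElt_mem_planeFixer hγ hb hab r)
  -- On this torus element `α` is 1 and `β` is `j`: it normalizes the `β`-character to `ψ` and keeps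
  -- the other two.
  have hT : torus j 1 hj0 one_ne_zero = levi (mkGL2 j 0 0 1 (by simp [hj0])) := rfl
  obtain ⟨ha₅, hab₅⟩ := levi_mem_rootEigen (m' := 1) (n' := 0) hz₄.1.2 hz₄.2.1 hz₄.2.2
    (mkGL2 j 0 0 1 (by simp [hj0])) (by simp [Matrix.det_fin_two])
    (by simp [Matrix.det_fin_two])
  have hU₅ := levi_mem_planeInv hz₄.1.2 (mkGL2 j 0 0 1 (by simp [hj0]))
  rw [← hT] at ha₅ hab₅ hU₅
  have hb₅ : ρ (torus j 1 hj0 one_ne_zero) z₄ ∈ rootEigen ρ ψ .b 1 := by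
    intro r
    have h := torus_semiconj_rootElt_b hj0 one_ne_zero (j⁻¹ * r)
    rw [div_one, mul_inv_cancel_left₀ hj0] at h
    rw [← Module.End.mul_apply, ← map_mul, ← h.eq, map_mul, Module.End.mul_apply, hz₄j, map_smul,
      mul_inv_cancel_left₀ hj0, one_mul]
  refine ⟨ρ (torus j 1 hj0 one_ne_zero) z₄, hZl _ _ hz₄.1.1, hinj _ hz₄0,
    whittaker_of_rootEigen hU₅ ha₅ hb₅ hab₅⟩

end Kirillov
-- The parabolic subgroup of `SO₇(k)` as the stabilizer of a plane.
section Cosets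

variable {k : Type*} [Field k]

theorem mulVec_eq_entries (M : Matrix (Fin 7) (Fin 7) k) :
    (M *ᵥ ![1, 0, 0, 0, 0, 0, 0] = fun i => M i 0) ∧
    (M *ᵥ ![0, 1, 0, 0, 0, 0, 0] = fun i => M i 1) := by
  constructor <;> ext i <;> simp [Matrix.mulVec, dotProduct, Fin.sum_univ_succ]

/-- An element of `SO₇(k)` which preserves the span of the first two basis vectors is in the
parabolic subgroup. -/
theorem mem_parabolicSO7 {g : SO7 k} {a b c d : k}
    (h0 : mat k g *ᵥ ![1, 0, 0, 0, 0, 0, 0] = ![a, b, 0, 0, 0, 0, 0])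
    (h1 : mat k g *ᵥ ![0, 1, 0, 0, 0, 0, 0] = ![c, d, 0, 0, 0, 0, 0]) : g ∈ parabolicSO7 k := by
  have inj {v : Fin 7 → k} (hv : mat k g *ᵥ v = 0) : v = 0 := by
    rw [← mat_inv_mulVec hv, Matrix.mulVec_zero]
  have comb (p q : k) : mat k g *ᵥ ![p, q, 0, 0, 0, 0, 0] =
      ![p * a + q * c, p * b + q * d, 0, 0, 0, 0, 0] := by
    have e : (![p, q, 0, 0, 0, 0, 0] : Fin 7 → k) =
      p • ![1, 0, 0, 0, 0, 0, 0] + q • ![0, 1, 0, 0, 0, 0, 0] := by simp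
    rw [e, Matrix.mulVec_add, Matrix.mulVec_smul, Matrix.mulVec_smul, h0, h1]
    simp
  have hd : a * d - b * c ≠ 0 := by
    intro hd
    have e1 := inj (v := ![d, -b, 0, 0, 0, 0, 0]) (by
      rw [comb]
      have h : d * a + -b * c = 0 := by linear_combination hd
      have h' : d * b + -b * d = 0 := by ring
      rw [h, h']
      simp)
    have e2 := inj (v := ![c, -a, 0, 0, 0, 0, 0]) (by
      rw [comb]
      have h : c * b + -a * d = 0 := by linear_combination -hd
      have h' : c * a + -a * c = 0 := by ring
      rw [h, h']
      simp)
    have d0 : d = 0 := by simpa using congrFun e1 0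
    have b0 : b = 0 := by simpa using congrFun e1 1
    have c0 : c = 0 := by simpa using congrFun e2 0
    have a0 : a = 0 := by simpa using congrFun e2 1
    subst a0 b0 c0 d0
    have := inj (v := ![1, 0, 0, 0, 0, 0, 0]) (by rw [h0]; simp)
    simpa using congrFun this 0
  -- The orthogonal complement of the plane is given by the vanishing of coordinates 5 and 6. An
  -- isometry preserving the plane preserves it too.
  have hz {v : Fin 7 → k} (h5 : v 5 = 0) (h6 : v 6 = 0) :
      (mat k g *ᵥ v) 5 = 0 ∧ (mat k g *ᵥ v) 6 = 0 := by
    have b0 := bilQ_mat g ![1, 0, 0, 0, 0, 0, 0] v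
    have b1 := bilQ_mat g ![0, 1, 0, 0, 0, 0, 0] v
    rw [h0] at b0
    rw [h1] at b1
    simp [bilQ_apply, h5, h6] at b0 b1
    constructor
    · apply mul_left_cancel₀ hd
      linear_combination a * b1 - c * b0
    · apply mul_left_cancel₀ hd
      linear_combination d * b0 - b * b1
  have e0 (i : Fin 7) := congrFun ((mulVec_eq_entries (mat k g)).1.symm.trans h0) i
  have e1 (i : Fin 7) := congrFun ((mulVec_eq_entries (mat k g)).2.symm.trans h1) i
  have e2 := hz (v := Pi.single 2 1) (by simp) (by simp)
  have e3 := hz (v := Pi.single 3 1) (by simp) (by simp)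
  have e4 := hz (v := Pi.single 4 1) (by simp) (by simp)
  simp only [Matrix.mulVec_single_one, Matrix.col_apply] at e2 e3 e4
  intro i j hij
  fin_cases i <;> fin_cases j <;> simp at hij <;> simp [e0, e1, e2, e3, e4]

theorem toGL2_apply (p : parabolicSO7 k) (i j : Fin 2) :
    toGL2 k p i j = mat k p.1 (Fin.castLE (by norm_num) i) (Fin.castLE (by norm_num) j) := rfl

theorem toGL2_eq {p : parabolicSO7 k} {A : GL (Fin 2) k}
    (h0 : mat k p.1 *ᵥ ![1, 0, 0, 0, 0, 0, 0] = ![A 0 0, A 1 0, 0, 0, 0, 0, 0])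
    (h1 : mat k p.1 *ᵥ ![0, 1, 0, 0, 0, 0, 0] = ![A 0 1, A 1 1, 0, 0, 0, 0, 0]) :
    toGL2 k p = A := by
  have e0 (i : Fin 7) := congrFun ((mulVec_eq_entries (mat k p.1)).1.symm.trans h0) i
  have e1 (i : Fin 7) := congrFun ((mulVec_eq_entries (mat k p.1)).2.symm.trans h1) i
  ext i j
  rw [toGL2_apply]
  fin_cases i <;> fin_cases j
  · exact e0 0
  · exact e1 0
  · exact e0 1
  · exact e1 1

theorem mulVec_of_mem_parabolicSO7 (p : parabolicSO7 k) :
    mat k p.1 *ᵥ ![1, 0, 0, 0, 0, 0, 0] = ![toGL2 k p 0 0, toGL2 k p 1 0, 0, 0, 0, 0, 0] ∧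
    mat k p.1 *ᵥ ![0, 1, 0, 0, 0, 0, 0] = ![toGL2 k p 0 1, toGL2 k p 1 1, 0, 0, 0, 0, 0] := by
  rw [(mulVec_eq_entries _).1, (mulVec_eq_entries _).2]
  have hp := p.2
  constructor <;> ext i <;> fin_cases i
  any_goals rfl
  all_goals exact hp (by decide)

theorem fixing_mem_parabolicSO7 {g : SO7 k}
    (h0 : mat k g *ᵥ ![1, 0, 0, 0, 0, 0, 0] = ![1, 0, 0, 0, 0, 0, 0])
    (h1 : mat k g *ᵥ ![0, 1, 0, 0, 0, 0, 0] = ![0, 1, 0, 0, 0, 0, 0]) :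
    ∃ p : parabolicSO7 k, p.1 = g ∧ toGL2 k p = 1 :=
  ⟨⟨g, mem_parabolicSO7 h0 h1⟩, rfl, toGL2_eq (by simpa using h0) (by simpa using h1)⟩

theorem exists_parabolicSO7_eq_levi [NeZero (2 : k)] (A : GL (Fin 2) k) :
    ∃ p : parabolicSO7 k, p.1 = (levi A).1 ∧ toGL2 k p = A := by
  have h0 : mat k (levi A).1 *ᵥ ![1, 0, 0, 0, 0, 0, 0] = ![A 0 0, A 1 0, 0, 0, 0, 0, 0] := by
    rw [mat_levi_mulVec]
    simp
  have h1 : mat k (levi A).1 *ᵥ ![0, 1, 0, 0, 0, 0, 0] = ![A 0 1, A 1 1, 0, 0, 0, 0, 0] := by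
    rw [mat_levi_mulVec]
    simp
  exact ⟨⟨_, mem_parabolicSO7 h0 h1⟩, rfl, toGL2_eq h0 h1⟩

end Cosets

/-! ### Functions supported on one coset. -/

section Induced

variable {k : Type*} [Field k] {W : Type*} [AddCommGroup W] [Module ℂ W]
  (τ : Representation ℂ (GL (Fin 2) k) W)

/-- The space of the induced representation `inducedRep τ`. -/
abbrev InducedSpace : Type _ :=
  Representation.coindV (parabolicSO7 k).subtype (τ.comp (toGL2 k))

open Classical in
/-- The function in `I(τ)` supported on the coset of `g` with value `w` at `g`. -/
noncomputable def deltaFun (g : SO7 k) : W →ₗ[ℂ] InducedSpace τ where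
  toFun w := ⟨fun x => if h : x * g⁻¹ ∈ parabolicSO7 k then τ (toGL2 k ⟨_, h⟩) w else 0, by
    intro p x
    have hiff : (parabolicSO7 k).subtype p * x * g⁻¹ ∈ parabolicSO7 k ↔
        x * g⁻¹ ∈ parabolicSO7 k := by
      rw [mul_assoc]
      exact (parabolicSO7 k).mul_mem_cancel_left p.2
    beta_reduce
    by_cases h : x * g⁻¹ ∈ parabolicSO7 k
    · rw [dif_pos h, dif_pos (hiff.2 h), MonoidHom.comp_apply, ← Module.End.mul_apply, ← map_mul,
        ← map_mul]
      congr 3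
      exact Subtype.ext (mul_assoc _ _ _)
    · rw [dif_neg h, dif_neg (fun h' => h (hiff.1 h')), map_zero]⟩
  map_add' w w' := by
    ext x
    by_cases h : x * g⁻¹ ∈ parabolicSO7 k <;> simp [h]
  map_smul' c w := by
    ext x
    by_cases h : x * g⁻¹ ∈ parabolicSO7 k <;> simp [h]

variable {τ}

theorem deltaFun_of_mem {g x : SO7 k} (h : x * g⁻¹ ∈ parabolicSO7 k) (w : W) :
    (deltaFun τ g w).1 x = τ (toGL2 k ⟨_, h⟩) w := dif_pos h

theorem deltaFun_of_notMem {g x : SO7 k} (h : x * g⁻¹ ∉ parabolicSO7 k) (w : W) :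
    (deltaFun τ g w).1 x = 0 := dif_neg h

theorem inducedRep_apply (h : SO7 k) (ξ : InducedSpace τ) (x : SO7 k) :
    (inducedRep τ h ξ).1 x = ξ.1 (x * h) := rfl

theorem inducedRep_deltaFun (h g : SO7 k) (w : W) :
    inducedRep τ h (deltaFun τ g w) = deltaFun τ (g * h⁻¹) w := by
  apply Subtype.ext
  ext x
  rw [inducedRep_apply]
  have e : x * (g * h⁻¹)⁻¹ = x * h * g⁻¹ := by group
  by_cases hx : x * h * g⁻¹ ∈ parabolicSO7 k
  · rw [deltaFun_of_mem hx, deltaFun_of_mem (by rwa [e])]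
    congr 3
    exact Subtype.ext e.symm
  · rw [deltaFun_of_notMem hx, deltaFun_of_notMem (by rwa [e])]

theorem deltaFun_mul (p : parabolicSO7 k) (g : SO7 k) (w : W) :
    deltaFun τ (p.1 * g) w = deltaFun τ g (τ (toGL2 k p)⁻¹ w) := by
  apply Subtype.ext
  ext x
  have e : x * (p.1 * g)⁻¹ = x * g⁻¹ * p.1⁻¹ := by group
  have hiff : x * (p.1 * g)⁻¹ ∈ parabolicSO7 k ↔ x * g⁻¹ ∈ parabolicSO7 k := by
    rw [e]
    exact (parabolicSO7 k).mul_mem_cancel_right (inv_mem p.2)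
  by_cases hx : x * g⁻¹ ∈ parabolicSO7 k
  · rw [deltaFun_of_mem hx, deltaFun_of_mem (hiff.2 hx), ← Module.End.mul_apply, ← map_mul,
      ← map_inv, ← map_mul]
    congr 3
    exact Subtype.ext e
  · rw [deltaFun_of_notMem hx, deltaFun_of_notMem (fun h => hx (hiff.1 h))]

/-- The constant is the order of the parabolic subgroup, since each coset is counted once for each
of its elements. Hence the functions `deltaFun` span `I(τ)`. -/
theorem sum_deltaFun [Fintype (SO7 k)] :
    ∃ c : ℂ, c ≠ 0 ∧ ∀ ξ : InducedSpace τ, ∑ g, deltaFun τ g (ξ.1 g) = c • ξ := by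
  classical
  refine ⟨((Finset.univ.filter (· ∈ parabolicSO7 k)).card : ℂ), ?_, fun ξ => ?_⟩
  · exact Nat.cast_ne_zero.2 (Finset.card_ne_zero_of_mem (a := 1) (by simp))
  apply Subtype.ext
  ext x
  have e : ((∑ g, deltaFun τ g (ξ.1 g) : InducedSpace τ) : SO7 k → W) x =
      ∑ g, (deltaFun τ g (ξ.1 g)).1 x := by
    simp
  rw [e]
  have h (g : SO7 k) : (deltaFun τ g (ξ.1 g)).1 x =
      if x * g⁻¹ ∈ parabolicSO7 k then ξ.1 x else 0 := by
    split_ifs with hg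
    · rw [deltaFun_of_mem hg]
      have := ξ.2 ⟨_, hg⟩ g
      simp only [MonoidHom.comp_apply] at this
      rw [← this]
      simp
    · rw [deltaFun_of_notMem hg]
  simp only [h]
  rw [Fintype.sum_equiv ((Equiv.inv (SO7 k)).trans (Equiv.mulLeft x)) _
    (fun y => if y ∈ parabolicSO7 k then ξ.1 x else 0) fun g => by simp,
    ← Finset.sum_filter, Finset.sum_const]
  exact (Nat.cast_smul_eq_nsmul ℂ _ _).symm

end Induced
-- Mackey analysis of an intertwining map.
section Hom

variable {k : Type*} [Field k] [NeZero (2 : k)] {V : Type*} [AddCommGroup V] [Module ℂ V]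
  {ρ : Representation ℂ (G2 k) V} {W : Type*} [AddCommGroup W] [Module ℂ W]
  {τ : Representation ℂ (GL (Fin 2) k) W}
  (Φ : Representation.IntertwiningMap ((inducedRep τ).comp (G2 k).subtype) ρ)

theorem rep_apply_deltaFun (h : G2 k) (g : SO7 k) (w : W) :
    ρ h (Φ (deltaFun τ g w)) = Φ (deltaFun τ (g * h.1⁻¹) w) := by
  rw [← inducedRep_deltaFun]
  exact (Representation.IntertwiningMap.isIntertwining _ _ Φ h _).symm

/-- An element fixing the plane pointwise lies in the parabolic subgroup with trivial `GL₂(k)`-part,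
and the inducing representation is trivial on the `SO₃(k)`-part and the unipotent radical. -/
theorem rep_apply_deltaFun_of_fixes {h : G2 k} {g : SO7 k}
    (h0 : mat k (g * h.1⁻¹ * g⁻¹) *ᵥ ![1, 0, 0, 0, 0, 0, 0] = ![1, 0, 0, 0, 0, 0, 0])
    (h1 : mat k (g * h.1⁻¹ * g⁻¹) *ᵥ ![0, 1, 0, 0, 0, 0, 0] = ![0, 1, 0, 0, 0, 0, 0]) (w : W) :
    ρ h (Φ (deltaFun τ g w)) = Φ (deltaFun τ g w) := by
  obtain ⟨p, hp, hp1⟩ := fixing_mem_parabolicSO7 h0 h1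
  have e : g * h.1⁻¹ = p.1 * g := by rw [hp, inv_mul_cancel_right]
  rw [rep_apply_deltaFun, e, deltaFun_mul, hp1, inv_one, map_one, Module.End.one_apply]

theorem apply_deltaFun_mem_planeInv (w : W) : Φ (deltaFun τ 1 w) ∈ planeInv ρ := by
  intro g hg
  have e : (1 : SO7 k) * g.1⁻¹ * 1⁻¹ = g.1⁻¹ := by rw [one_mul, inv_one, mul_one]
  apply rep_apply_deltaFun_of_fixes
  · rw [e]
    exact mat_inv_mulVec hg.1
  · rw [e]
    exact mat_inv_mulVec hg.2

theorem levi_apply_deltaFun (A : GL (Fin 2) k) (w : W) :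
    ρ (levi A) (Φ (deltaFun τ 1 w)) = Φ (deltaFun τ 1 (τ A w)) := by
  obtain ⟨p, hp, h1⟩ := exists_parabolicSO7_eq_levi A
  have e : (levi A).1⁻¹ = (p⁻¹).1 * 1 := by rw [mul_one, Subgroup.coe_inv, hp]
  rw [rep_apply_deltaFun, one_mul, e, deltaFun_mul, map_inv (toGL2 k), inv_inv, h1]

/-- The plane of `e₁X⁺, e₃X⁻` represents the orbit of planes with zero product; cuspidality for `P'`
applies there because `V'` fixes it pointwise. -/
theorem mulVec_of_mem_unipV' {n : G2 k} (hn : n ∈ unipV' k) (p q : k) :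
    mat k n.1 *ᵥ ![p, 0, 0, 0, q, 0, 0] = ![p, 0, 0, 0, q, 0, 0] := by
  induction hn using Subgroup.closure_induction with
  | mem x hx =>
    obtain ⟨γ, hγ, r, rfl⟩ := hx
    rw [mat_rootElt]
    cases γ
    · exact absurd rfl hγ
    · simp [rootMatrix_b_mulVec]
    · simp [rootMatrix_ab_mulVec]
    · simp [rootMatrix_aab_mulVec]
    · simp [rootMatrix_aaab_mulVec]
    · simp [rootMatrix_aaabb_mulVec]
  | one => simp
  | mul x y _ _ hx hy => rw [Subgroup.coe_mul, mat_mul_mulVec, hy, hx]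
  | inv x _ hx => exact mat_inv_mulVec hx

theorem mulVec_conj_of_mem_unipV' {g h : SO7 k} {n : G2 k} (hn : n ∈ unipV' k) {v : Fin 7 → k}
    {p q : k} (hv : mat k h *ᵥ (mat k g⁻¹ *ᵥ v) = ![p, 0, 0, 0, q, 0, 0]) :
    mat k (g * (h⁻¹ * n.1 * h)⁻¹ * g⁻¹) *ᵥ v = v := by
  have e : g * (h⁻¹ * n.1 * h)⁻¹ * g⁻¹ = (h * g⁻¹)⁻¹ * n.1⁻¹ * (h * g⁻¹) := by group
  rw [← mat_mul_mulVec] at hv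
  rw [e, mat_mul_mulVec, mat_mul_mulVec, hv, mat_inv_mulVec (mulVec_of_mem_unipV' hn p q)]
  exact mat_inv_mulVec hv

/-- An intertwining map into a cuspidal representation vanishes if it vanishes on the functions
supported on the parabolic subgroup. -/
theorem IsCuspidal.apply_deltaFun_eq_zero [Finite k] (hρ : IsCuspidal ρ)
    (h : ∀ w, Φ (deltaFun τ 1 w) = 0) (g : SO7 k) (w : W) : Φ (deltaFun τ g w) = 0 := by
  have inj {v : Fin 7 → k} (hv : mat k g⁻¹ *ᵥ v = 0) : v = 0 := by
    rw [← mat_inv_mulVec hv, Matrix.mulVec_zero]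
  obtain ⟨h', ⟨a, b, c, d, h0, h1⟩ | ⟨a, b, c, d, h0, h1⟩⟩ := exists_map_plane
    (x := mat k g⁻¹ *ᵥ ![1, 0, 0, 0, 0, 0, 0]) (y := mat k g⁻¹ *ᵥ ![0, 1, 0, 0, 0, 0, 0])
    (by rw [bilQ_mat, bilQ_apply]; simp) (by rw [bilQ_mat, bilQ_apply]; simp)
    (by rw [bilQ_mat, bilQ_apply]; simp) (fun h0 => by simpa using congrFun (inj h0) 0)
  -- Orbit of the base plane: `g` lies in the parabolic subgroup times `G₂(k)`, so the value is a
  -- translate of one that vanishes.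
  · rw [← mat_mul_mulVec] at h0 h1
    have hp := mem_parabolicSO7 h0 h1
    have e : g = ((⟨h'.1 * g⁻¹, hp⟩ : parabolicSO7 k)⁻¹).1 * (1 * (h'⁻¹).1⁻¹) := by
      rw [Subgroup.coe_inv, Subgroup.coe_inv, inv_inv, one_mul, mul_inv_rev, inv_inv,
        inv_mul_cancel_right]
    rw [e, deltaFun_mul, ← rep_apply_deltaFun, h, map_zero]
  -- Other orbit: a conjugate of `V'` fixes the plane pointwise, hence fixes the value.
  · refine hρ.eq_zero (N := unipV' k) (by simp) h'⁻¹ fun n hn => ?_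
    rw [inv_inv]
    have e : (h'⁻¹ * n * h').1 = h'.1⁻¹ * n.1 * h'.1 := rfl
    apply rep_apply_deltaFun_of_fixes
    · rw [e]
      exact mulVec_conj_of_mem_unipV' hn h0
    · rw [e]
      exact mulVec_conj_of_mem_unipV' hn h1

theorem IsCuspidal.eq_zero_of_apply_deltaFun [Finite k] (hρ : IsCuspidal ρ)
    (h : ∀ w, Φ (deltaFun τ 1 w) = 0) : Φ = 0 := by
  have := Fintype.ofFinite (SO7 k)
  obtain ⟨c, hc, hsum⟩ := sum_deltaFun (τ := τ)
  refine Representation.IntertwiningMap.ext (LinearMap.ext fun ξ => ?_)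
  have h1 : Φ.toLinearMap (c • ξ) = 0 := by
    rw [← hsum, map_sum]
    exact Finset.sum_eq_zero fun g _ => hρ.apply_deltaFun_eq_zero Φ h g _
  rw [map_smul] at h1
  exact (smul_eq_zero.1 h1).resolve_left hc

/-- The functional on `τ` attached to an intertwining map and a functional on `ρ`. -/
noncomputable def toFunctional (τ : Representation ℂ (GL (Fin 2) k) W) (l : V →ₗ[ℂ] ℂ) :
    Representation.IntertwiningMap ((inducedRep τ).comp (G2 k).subtype) ρ →ₗ[ℂ] (W →ₗ[ℂ] ℂ) where
  toFun Φ := l ∘ₗ Φ.toLinearMap ∘ₗ deltaFun τ 1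
  map_add' Φ Φ' := by
    ext w
    exact map_add l _ _
  map_smul' c Φ := by
    rw [Representation.IntertwiningMap.toLinearMap_smul, LinearMap.smul_comp, LinearMap.comp_smul,
      RingHom.id_apply]

theorem toFunctional_apply (l : V →ₗ[ℂ] ℂ) (w : W) :
    toFunctional τ l Φ w = l (Φ (deltaFun τ 1 w)) := rfl

variable {ψ : AddChar k ℂ} {l : V →ₗ[ℂ] ℂ}

theorem toFunctional_upperHom
    (hl : ∀ (u : unipU k) (v : V), l (ρ u v) = whittakerChar ψ u * l v)
    (r : Multiplicative k) (w : W) :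
    toFunctional τ l Φ (τ (upperHom k r) w) = ψ.toMonoidHom r * toFunctional τ l Φ w := by
  have := hl ⟨rootElt .b r.toAdd, rootElt_mem_unipU _ _⟩ (Φ (deltaFun τ 1 w))
  rw [whittakerChar_beta] at this
  rw [toFunctional_apply, toFunctional_apply, ← levi_apply_deltaFun]
  have e : levi (upperHom k r) = rootElt .b r.toAdd := levi_upperHom r.toAdd
  rw [e]
  exact this

end Hom
-- An intertwining map is determined by its Whittaker functional.
section Injectivity

variable {k : Type*} [Field k] [NeZero (2 : k)] {V : Type*} [AddCommGroup V] [Module ℂ V]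
  {ρ : Representation ℂ (G2 k) V} {W : Type*} [AddCommGroup W] [Module ℂ W]
  {τ : Representation ℂ (GL (Fin 2) k) W} {ψ : AddChar k ℂ} {l : V →ₗ[ℂ] ℂ}

/-- The vectors whose translates by the Levi subgroup are killed by the functional `l`. -/
def leviKer (ρ : Representation ℂ (G2 k) V) (l : V →ₗ[ℂ] ℂ) : Submodule ℂ V :=
  ⨅ A : GL (Fin 2) k, LinearMap.ker (l ∘ₗ ρ (levi A))

theorem mem_leviKer {z : V} : z ∈ leviKer ρ l ↔ ∀ A, l (ρ (levi A) z) = 0 := by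
  simp [leviKer]

theorem levi_mem_leviKer {z : V} (hz : z ∈ leviKer ρ l) (A : GL (Fin 2) k) :
    ρ (levi A) z ∈ leviKer ρ l := by
  rw [mem_leviKer] at hz ⊢
  intro B
  rw [← Module.End.mul_apply, ← map_mul, ← map_mul]
  exact hz _

/-- The conjugate of `g` by a Levi element lies in `V`, hence in `U`, and acts on `l` by a scalar.
This makes `leviKer` stable under `P`. -/
theorem mem_leviKer_of_mulVec
    (hl : ∀ (u : unipU k) (v : V), l (ρ u v) = whittakerChar ψ u * l v) {z : V}
    (hz : z ∈ leviKer ρ l) {g : G2 k} {p q : k}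
    (h0 : mat k g.1 *ᵥ ![1, 0, 0, 0, 0, 0, 0] = ![1, 0, 0, 0, p, 0, 0])
    (h1 : mat k g.1 *ᵥ ![0, 1, 0, 0, 0, 0, 0] = ![0, 1, 0, 0, q, 0, 0]) :
    ρ g z ∈ leviKer ρ l := by
  rw [mem_leviKer] at hz ⊢
  intro A
  have comb (x y : k) :
      mat k g.1 *ᵥ ![x, y, 0, 0, 0, 0, 0] = ![x, y, 0, 0, x * p + y * q, 0, 0] := by
    have e : (![x, y, 0, 0, 0, 0, 0] : Fin 7 → k) =
      x • ![1, 0, 0, 0, 0, 0, 0] + y • ![0, 1, 0, 0, 0, 0, 0] := by simp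
    rw [e, Matrix.mulVec_add, Matrix.mulVec_smul, Matrix.mulVec_smul, h0, h1]
    simp
  have hu : levi A * g * levi A⁻¹ ∈ unipU k := by
    obtain ⟨B, hB⟩ : ∃ B, A⁻¹ = B := ⟨_, rfl⟩
    have hAB : A.val * B.val = 1 := by rw [← Units.val_mul, ← hB, mul_inv_cancel, Units.val_one]
    have e00 := congrFun (congrFun hAB 0) 0
    have e10 := congrFun (congrFun hAB 1) 0
    have e01 := congrFun (congrFun hAB 0) 1
    have e11 := congrFun (congrFun hAB 1) 1
    simp only [Matrix.mul_apply, Fin.sum_univ_two, Matrix.one_apply_eq] at e00 e10 e01 e11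
    rw [Matrix.one_apply_ne (by decide)] at e01 e10
    rw [hB]
    refine unipV_le_unipU (mem_unipV_of_mulVec (p := A.val.det * (B 0 0 * p + B 1 0 * q))
      (q := A.val.det * (B 0 1 * p + B 1 1 * q)) ?_ ?_)
    · rw [Subgroup.coe_mul, mat_mul_mulVec, Subgroup.coe_mul, mat_mul_mulVec, mat_levi_mulVec B]
      simp [comb, mat_levi_mulVec, e00, e10]
    · rw [Subgroup.coe_mul, mat_mul_mulVec, Subgroup.coe_mul, mat_mul_mulVec, mat_levi_mulVec B]
      simp [comb, mat_levi_mulVec, e01, e11]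
  have := hl ⟨_, hu⟩ (ρ (levi A) z)
  rw [hz, mul_zero] at this
  rw [← this]
  simp only [← Module.End.mul_apply, ← map_mul]
  rw [mul_assoc, ← map_mul, inv_mul_cancel, map_one, mul_one]

/-- An intertwining map into a cuspidal irreducible representation is determined by the attached
functional. -/
theorem eq_zero_of_toFunctional_eq_zero [Finite k] (hρ : ρ.IsIrreducible) (hc : IsCuspidal ρ)
    (hψ : ψ ≠ 1) (hl0 : l ≠ 0)
    (hl : ∀ (u : unipU k) (v : V), l (ρ u v) = whittakerChar ψ u * l v)
    {Φ : Representation.IntertwiningMap ((inducedRep τ).comp (G2 k).subtype) ρ}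
    (h : toFunctional τ l Φ = 0) : Φ = 0 := by
  have := Fintype.ofFinite (unipU k)
  refine hc.eq_zero_of_apply_deltaFun Φ fun w => ?_
  by_contra hy0
  have hy : Φ (deltaFun τ 1 w) ∈ leviKer ρ l := by
    rw [mem_leviKer]
    intro A
    rw [levi_apply_deltaFun, ← toFunctional_apply, h, LinearMap.zero_apply]
  obtain ⟨z, hz, hz0, hzU⟩ := hc.exists_whittaker_vector hψ
    (fun A z hz => levi_mem_leviKer hz A)
    (fun r z hz => mem_leviKer_of_mulVec hl hz (p := -r) (q := 0)
      (by rw [mat_rootElt, rootMatrix_a_mulVec]; simp)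
      (by rw [mat_rootElt, rootMatrix_a_mulVec]; simp))
    (fun r z hz => mem_leviKer_of_mulVec hl hz (p := 0) (q := r)
      (by rw [mat_rootElt, rootMatrix_ab_mulVec]; simp)
      (by rw [mat_rootElt, rootMatrix_ab_mulVec]; simp)) hy (apply_deltaFun_mem_planeInv Φ w) hy0
  -- By uniqueness, `l` cannot vanish on a nonzero Whittaker vector, whereas it vanishes on
  -- `leviKer`.
  refine hρ.functional_apply_ne_zero_of_gelfand (isGelfandInvolution_whittakerChar hψ)
    hl0 hl hz0 hzU ?_
  simpa using mem_leviKer.1 hz 1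

end Injectivity

/-! ### Construction of a nonzero intertwining map. -/

section Existence

variable {k : Type*} [Field k] [NeZero (2 : k)] {V : Type*} [AddCommGroup V] [Module ℂ V]
  {ρ : Representation ℂ (G2 k) V} {W : Type*} [AddCommGroup W] [Module ℂ W]
  {τ : Representation ℂ (GL (Fin 2) k) W} {ψ : AddChar k ℂ} {l : V →ₗ[ℂ] ℂ}

theorem coe_upperHom (r : k) : (upperHom k (.ofAdd r)).val = !![1, r; 0, 1] := by
  ext i j
  fin_cases i <;> fin_cases j <;> simp [upperHom]

/-- Conjugation by diagonal matrices permutes the nontrivial characters transitively, so genericity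
for some character gives it for the `ψ` chosen for `Π`. -/
theorem IsGenericGL2.exists_functional [Finite k] (hτ : IsGenericGL2 τ) (hψ : ψ ≠ 1) :
    ∃ m : W →ₗ[ℂ] ℂ, m ≠ 0 ∧
      ∀ r w, m (τ (upperHom k r) w) = ψ.toMonoidHom r * m w := by
  obtain ⟨ψ', hψ', l', hl0, hl'⟩ := hτ
  obtain ⟨a, ha⟩ := AddChar.exists_forall_eq_mul hψ' ψ
  have ha0 : a ≠ 0 := by
    rintro rfl
    refine hψ (DFunLike.ext _ _ fun x => ?_)
    rw [ha, zero_mul, AddChar.map_zero_eq_one, AddChar.one_apply]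
  obtain ⟨D, hD⟩ : ∃ D : GL (Fin 2) k, D.val = !![a, 0; 0, 1] :=
    ⟨mkGL2 a 0 0 1 (by simpa using ha0), rfl⟩
  refine ⟨l' ∘ₗ τ D, fun h => hl0 (LinearMap.ext fun w => ?_), fun r w => ?_⟩
  · have := LinearMap.congr_fun h (τ D⁻¹ w)
    rwa [LinearMap.comp_apply, ← Module.End.mul_apply, ← map_mul, mul_inv_cancel, map_one,
      Module.End.one_apply] at this
  · have e : D * upperHom k r = upperHom k (.ofAdd (a * r.toAdd)) * D := by
      apply Units.ext
      rw [Units.val_mul, Units.val_mul, hD, coe_upperHom, ← ofAdd_toAdd r, coe_upperHom]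
      simp
    rw [LinearMap.comp_apply, LinearMap.comp_apply, ← Module.End.mul_apply, ← map_mul, e, map_mul,
      Module.End.mul_apply]
    refine (hl' (a * r.toAdd) _).trans ?_
    rw [← ha]
    rfl

theorem exists_addChar_mul_ne_one (hψ : ψ ≠ 1) {c : k} (hc : c ≠ 0) : ∃ r, ψ (c * r) ≠ 1 := by
  obtain ⟨x, hx⟩ := AddChar.ne_one_iff.1 hψ
  exact ⟨c⁻¹ * x, by rwa [mul_inv_cancel_left₀ hc]⟩

/-- The Bessel function of a Whittaker vector is supported on unipotent elements of the Levi
subgroup `GL₂(k)`. -/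
theorem exists_eq_upperHom_of_apply_ne_zero (hψ : ψ ≠ 1)
    (hl : ∀ (u : unipU k) (v : V), l (ρ u v) = whittakerChar ψ u * l v) {z : V}
    (hz : z ∈ planeInv ρ) (ha : z ∈ rootEigen ρ ψ .a 1) (hab : z ∈ rootEigen ρ ψ .ab 0)
    (hb : z ∈ rootEigen ρ ψ .b 1) {B : GL (Fin 2) k} (hB : l (ρ (levi B) z) ≠ 0) :
    ∃ r, B = upperHom k r := by
  have hd := B.det_ne_zero
  obtain ⟨h1, h2⟩ := levi_mem_rootEigen hz ha hab B (m' := B 0 0 / B.val.det)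
    (n' := -B 1 0 / B.val.det) (by field_simp; ring) (by field_simp; ring)
  -- A root element acts on the translated vector by the transformed character, and on `l` by the
  -- Whittaker character. As the value of `l` is nonzero, the two agree. The same comparison for
  -- `α+β` and `β` fixes the remaining entries.
  have e1 : B 0 0 / B.val.det = 1 := by
    by_contra hne
    obtain ⟨r, hr⟩ := exists_addChar_mul_ne hψ hne
    have := hl ⟨rootElt .a r, rootElt_mem_unipU _ _⟩ (ρ (levi B) z)
    rw [whittakerChar_alpha, h1 r, map_smul, smul_eq_mul] at this
    exact hr (mul_right_cancel₀ hB this)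
  have e2 : -B 1 0 / B.val.det = 0 := by
    by_contra hne
    obtain ⟨r, hr⟩ := exists_addChar_mul_ne_one hψ hne
    have := hl ⟨rootElt .ab r, rootElt_mem_unipU _ _⟩ (ρ (levi B) z)
    rw [whittakerChar_of_ne _ _ (by simp) (by simp), h2 r, map_smul, smul_eq_mul] at this
    exact hr (mul_right_cancel₀ hB this)
  have e10 : B 1 0 = 0 := by simpa [hd] using e2
  have e11 : B 1 1 = 1 := by
    rw [div_eq_one_iff_eq hd] at e1
    have e00 := e1
    rw [Matrix.det_fin_two, e10, mul_zero, sub_zero] at e1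
    exact (mul_eq_left₀ (by rwa [e00])).1 e1.symm
  have e00 : B 0 0 = 1 := by
    by_contra hne
    obtain ⟨r, hr⟩ := exists_addChar_mul_ne hψ hne
    have e : B * upperHom k (.ofAdd r) = upperHom k (.ofAdd (B 0 0 * r)) * B := by
      apply Units.ext
      rw [Units.val_mul, Units.val_mul, coe_upperHom, coe_upperHom]
      ext i j
      fin_cases i <;> fin_cases j <;> simp [Matrix.mul_apply, Fin.sum_univ_two, e10, e11, add_comm]
    have e' := congrArg (fun C => l (ρ (levi C) z)) e
    simp only [map_mul, Module.End.mul_apply, levi_upperHom] at e'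
    have := hl ⟨rootElt .b (B 0 0 * r), rootElt_mem_unipU _ _⟩ (ρ (levi B) z)
    rw [whittakerChar_beta, ← e', hb r, map_smul, map_smul, smul_eq_mul, one_mul] at this
    exact hr (mul_right_cancel₀ hB this).symm
  refine ⟨.ofAdd (B 0 1), Units.ext ?_⟩
  rw [coe_upperHom]
  ext i j
  fin_cases i <;> fin_cases j <;> simp [e00, e10, e11]

/-- The intertwining map `ξ ↦ ∑ g, m (ξ g) • ρ(g⁻¹) v`. -/
noncomputable def sumMap [Fintype (G2 k)] (ρ : Representation ℂ (G2 k) V)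
    (τ : Representation ℂ (GL (Fin 2) k) W) (m : W →ₗ[ℂ] ℂ) (v : V) :
    Representation.IntertwiningMap ((inducedRep τ).comp (G2 k).subtype) ρ where
  toFun ξ := ∑ g : G2 k, m (ξ.1 g.1) • ρ g⁻¹ v
  map_add' ξ ξ' := by
    rw [← Finset.sum_add_distrib]
    refine Finset.sum_congr rfl fun g _ => ?_
    rw [← add_smul, ← map_add]
    rfl
  map_smul' c ξ := by
    rw [Finset.smul_sum]
    refine Finset.sum_congr rfl fun g _ => ?_
    rw [smul_smul, RingHom.id_apply]
    exact congrArg (· • ρ g⁻¹ v) (map_smul m c _)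
  isIntertwining' h := by
    refine LinearMap.ext fun ξ => ?_
    change ∑ g : G2 k, m ((inducedRep τ h.1 ξ).1 g.1) • ρ g⁻¹ v =
      ρ h (∑ g : G2 k, m (ξ.1 g.1) • ρ g⁻¹ v)
    rw [map_sum]
    refine Fintype.sum_equiv (Equiv.mulRight h) _ _ fun g => ?_
    rw [map_smul, ← Module.End.mul_apply, ← map_mul]
    congr 3
    rw [Equiv.coe_mulRight, mul_inv_rev, mul_inv_cancel_left]

theorem sumMap_apply [Fintype (G2 k)] (m : W →ₗ[ℂ] ℂ) (v : V) (ξ : InducedSpace τ) :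
    sumMap ρ τ m v ξ = ∑ g : G2 k, m (ξ.1 g.1) • ρ g⁻¹ v := rfl

/-- A nonzero term requires `g` in the parabolic subgroup, so that `g` is a Levi element up to
`planeFixer`. The support of the Bessel function makes that element upper unipotent, and there the
characters of `m` and `z` cancel. -/
theorem deltaFun_term_eq (hψ : ψ ≠ 1)
    (hl : ∀ (u : unipU k) (v : V), l (ρ u v) = whittakerChar ψ u * l v) {z : V} (hz1 : l z = 1)
    (hz : z ∈ planeInv ρ) (ha : z ∈ rootEigen ρ ψ .a 1) (hab : z ∈ rootEigen ρ ψ .ab 0)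
    (hb : z ∈ rootEigen ρ ψ .b 1) {m : W →ₗ[ℂ] ℂ}
    (hm : ∀ r w, m (τ (upperHom k r) w) = ψ.toMonoidHom r * m w) (w : W) (g : G2 k) :
    m ((deltaFun τ 1 w).1 g.1) * l (ρ g⁻¹ z) = 0 ∨
      m ((deltaFun τ 1 w).1 g.1) * l (ρ g⁻¹ z) = m w := by
  by_cases hg : g.1 * 1⁻¹ ∈ parabolicSO7 k
  swap
  · rw [deltaFun_of_notMem hg, map_zero, zero_mul]
    exact .inl rfl
  rw [deltaFun_of_mem hg]
  obtain ⟨A, hA⟩ : ∃ A, toGL2 k ⟨_, hg⟩ = A := ⟨_, rfl⟩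
  have hv := mulVec_of_mem_parabolicSO7 ⟨_, hg⟩
  have hg1 : g.1 * 1⁻¹ = g.1 := by rw [inv_one, mul_one]
  simp only [hA] at hv
  rw [hg1] at hv
  have hgA : ρ g⁻¹ z = ρ (levi A⁻¹) z := by
    have hn : (levi A⁻¹ * g)⁻¹ ∈ planeFixer k := by
      refine inv_mem ⟨?_, ?_⟩
      · rw [Subgroup.coe_mul, mat_mul_mulVec, hv.1, map_inv, Subgroup.coe_inv]
        apply mat_inv_mulVec
        rw [mat_levi_mulVec]
        simp
      · rw [Subgroup.coe_mul, mat_mul_mulVec, hv.2, map_inv, Subgroup.coe_inv]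
        apply mat_inv_mulVec
        rw [mat_levi_mulVec]
        simp
    have := levi_mem_planeInv hz A⁻¹ _ hn
    rwa [← Module.End.mul_apply, ← map_mul, mul_inv_rev, inv_mul_cancel_right] at this
  rw [hA, hgA]
  by_cases h0 : l (ρ (levi A⁻¹) z) = 0
  · exact .inl (by rw [h0, mul_zero])
  right
  obtain ⟨r, hr⟩ := exists_eq_upperHom_of_apply_ne_zero hψ hl hz ha hab hb h0
  have e : levi (upperHom k r) = rootElt .b r.toAdd := levi_upperHom r.toAdd
  have hA' : A = upperHom k r⁻¹ := by rw [map_inv, ← hr, inv_inv]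
  rw [hr, e, hb, hA', hm, map_smul, hz1, one_mul, smul_eq_mul, mul_one]
  have h1 : ψ.toMonoidHom r⁻¹ * ψ r.toAdd = 1 :=
    (map_mul ψ.toMonoidHom r⁻¹ r).symm.trans (by rw [inv_mul_cancel, map_one])
  rw [mul_right_comm, h1, one_mul]

theorem exists_toFunctional_ne_zero [Finite k] (hψ : ψ ≠ 1) (hl0 : l ≠ 0)
    (hl : ∀ (u : unipU k) (v : V), l (ρ u v) = whittakerChar ψ u * l v) (hτ : IsGenericGL2 τ) :
    ∃ Φ : Representation.IntertwiningMap ((inducedRep τ).comp (G2 k).subtype) ρ,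
      toFunctional τ l Φ ≠ 0 := by
  have := Fintype.ofFinite (unipU k)
  have := Fintype.ofFinite (G2 k)
  obtain ⟨m, hm0, hm⟩ := hτ.exists_functional hψ
  obtain ⟨z, hz1, hz⟩ := Representation.exists_eigenvector_of_functional
    (ι := (unipU k).subtype) hl0 hl
  have ha : z ∈ rootEigen ρ ψ .a 1 := fun r => by
    have := hz ⟨rootElt .a r, rootElt_mem_unipU _ _⟩
    rw [one_mul]
    rwa [whittakerChar_alpha] at this
  have hb : z ∈ rootEigen ρ ψ .b 1 := fun r => by
    have := hz ⟨rootElt .b r, rootElt_mem_unipU _ _⟩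
    rw [one_mul]
    rwa [whittakerChar_beta] at this
  have hfix {γ : PosRoot} (ha : γ ≠ .a) (hb : γ ≠ .b) (r : k) : ρ (rootElt γ r) z = z := by
    have := hz ⟨rootElt γ r, rootElt_mem_unipU _ _⟩
    rwa [whittakerChar_of_ne _ _ ha hb, one_smul] at this
  have hab : z ∈ rootEigen ρ ψ .ab 0 := fun r => by
    rw [zero_mul, AddChar.map_zero_eq_one, one_smul]
    exact hfix (by simp) (by simp) r
  have hU : z ∈ planeInv ρ := fun g hg => by
    obtain ⟨r, s, t, rfl⟩ := exists_eq_of_fixes_plane hg.1 hg.2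
    simp [hfix]
  obtain ⟨w, hw⟩ : ∃ w, m w ≠ 0 := by
    by_contra! h
    exact hm0 (LinearMap.ext h)
  refine ⟨sumMap ρ τ m z, fun h => ?_⟩
  have h1 := LinearMap.congr_fun h w
  rw [toFunctional_apply, sumMap_apply, map_sum, LinearMap.zero_apply] at h1
  classical
  -- Every term is 0 or `m w`, so the sum is `m w` times a count, and no cancellation can occur. The
  -- term of `g = 1` shows that the count is positive.
  have h2 (g : G2 k) : l (m ((deltaFun τ 1 w).1 g.1) • ρ g⁻¹ z) =
      if m ((deltaFun τ 1 w).1 g.1) * l (ρ g⁻¹ z) = m w then m w else 0 := by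
    rw [map_smul, smul_eq_mul]
    split_ifs with h
    · exact h
    · exact (deltaFun_term_eq hψ hl hz1 hU ha hab hb hm w g).resolve_right h
  rw [Finset.sum_congr rfl fun g _ => h2 g, ← Finset.sum_filter, Finset.sum_const,
    smul_eq_zero] at h1
  have h3 := Finset.card_eq_zero.1 (h1.resolve_right hw)
  rw [Finset.filter_eq_empty_iff] at h3
  apply h3 (Finset.mem_univ 1)
  have hmem : ((1 : G2 k).1 * 1⁻¹ : SO7 k) ∈ parabolicSO7 k := by simp
  have hone : (⟨_, hmem⟩ : parabolicSO7 k) = 1 := Subtype.ext (by simp)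
  rw [deltaFun_of_mem hmem, hone, map_one, map_one, inv_one, map_one, Module.End.one_apply,
    Module.End.one_apply, hz1, mul_one]

/-- A nonzero functional determines the intertwining maps up to scalars. -/
theorem exists_smul_eq_of_toFunctional_ne_zero [Finite k] (hρ : ρ.IsIrreducible)
    (hc : IsCuspidal ρ) (hτ : τ.IsIrreducible) (hψ : ψ ≠ 1) (hl0 : l ≠ 0)
    (hl : ∀ (u : unipU k) (v : V), l (ρ u v) = whittakerChar ψ u * l v)
    {Φ : Representation.IntertwiningMap ((inducedRep τ).comp (G2 k).subtype) ρ}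
    (hΦ : toFunctional τ l Φ ≠ 0)
    (Φ' : Representation.IntertwiningMap ((inducedRep τ).comp (G2 k).subtype) ρ) :
    ∃ c : ℂ, c • Φ = Φ' := by
  have := Fintype.ofFinite (Multiplicative k)
  obtain ⟨c, hcΦ⟩ := hτ.functional_eq_smul_of_gelfand (isGelfandInvolution_upperHom hψ) hΦ
    (toFunctional_upperHom Φ hl) (toFunctional_upperHom Φ' hl)
  refine ⟨c, (sub_eq_zero.1 ?_).symm⟩
  refine eq_zero_of_toFunctional_eq_zero hρ hc hψ hl0 hl ?_
  rw [map_sub, map_smul, hcΦ, sub_self]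

end Existence

end G2SO7

theorem proposition1p3 {k : Type*} [Field k] [Finite k] [NeZero (2 : k)]
    {V : Type*} [AddCommGroup V] [Module ℂ V] (ρ : Representation ℂ (G2SO7.G2 k) V)
    (hρ : ρ.IsIrreducible) (hρ_generic : G2SO7.IsGeneric ρ) (hρ_cuspidal : G2SO7.IsCuspidal ρ)
    {W : Type*} [AddCommGroup W] [Module ℂ W] (τ : Representation ℂ (GL (Fin 2) k) W)
    (hτ : τ.IsIrreducible) (hτ_generic : G2SO7.IsGenericGL2 τ) :
    Module.finrank ℂ (Representation.IntertwiningMap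
      ((G2SO7.inducedRep τ).comp (G2SO7.G2 k).subtype) ρ) = 1 := by
  obtain ⟨ψ, hψ, l, hl0, hl⟩ := hρ_generic
  obtain ⟨Φ, hΦ⟩ := G2SO7.exists_toFunctional_ne_zero hψ hl0 hl hτ_generic
  have hΦ0 : Φ ≠ 0 := by
    intro h
    exact hΦ (by rw [h, map_zero])
  exact finrank_eq_one Φ hΦ0 (G2SO7.exists_smul_eq_of_toFunctional_ne_zero hρ hρ_cuspidal hτ hψ
    hl0 hl hΦ)
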